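/- \textbf{Language.} Fix a language of arithmetic (symbols $0,S,=$ and possibly others, all interpreted in $\mathbb N$), and a quantifier-free formula $B(x,y,X)$ of it in which the set variable $X$ occurs only positively and which contains no closed terms. Let $I$ be a new unary predicate. Terms and quantifier-free formulas are built from these symbols and, recursively, from a $k$-ary Skolem function $c_{\exists x\,\phi}$ for every quantifier-free $\phi(x,y_1,\dots,y_k)$ containing no closed terms (\emph{simple} $\phi$). $\exists x\,\phi(x,\vec t)$ abbreviates $\phi(c_{\exists x\phi}(\vec t),\vec t)$, $\forall x\,\phi(x,\vec t)$ abbreviates $\phi(c_{\exists x\neg\phi}(\vec t),\vec t)$, and $A(y,X)=\forall x\,B(x,y,X)$. \emph{Canonical expressions} are the terms $c(\vec n)$ and the formulas $n\in I$ with numerals $\vec n,n$; put $c_n=c_{\exists x\,\neg B(x,y,I)}(n)$. Let $rk_s$ be the Skolem nesting depth. Ranks: $rk(n\in I)=rk(c_n)=\Omega$; otherwise $rk(c_{\exists x\phi}(\vec n))$ is $rk_s(c_{\exists x\phi})$ if $I$ does not occur in $\phi$ (not even inside the index of a Skolem symbol; $c_{\exists x\neg B}$ counts as containing $I$), and $\Omega+rk_s(c_{\exists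 x\phi})+1$ if it does; $\Omega$ exceeds all natural numbers. \textbf{Substitutions.} An $\epsilon$-substitution $S$ is a partial function on canonical expressions; terms get positive numerals or $?$, formulas get $\top$ or $?$. $|E|_S$ replaces canonical expressions in $\operatorname{dom}S$ by their values ($?$ counts as $0$, resp. $\bot$) and computes arithmetical terms; $S\vDash\phi$ means that $|\phi|_S$ is a true arithmetical sentence, $S$ \emph{decides} $\phi$ if $S\vDash\phi$ or $S\vDash\neg\phi$. $\overline S$ extends $S$ by $?$ everywhere else. $F(e,?)=\top$, $F(c_{\exists x\phi}(\vec n),u)=\phi(u,\vec n)\wedge\bigwedge_{v<u}\neg\phi(v,\vec n)$, $F(n\in I,\top)=A(n,I)$. $S$ is \emph{correct} if $\overline S\vDash F(e,u)$ for all $(e,u)\in S$; \emph{computationally inconsistent} if $S\vDash\neg F(e,u)$ for some $(e,u)\in S$ or $(c_n,u),(n\in I,\top)\in S$ for some $n$ and $u\ne{?}$. Pairs $(n\in I,\top),(c_n,?)$ are positive, $(n\in I,?)$ and $(c_n,u)$, $u\neq{?}$, negative; $S^-$ is the set of negative pairs of $S$. Fix closed critical formulas $Cr_J$ (finitely many),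 each of the form $\neg s=0\to\exists x\,s=Sx$ (Pred); $\phi(t,\vec s)\to\exists x\,\phi(x,\vec s)$ (Epsilon); $\phi(0,\vec s)\wedge\neg\phi(t,\vec s)\to\exists x(\phi(x,\vec s)\wedge\neg\phi(Sx,\vec s))$ (Induction); $A(t,I)\to t\in I$; $\forall x(A(x,\phi)\to\phi(x,\vec s))\to\forall x(x\in I\to\phi(x,\vec s))$ (Closure), with $\phi$ simple and $\vec s,t$ closed. $S$ is \emph{solving} if $\overline S\vDash Cr_J$ for all $J$. \textbf{$H$-step.} A \emph{history} $(P,V)$ is a finite list $P$ of distinct formulas $n\in I$ and a function $V$ on them whose values are finite sets of negative pairs that are $\epsilon$-substitutions. $P$ is \emph{admissible} if, for each entry $n\in I$ of $P$, $B(0,n,I)$ is true when exactly the earlier entries are. For correct nonsolving $S$ with history $(P,V)$, where $P$ lists the $n\in I$ with value $\top$ in $S$, each $Cr_J$ with $\overline S\not\vDash Cr_J$ proposes a pair $(e_J,v_J)$ (all values computed in $\overline S$): Pred: $c_{\exists x\,y=Sx}(|s|)$ and $|s|-1$; Epsilon: $c_{\exists x\phi}(|\vec s|)$ and $|t|$;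 Induction: $c_{\exists x(\phi(x)\wedge\neg\phi(Sx))}(|\vec s|)$ and the least $m<|t|$ with $\phi(m,\vec s)\wedge\neg\phi(m+1,\vec s)$; $A(t,I)\to t\in I$: the formula $|t|\in I$ and $\top$; Closure: let $n\in I$ be the first entry of $P$ with $\overline S\vDash\neg\phi(n,\vec s)$; if $\overline S\vDash\neg A(n,\phi)$, then $c_n$ and $|c_{\exists x\neg B(x,y,\phi)}(n,\vec s)|$; otherwise $c_{\exists x\,\neg(A(x,\phi)\to\phi(x))}(|\vec s|)$ and $n$. The $H$-expression $e$ and $H$-value $v$ are the pair of least $rk(e_J)$, with $J$ least. The \emph{$H$-step applies} if $S$ is correct and nonsolving, $(e,?)\in S$ and all these calculations can be made in $S$: $S$ decides every $Cr_J$ and, for each unsatisfied one, evaluates and decides whatever is consulted (for Induction, $\phi(m,\vec s)$ for all $m\le|t|$; for Closure, $\phi(m,\vec s)$ for the entries of $P$ up to $n$, and $A(n,\phi)$); moreover $n\in I\in\operatorname{dom}S$ if $e=c_n$, $c_n\in\operatorname{dom}S$ if $e$ is $n\in I$, and if $e$ is some $c_n$ then $m\in I\in\operatorname{dom}S$ for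 all $(c_m,?)\in S$. Then $H(S,P,V)$ is: if $rk(e)\ne\Omega$, $S_{\le rk(e)}$ with the value of $e$ changed to $v$, with $(P,V)$ kept if $rk(e)>\Omega$ and emptied if $rk(e)<\Omega$; if $e$ is $n\in I$, $S_{<\Omega}$, the positive pairs of $S$ and $(n\in I,\top)$, with $n\in I$ appended to $P$ and $V(n\in I)=S^-$; if $e=c_n$, let $P'$ be the part of $P$ before $n\in I$ (all of $P$ if $n\in I$ is not in $P$): $S_{<\Omega}$, the pairs $(m\in I,\top),(c_m,?)\in S$ with $m\in I$ in $P'$, the pairs of $V(n\in I)$ (of $S^-$ if $n\in I$ is not in $P$; where $V(n\in I)$ conflicts with the other pairs, these prevail), and $(c_n,v)$, with history $P',V\upharpoonright P'$. \textbf{Sequents and rules.} A \emph{sequent} $\Theta=(S,P,V,F)$ consists of such $S,P,V$ and $F:\{e\in\operatorname{dom}S: S(e)={?}\text{ or }rk(e)=\Omega\}\to\{t,f\}$ (temporary, fixed). $H(\Theta)$ keeps $F$ on old expressions and sets it to $t$ on new ones. $e'\in\operatorname{dom}S$ is \emph{active} if $rk(e')=rk(e)$ for the $H$-expression $e$ and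 $H(\Theta)$ does not contain $(e',S(e'))$. $(e,u,i),\Theta$ adds to $\Theta$ a pair with $e\notin\operatorname{dom}S$ and $F(e)=i$ ($(e,u),\Theta$ if $F(e)$ is not needed). Axioms: $AxF$: $S$ is computationally inconsistent; $AxS$: $S$ is solving; $AxH_{e,v}$: the $H$-step applies with $H$-expression $e$ and $H$-value $v$ and some active $e'$ has $F(e')=f$. Rules with conclusion $\Theta$ ($u$ ranging over positive numerals): for a term $e$ of rank $\ne\Omega$, $Cut_e$ from $(e,?,f),\Theta$ and all $(e,u),\Theta$, and $CutFr_e$ from $(e,?,t),\Theta$ and all $(e,u),\Theta$; for a term $e$ of rank $\Omega$, $Cut^{\Omega,\mathrm{term}}_e$ from $(e,?,f),\Theta$ and all $(e,u,f),\Theta$, and $CutFr^{\Omega,\mathrm{term}}_e$ from $(e,?,t),\Theta$ and all $(e,u,f),\Theta$; for a formula $e$, $Cut^{\Omega,\mathrm{form}}_e$ from $(e,?,f),\Theta$ and all sequents arising from $\Theta$ by appending to $(P,V)$ a history $(P_e,V_e)$ with last entry $e$ and giving all entries of $P_e$ the value $\top$ and $F=f$, where no entry $m\in I$ of $P_e$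 is in $\operatorname{dom}S$ or has $(c_m,u)\in S$ with $u\neq{?}$, and $P{}^\frown P_e$ is admissible; $Fr_e$ from $(e,?,t),\Theta$; $H_{e,v}$ from $H(\Theta)$, if the $H$-step applies to $\Theta$ with $H$-expression $e$ and $H$-value $v$ and all active expressions, including $e$, are temporary. \emph{Deductions} from a set of sequents are well-founded trees built from its members, axioms and rules; \emph{derivations} are deductions from $\emptyset$. An \emph{$\Omega+1$-deduction} has only $Cut$s (of all three kinds) of rank $<\Omega+1$, no $CutFr$s, and only $Fr$ and $H$ inferences of rank $\ge\Omega+1$. An \emph{$\Omega^*$-deduction} has only $Cut$s of rank $\le\Omega$, none of them $Cut^{\Omega,\mathrm{term}}$, $CutFr$s of rank $=\Omega$, $Fr$s of rank $>\Omega$ and $H$s of rank $\ge\Omega$. An \emph{$\Omega+1$-path} is a path $\emptyset=\Theta_0,\dots,\Theta_n$ starting at the root of some $\Omega+1$-deduction of the empty sequent from some set. $\Theta^{\mathrm{term}\to t}$ is $\Theta$ with $F(e)$ changed to $t$ for all rank-$\Omega$ terms $e$ with $S(e)={?}$. \textbf{Lemma.} Suppose there is an $\Omega+1$-derivation of $\Theta$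 and an $\Omega+1$-path $\emptyset=\Theta_0,\dots,\Theta_n=\Theta$. Suppose that for each $i<n$ such that $\Theta_{i+1}=(e,?,f),\Theta_i$ with a term $e$ of rank $\Omega$ there is a family $\{d_{e,v}\}_v$, $v$ ranging over the positive numerals, where each $d_{e,v}$ is an $\Omega^*$-derivation of $(e,v,f),\Theta_i^{\mathrm{term}\to t}$. Then there is an $\Omega^*$-derivation of $\Theta^{\mathrm{term}\to t}$ in which no axiom is an instance of $AxH_{c_n,v}$ with $(n\in I,\top)$ absent from it. -/

import Mathlib

noncomputable section

namespace EpsID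

open scoped Classical

/-! ## The Skolemized language -/

/-- A language of arithmetic with its interpretation in the standard model `ℕ`: it contains
`0`, `S`, `=`, and whatever other function and relation symbols one wishes to have. -/
structure ArithLanguage where
  Fn : ℕ → Type
  Rel : ℕ → Type
  fn : ∀ {k : ℕ}, Fn k → (Fin k → ℕ) → ℕ
  rel : ∀ {k : ℕ}, Rel k → (Fin k → ℕ) → Prop
  zero : Fn 0
  succ : Fn 1
  eq : Rel 2
  fn_zero : ∀ a, fn zero a = 0
  fn_succ : ∀ a, fn succ a = a 0 + 1
  rel_eq : ∀ a, rel eq a ↔ a 0 = a 1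

inductive Kind where
  | tm
  | fml

/-- Terms (kind `tm`) and quantifier-free formulas (kind `fml`) with free variables among
`var 0, …, var (n - 1)`.  `sk φ t` is the Skolem term `c_{∃x φ(x, y₁, …, y_k)}(t₁, …, t_k)`, where
`x` is `var 0` and `y_i` is `var i` in `φ`.  `mem t` is the formula `t ∈ I`. -/
inductive Expr (L : ArithLanguage) : Kind → ℕ → Type where
  | var {n : ℕ} (i : Fin n) : Expr L .tm n
  | fn {n k : ℕ} (f : L.Fn k) (t : Fin k → Expr L .tm n) : Expr L .tm n
  | sk {n k : ℕ} (φ : Expr L .fml (k + 1)) (t : Fin k → Expr L .tm n) : Expr L .tm n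
  | rel {n k : ℕ} (R : L.Rel k) (t : Fin k → Expr L .tm n) : Expr L .fml n
  | mem {n : ℕ} (t : Expr L .tm n) : Expr L .fml n
  | top {n : ℕ} : Expr L .fml n
  | bot {n : ℕ} : Expr L .fml n
  | neg {n : ℕ} (φ : Expr L .fml n) : Expr L .fml n
  | and {n : ℕ} (φ ψ : Expr L .fml n) : Expr L .fml n
  | or {n : ℕ} (φ ψ : Expr L .fml n) : Expr L .fml n

abbrev Tm (L : ArithLanguage) (n : ℕ) : Type := Expr L .tm n
abbrev Fml (L : ArithLanguage) (n : ℕ) : Type := Expr L .fml n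

/-- A Skolem function symbol `c_{∃x φ(x, y₁, …, y_k)}`. -/
abbrev SkolemFn (L : ArithLanguage) : Type := Σ k : ℕ, Fml L (k + 1)

namespace Expr

variable {L : ArithLanguage}

def zero {n : ℕ} : Tm L n := .fn L.zero ![]
def succ {n : ℕ} (t : Tm L n) : Tm L n := .fn L.succ ![t]
def eq {n : ℕ} (s t : Tm L n) : Fml L n := .rel L.eq ![s, t]
def imp {n : ℕ} (φ ψ : Fml L n) : Fml L n := .or (.neg φ) ψ

/-- The numeral `S (S (… 0))`. -/
def numeral {n : ℕ} : ℕ → Tm L n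
  | 0 => zero
  | m + 1 => succ (numeral m)

/-- Some variable occurs.  The variables of the index `φ` of a Skolem symbol are bound. -/
def HasVar : {κ : Kind} → {n : ℕ} → Expr L κ n → Prop
  | _, _, .var _ => True
  | _, _, .fn _ t => ∃ i, (t i).HasVar
  | _, _, .sk _ t => ∃ i, (t i).HasVar
  | _, _, .rel _ t => ∃ i, (t i).HasVar
  | _, _, .mem t => t.HasVar
  | _, _, .top => False
  | _, _, .bot => False
  | _, _, .neg φ => φ.HasVar
  | _, _, .and φ ψ => φ.HasVar ∨ ψ.HasVar
  | _, _, .or φ ψ => φ.HasVar ∨ ψ.HasVar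

/-- The expression contains no closed terms. -/
def Simple : {κ : Kind} → {n : ℕ} → Expr L κ n → Prop
  | _, _, .var _ => True
  | _, _, .fn _ t => (∃ i, (t i).HasVar) ∧ ∀ i, (t i).Simple
  | _, _, .sk _ t => (∃ i, (t i).HasVar) ∧ ∀ i, (t i).Simple
  | _, _, .rel _ t => ∀ i, (t i).Simple
  | _, _, .mem t => t.Simple
  | _, _, .top => True
  | _, _, .bot => True
  | _, _, .neg φ => φ.Simple
  | _, _, .and φ ψ => φ.Simple ∧ ψ.Simple
  | _, _, .or φ ψ => φ.Simple ∧ ψ.Simple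

/-- The expression belongs to the Skolemized language: Skolem symbols `c_{∃x φ}` exist only for
simple `φ` of the Skolemized language. -/
def InLang : {κ : Kind} → {n : ℕ} → Expr L κ n → Prop
  | _, _, .var _ => True
  | _, _, .fn _ t => ∀ i, (t i).InLang
  | _, _, .sk φ t => φ.Simple ∧ φ.InLang ∧ ∀ i, (t i).InLang
  | _, _, .rel _ t => ∀ i, (t i).InLang
  | _, _, .mem t => t.InLang
  | _, _, .top => True
  | _, _, .bot => True
  | _, _, .neg φ => φ.InLang
  | _, _, .and φ ψ => φ.InLang ∧ ψ.InLang
  | _, _, .or φ ψ => φ.InLang ∧ ψ.InLang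

/-- No Skolem function symbol occurs. -/
def SkolemFree : {κ : Kind} → {n : ℕ} → Expr L κ n → Prop
  | _, _, .var _ => True
  | _, _, .fn _ t => ∀ i, (t i).SkolemFree
  | _, _, .sk _ _ => False
  | _, _, .rel _ t => ∀ i, (t i).SkolemFree
  | _, _, .mem t => t.SkolemFree
  | _, _, .top => True
  | _, _, .bot => True
  | _, _, .neg φ => φ.SkolemFree
  | _, _, .and φ ψ => φ.SkolemFree ∧ ψ.SkolemFree
  | _, _, .or φ ψ => φ.SkolemFree ∧ ψ.SkolemFree

/-- `Polar true φ`: all (displayed) occurrences of `I` in `φ` are positive; `Polar false φ`: all are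
negative. -/
def Polar : {κ : Kind} → {n : ℕ} → Bool → Expr L κ n → Prop
  | _, _, _, .var _ => True
  | _, _, _, .fn _ _ => True
  | _, _, _, .sk _ _ => True
  | _, _, _, .rel _ _ => True
  | _, _, b, .mem _ => b = true
  | _, _, _, .top => True
  | _, _, _, .bot => True
  | _, _, b, .neg φ => φ.Polar (!b)
  | _, _, b, .and φ ψ => φ.Polar b ∧ ψ.Polar b
  | _, _, b, .or φ ψ => φ.Polar b ∧ ψ.Polar b

/-- A formula of the language of arithmetic: neither Skolem symbols nor `I` occur. -/
def IsPA : {κ : Kind} → {n : ℕ} → Expr L κ n → Prop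
  | _, _, .var _ => True
  | _, _, .fn _ t => ∀ i, (t i).IsPA
  | _, _, .sk _ _ => False
  | _, _, .rel _ t => ∀ i, (t i).IsPA
  | _, _, .mem _ => False
  | _, _, .top => True
  | _, _, .bot => True
  | _, _, .neg φ => φ.IsPA
  | _, _, .and φ ψ => φ.IsPA ∧ ψ.IsPA
  | _, _, .or φ ψ => φ.IsPA ∧ ψ.IsPA

/-- Simultaneous substitution: `var i` becomes `σ i`, and each atom `t ∈ I` becomes `χ(t)`. -/
def replace {m : ℕ} (χ : Tm L m → Fml L m) :
    {κ : Kind} → {n : ℕ} → (Fin n → Tm L m) → Expr L κ n → Expr L κ m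
  | _, _, σ, .var i => σ i
  | _, _, σ, .fn f t => .fn f fun i => (t i).replace χ σ
  | _, _, σ, .sk φ t => .sk φ fun i => (t i).replace χ σ
  | _, _, σ, .rel R t => .rel R fun i => (t i).replace χ σ
  | _, _, σ, .mem t => χ (t.replace χ σ)
  | _, _, _, .top => .top
  | _, _, _, .bot => .bot
  | _, _, σ, .neg φ => .neg (φ.replace χ σ)
  | _, _, σ, .and φ ψ => .and (φ.replace χ σ) (ψ.replace χ σ)
  | _, _, σ, .or φ ψ => .or (φ.replace χ σ) (ψ.replace χ σ)

/-- Substitution of terms for variables. -/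
def subst {κ : Kind} {n m : ℕ} (σ : Fin n → Tm L m) (E : Expr L κ n) : Expr L κ m :=
  E.replace .mem σ

/-- `φ(t, s₁, …, s_k)` for `φ(x, y₁, …, y_k)`. -/
def app {k m : ℕ} (φ : Fml L (k + 1)) (t : Tm L m) (s : Fin k → Tm L m) : Fml L m :=
  φ.subst (Fin.cons t s)

/-- `∃x φ(x, s)` as an abbreviation for `φ(c_{∃x φ}(s), s)`. -/
def ex {k m : ℕ} (φ : Fml L (k + 1)) (s : Fin k → Tm L m) : Fml L m :=
  φ.app (.sk φ s) s

/-- `∀x φ(x, s)` as an abbreviation for `φ(c_{∃x ¬φ}(s), s)`. -/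
def all {k m : ℕ} (φ : Fml L (k + 1)) (s : Fin k → Tm L m) : Fml L m :=
  φ.app (.sk φ.neg s) s

/-- The least `n` such that the expression belongs to the `n`-th stage of the Skolemization. -/
def simpleRank : {κ : Kind} → {n : ℕ} → Expr L κ n → ℕ
  | _, _, .var _ => 0
  | _, _, .fn _ t => Finset.univ.sup fun i => (t i).simpleRank
  | _, _, .sk φ t => max (φ.simpleRank + 1) (Finset.univ.sup fun i => (t i).simpleRank)
  | _, _, .rel _ t => Finset.univ.sup fun i => (t i).simpleRank
  | _, _, .mem t => t.simpleRank
  | _, _, .top => 0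
  | _, _, .bot => 0
  | _, _, .neg φ => φ.simpleRank
  | _, _, .and φ ψ => max φ.simpleRank ψ.simpleRank
  | _, _, .or φ ψ => max φ.simpleRank ψ.simpleRank

/-- `I` occurs in the expression, possibly inside the index of a Skolem symbol.  The distinguished
symbol `c₀` (which will be `c_{∃x ¬B(x,y,I)}`) always counts as containing `I`. -/
def ContainsI (c₀ : SkolemFn L) : {κ : Kind} → {n : ℕ} → Expr L κ n → Prop
  | _, _, .var _ => False
  | _, _, .fn _ t => ∃ i, (t i).ContainsI c₀
  | _, _, .sk (k := k) φ t =>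
      (⟨k, φ⟩ : SkolemFn L) = c₀ ∨ φ.ContainsI c₀ ∨ ∃ i, (t i).ContainsI c₀
  | _, _, .rel _ t => ∃ i, (t i).ContainsI c₀
  | _, _, .mem _ => True
  | _, _, .top => False
  | _, _, .bot => False
  | _, _, .neg φ => φ.ContainsI c₀
  | _, _, .and φ ψ => φ.ContainsI c₀ ∨ ψ.ContainsI c₀
  | _, _, .or φ ψ => φ.ContainsI c₀ ∨ ψ.ContainsI c₀

def conj {n : ℕ} : List (Fml L n) → Fml L n
  | [] => .top
  | φ :: l => .and φ (conj l)

end Expr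

/-- Values of terms are numbers, values of formulas are propositions. -/
def Kind.Sem : Kind → Type
  | .tm => ℕ
  | .fml => Prop

/-- The interpretation in the standard model; it is only used for expressions of the language of
arithmetic, so that its values on Skolem terms and on `t ∈ I` are irrelevant. -/
def Expr.interp {L : ArithLanguage} :
    {κ : Kind} → {n : ℕ} → (Fin n → ℕ) → Expr L κ n → κ.Sem
  | _, _, a, .var i => a i
  | _, _, a, .fn f t => L.fn f fun i => (t i).interp a
  | _, _, _, .sk _ _ => (0 : ℕ)
  | _, _, a, .rel R t => L.rel R fun i => (t i).interp a
  | _, _, _, .mem _ => False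
  | _, _, _, .top => True
  | _, _, _, .bot => False
  | _, _, a, .neg φ => ¬ (φ.interp a : Prop)
  | _, _, a, .and φ ψ => (φ.interp a : Prop) ∧ (ψ.interp a : Prop)
  | _, _, a, .or φ ψ => (φ.interp a : Prop) ∨ (ψ.interp a : Prop)

/-! ## Critical formulas -/

/-- The formula `B(x, y, X)` with `x = var 0`, `y = var 1` and `t ∈ X` written `mem t`; the
inductively defined predicate is given by `A(y, X) = ∀x B(x, y, X)`. -/
structure InductiveOperator (L : ArithLanguage) where
  B : Fml L 2
  skolemFree : B.SkolemFree
  simple : B.Simple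
  positive : B.Polar true

namespace InductiveOperator

variable {L : ArithLanguage} (Op : InductiveOperator L)

/-- The Skolem symbol `c_{∃x ¬B(x,y,I)}`. -/
def cSym : SkolemFn L := ⟨1, Op.B.neg⟩

/-- `A(y, I)`, that is, `B(c_{∃x ¬B(x,y,I)}(y), y, I)`. -/
def AI {m : ℕ} (y : Tm L m) : Fml L m := Op.B.all ![y]

/-- `B(x, y, φ(·, z))` with `x = var 0`, `y = var 1` and the parameters `z` the later variables. -/
def BOf {k : ℕ} (φ : Fml L (k + 1)) : Fml L (k + 2) :=
  Op.B.replace (fun t => φ.app t fun i => .var i.succ.succ) ![.var 0, .var 1]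

/-- `A(y, φ(·, z))`. -/
def AOf {k m : ℕ} (φ : Fml L (k + 1)) (y : Tm L m) (z : Fin k → Tm L m) : Fml L m :=
  (Op.BOf φ).all (Fin.cons y z)

/-- `A(x, φ(·, z)) → φ(x, z)`, with `x = var 0` and `z` the later variables. -/
def closedUnder {k : ℕ} (φ : Fml L (k + 1)) : Fml L (k + 1) :=
  (Op.AOf φ (.var 0) fun i => .var i.succ).imp φ

end InductiveOperator

/-- `x ∈ I → φ(x, z)`. -/
def memImp {L : ArithLanguage} {k : ℕ} (φ : Fml L (k + 1)) : Fml L (k + 1) :=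
  (Expr.mem (.var 0)).imp φ

/-- `y = S x`. -/
def predMatrix (L : ArithLanguage) : Fml L 2 := .eq (.var 1) (.succ (.var 0))

/-- `φ(x, z) ∧ ¬ φ(S x, z)`. -/
def indMatrix {L : ArithLanguage} {k : ℕ} (φ : Fml L (k + 1)) : Fml L (k + 1) :=
  .and φ (.neg (φ.app (.succ (.var 0)) fun i => .var i.succ))

/-- The closed critical formulas. -/
inductive Crit (L : ArithLanguage) where
  /-- `¬ s = 0 → ∃x s = S x` -/
  | pred (s : Tm L 0)
  /-- `φ(t, s) → ∃x φ(x, s)` -/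
  | eps {k : ℕ} (φ : Fml L (k + 1)) (s : Fin k → Tm L 0) (t : Tm L 0)
  /-- `φ(0, s) ∧ ¬ φ(t, s) → ∃x (φ(x, s) ∧ ¬ φ(S x, s))` -/
  | ind {k : ℕ} (φ : Fml L (k + 1)) (s : Fin k → Tm L 0) (t : Tm L 0)
  /-- `A(t, I) → t ∈ I` -/
  | indDef (t : Tm L 0)
  /-- `∀x (A(x, φ) → φ(x, s)) → ∀x (x ∈ I → φ(x, s))` -/
  | closure {k : ℕ} (φ : Fml L (k + 1)) (s : Fin k → Tm L 0)

namespace Crit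

variable {L : ArithLanguage}

def toFml (Op : InductiveOperator L) : Crit L → Fml L 0
  | pred s => (Expr.neg (s.eq .zero)).imp ((predMatrix L).ex ![s])
  | eps φ s t => (φ.app t s).imp (φ.ex s)
  | ind φ s t => (Expr.and (φ.app .zero s) (.neg (φ.app t s))).imp ((indMatrix φ).ex s)
  | indDef t => (Op.AI t).imp (.mem t)
  | closure φ s => ((Op.closedUnder φ).all s).imp ((memImp φ).all s)

/-- The constituents belong to the Skolemized language, and `φ(x, y)` is simple. -/
def InLang : Crit L → Prop
  | pred s => s.InLang
  | eps φ s t => φ.Simple ∧ φ.InLang ∧ (∀ i, (s i).InLang) ∧ t.InLang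
  | ind φ s t => φ.Simple ∧ φ.InLang ∧ (∀ i, (s i).InLang) ∧ t.InLang
  | indDef t => t.InLang
  | closure φ s => φ.Simple ∧ φ.InLang ∧ ∀ i, (s i).InLang

end Crit

/-- The data fixed throughout: the language of arithmetic, the inductive definition, and the finite
list `Cr` of closed critical formulas. -/
structure System where
  L : ArithLanguage
  Op : InductiveOperator L
  N : ℕ
  Cr : Fin N → Crit L
  cr_inLang : ∀ J, (Cr J).InLang

/-! ## Canonical expressions, ranks and `ε`-substitutions -/

/-- `term φ a` is `c_{∃x φ}(a₁, …, a_k)` with numerals `a_i`; `mem n` is the formula `n ∈ I`. -/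
inductive CanExpr (L : ArithLanguage) where
  | term {k : ℕ} (φ : Fml L (k + 1)) (a : Fin k → ℕ)
  | mem (n : ℕ)

namespace CanExpr

variable {L : ArithLanguage}

/-- The expression belongs to the Skolemized language. -/
def InLang : CanExpr L → Prop
  | term φ _ => φ.Simple ∧ φ.InLang
  | mem _ => True

def IsTerm : CanExpr L → Prop
  | term _ _ => True
  | mem _ => False

end CanExpr

/-- The values of an `ε`-substitution: `?`, a positive numeral, or `⊤`. -/
inductive Val where
  | unk
  | num (u : ℕ+)
  | top

/-- Terms take positive numerals or `?` as values, formulas take `⊤` or `?`. -/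
def Val.Fits {L : ArithLanguage} : Val → CanExpr L → Prop
  | .unk, _ => True
  | .num _, .term _ _ => True
  | .top, .mem _ => True
  | _, _ => False

/-- Partial functions from canonical expressions to values. -/
abbrev Subst (L : ArithLanguage) : Type := CanExpr L → Option Val

namespace Subst

variable {L : ArithLanguage}

/-- The standard extension, which gives the value `?` to everything outside the domain. -/
def bar (S : Subst L) : Subst L := fun e => some ((S e).getD .unk)

/-- The pairs `(e, u) ∈ S` with the property `p`. -/
def restrict (S : Subst L) (p : CanExpr L → Val → Prop) : Subst L := fun e =>
  match S e with
  | some u => if p e u then some u else none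
  | none => none

/-- `{(m ∈ I, ⊤) | m ∈ l}`. -/
def ofList (l : List ℕ) : Subst L
  | .mem m => if m ∈ l then some .top else none
  | .term _ _ => none

end Subst

/-- The reduction `|E|_S`. -/
def Expr.reduce {L : ArithLanguage} (S : Subst L) :
    {κ : Kind} → {n : ℕ} → Expr L κ n → Expr L κ n
  | _, _, .var i => .var i
  | _, _, .fn f t =>
      if h : ∃ a : _ → ℕ, ∀ i, (t i).reduce S = numeral (a i) then numeral (L.fn f h.choose)
      else .fn f fun i => (t i).reduce S
  | _, _, .sk φ t =>
      if h : ∃ a : _ → ℕ, ∀ i, (t i).reduce S = numeral (a i) then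
        match S (.term φ h.choose) with
        | some (.num u) => numeral u
        | some _ => numeral 0
        | none => .sk φ fun i => (t i).reduce S
      else .sk φ fun i => (t i).reduce S
  | _, _, .rel R t => .rel R fun i => (t i).reduce S
  | _, _, .mem t =>
      if h : ∃ m : ℕ, t.reduce S = numeral m then
        match S (.mem h.choose) with
        | some .unk => .bot
        | some _ => .top
        | none => .mem (t.reduce S)
      else .mem (t.reduce S)
  | _, _, .top => .top
  | _, _, .bot => .bot
  | _, _, .neg φ => .neg (φ.reduce S)
  | _, _, .and φ ψ => .and (φ.reduce S) (ψ.reduce S)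
  | _, _, .or φ ψ => .or (φ.reduce S) (ψ.reduce S)

namespace Subst

variable {L : ArithLanguage}

/-- `S ⊨ φ`: the reduction of `φ` is a sentence of arithmetic that is true in the standard model. -/
def Models (S : Subst L) (φ : Fml L 0) : Prop :=
  (φ.reduce S).IsPA ∧ ((φ.reduce S).interp Fin.elim0 : Prop)

def Decides (S : Subst L) (φ : Fml L 0) : Prop := S.Models φ ∨ S.Models φ.neg

/-- `|t|_S` is the numeral `m`. -/
def Evals (S : Subst L) (t : Tm L 0) (m : ℕ) : Prop := t.reduce S = .numeral m

end Subst

/-- `Ω`, an ordinal above all natural numbers. -/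
def Ω : Ordinal.{0} := Ordinal.omega 1

namespace System

variable (𝔖 : System)

/-- The canonical term `c_n`, that is, `c_{∃x ¬B(x,y,I)}(n)`. -/
def c (n : ℕ) : CanExpr 𝔖.L := .term 𝔖.Op.B.neg ![n]

/-- The rank of a canonical expression. -/
def rk : CanExpr 𝔖.L → Ordinal.{0}
  | .term (k := k) φ _ =>
      if (⟨k, φ⟩ : SkolemFn 𝔖.L) = 𝔖.Op.cSym then Ω
      else if φ.ContainsI 𝔖.Op.cSym then Ω + ((φ.simpleRank + 1 : ℕ) : Ordinal.{0}) + 1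
      else ((φ.simpleRank + 1 : ℕ) : Ordinal.{0})
  | .mem _ => Ω

/-- The formula `F(e, u)`. -/
def F : CanExpr 𝔖.L → Val → Fml 𝔖.L 0
  | .term φ a, .num u =>
      .and (φ.app (.numeral u) fun i => .numeral (a i))
        (.conj ((List.range u).map fun v => .neg (φ.app (.numeral v) fun i => .numeral (a i))))
  | .mem n, .top => 𝔖.Op.AI (.numeral n)
  | _, _ => .top

def Correct (S : Subst 𝔖.L) : Prop := ∀ e u, S e = some u → S.bar.Models (𝔖.F e u)

/-- Computational inconsistency. -/
def CI (S : Subst 𝔖.L) : Prop :=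
  (∃ e u, S e = some u ∧ S.Models (𝔖.F e u).neg) ∨
    ∃ n u, S (𝔖.c n) = some (.num u) ∧ S (.mem n) = some .top

def Sat (S : Subst 𝔖.L) (J : Fin 𝔖.N) : Prop := S.bar.Models ((𝔖.Cr J).toFml 𝔖.Op)

def Solving (S : Subst 𝔖.L) : Prop := ∀ J, 𝔖.Sat S J

/-- Positive pairs of rank `Ω`: `(n ∈ I, ⊤)` and `(c_n, ?)`. -/
def IsPos (e : CanExpr 𝔖.L) (u : Val) : Prop :=
  (∃ n, e = .mem n ∧ u = .top) ∨ ∃ n, e = 𝔖.c n ∧ u = .unk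

/-- Negative pairs of rank `Ω`: `(n ∈ I, ?)` and `(c_n, v)` with a numeral `v`. -/
def IsNeg (e : CanExpr 𝔖.L) (u : Val) : Prop :=
  (∃ n, e = .mem n ∧ u = .unk) ∨ ∃ n v, e = 𝔖.c n ∧ u = .num v

/-! ## Histories -/

/-- `(P, V)` is a substitution history; the formula `n ∈ I` is represented by `n`. -/
def IsHistory (P : List ℕ) (V : ℕ → Option (Subst 𝔖.L)) : Prop :=
  P.Nodup ∧ (∀ n, n ∈ P ↔ V n ≠ none) ∧
    ∀ n T, V n = some T → {e | T e ≠ none}.Finite ∧ ∀ e u, T e = some u → 𝔖.IsNeg e u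

/-- `|B(0, n_i, I)|` is true under the standard extension of `{(n_j ∈ I, ⊤) | j < i}`, for all `i`. -/
def Admissible (P : List ℕ) : Prop :=
  ∀ l n r, P = l ++ n :: r →
    (Subst.ofList (L := 𝔖.L) l).bar.Models (𝔖.Op.B.subst ![.numeral 0, .numeral n])

/-! ## The `H`-step -/

/-- `n ∈ I` is the first formula in `P` such that `T ⊨ ¬ φ(n, s)`. -/
def IsFirstFailure (T : Subst 𝔖.L) (P : List ℕ) {k : ℕ} (φ : Fml 𝔖.L (k + 1))
    (s : Fin k → Tm 𝔖.L 0) (n : ℕ) : Prop :=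
  ∃ l r, P = l ++ n :: r ∧ T.Models (φ.app (.numeral n) s).neg ∧
    ∀ m ∈ l, ¬ T.Models (φ.app (.numeral m) s).neg

/-- `e` is the expression `e_J` proposed by a critical formula; `T` is a standard extension. -/
def IsHExpr (T : Subst 𝔖.L) (P : List ℕ) (e : CanExpr 𝔖.L) : Crit 𝔖.L → Prop
  | .pred s => ∃ m, T.Evals s m ∧ e = .term (predMatrix 𝔖.L) ![m]
  | .eps φ s _ => ∃ a, (∀ i, T.Evals (s i) (a i)) ∧ e = .term φ a
  | .ind φ s _ => ∃ a, (∀ i, T.Evals (s i) (a i)) ∧ e = .term (indMatrix φ) a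
  | .indDef t => ∃ m, T.Evals t m ∧ e = .mem m
  | .closure φ s => ∃ n, 𝔖.IsFirstFailure T P φ s n ∧
      ((T.Models (𝔖.Op.AOf φ (.numeral n) s).neg ∧ e = 𝔖.c n) ∨
        (¬ T.Models (𝔖.Op.AOf φ (.numeral n) s).neg ∧
          ∃ a, (∀ i, T.Evals (s i) (a i)) ∧ e = .term (𝔖.Op.closedUnder φ).neg a))

/-- `v` is the value `v_J` proposed by a critical formula; `T` is a standard extension. -/
def IsHValue (T : Subst 𝔖.L) (P : List ℕ) (v : Val) : Crit 𝔖.L → Prop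
  | .pred s => ∃ u : ℕ+, T.Evals s (u + 1) ∧ v = .num u
  | .eps _ _ t => ∃ u : ℕ+, T.Evals t u ∧ v = .num u
  | .ind φ s t => ∃ (u : ℕ+) (M : ℕ), T.Evals t M ∧ v = .num u ∧
      IsLeast {m : ℕ | m < M ∧ T.Models (φ.app (.numeral m) s) ∧
        T.Models (φ.app (.numeral (m + 1)) s).neg} u
  | .indDef _ => v = .top
  | .closure φ s => ∃ n, 𝔖.IsFirstFailure T P φ s n ∧ ∃ u : ℕ+, v = .num u ∧
      ((T.Models (𝔖.Op.AOf φ (.numeral n) s).neg ∧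
          T.Evals (.sk (𝔖.Op.BOf φ).neg (Fin.cons (.numeral n) s)) u) ∨
        (¬ T.Models (𝔖.Op.AOf φ (.numeral n) s).neg ∧ (u : ℕ) = n))

/-- `e` and `v` are the `H`-expression and the `H`-value: they are proposed by the unsatisfied
critical formula whose expression has the least rank, the first such one in the list. -/
def IsHStep (S : Subst 𝔖.L) (P : List ℕ) (e : CanExpr 𝔖.L) (v : Val) : Prop :=
  ∃ J, ¬ 𝔖.Sat S J ∧ 𝔖.IsHExpr S.bar P e (𝔖.Cr J) ∧ 𝔖.IsHValue S.bar P v (𝔖.Cr J) ∧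
    ∀ J' e', ¬ 𝔖.Sat S J' → 𝔖.IsHExpr S.bar P e' (𝔖.Cr J') →
      𝔖.rk e < 𝔖.rk e' ∨ (𝔖.rk e = 𝔖.rk e' ∧ J ≤ J')

/-- The calculations made to find the expression and the value proposed by an unsatisfied critical
formula take place in `S`. -/
def CalcIn (S : Subst 𝔖.L) (P : List ℕ) : Crit 𝔖.L → Prop
  | .pred s => ∃ m, S.Evals s m
  | .eps _ s t => (∀ i, ∃ m, S.Evals (s i) m) ∧ ∃ m, S.Evals t m
  | .ind φ s t => (∀ i, ∃ m, S.Evals (s i) m) ∧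
      ∃ M, S.Evals t M ∧ ∀ m ≤ M, S.Decides (φ.app (.numeral m) s)
  | .indDef t => ∃ m, S.Evals t m
  | .closure φ s => (∀ i, ∃ m, S.Evals (s i) m) ∧
      ∀ l n r, P = l ++ n :: r → 𝔖.IsFirstFailure S.bar P φ s n →
        (∀ m ∈ l ++ [n], S.Decides (φ.app (.numeral m) s)) ∧
        S.Decides (𝔖.Op.AOf φ (.numeral n) s) ∧
        (S.Models (𝔖.Op.AOf φ (.numeral n) s).neg →
          ∃ m, S.Evals (.sk (𝔖.Op.BOf φ).neg (Fin.cons (.numeral n) s)) m)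

/-- The `H`-step applies to a substitution with `H`-expression `e` and `H`-value `v`: it is correct
and nonsolving, and all calculations take place in `S`. -/
def HApplies (S : Subst 𝔖.L) (P : List ℕ) (e : CanExpr 𝔖.L) (v : Val) : Prop :=
  𝔖.Correct S ∧ ¬ 𝔖.Solving S ∧ 𝔖.IsHStep S P e v ∧
    (∀ J, S.Decides ((𝔖.Cr J).toFml 𝔖.Op)) ∧
    (∀ J, ¬ 𝔖.Sat S J → 𝔖.CalcIn S P (𝔖.Cr J)) ∧
    S e = some .unk ∧
    (∀ n, e = 𝔖.c n → S (.mem n) ≠ none) ∧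
    (∀ n, e = .mem n → S (𝔖.c n) ≠ none) ∧
    ((∃ n, e = 𝔖.c n) → ∀ m, S (𝔖.c m) = some .unk → S (.mem m) ≠ none)

end System

/-! ## Sequents -/

/-- The data `(S, P, V, F)` of a sequent.  In `F`, `true` is `t` (temporary) and `false` is `f`
(fixed). -/
@[ext]
structure Sequent (L : ArithLanguage) where
  S : Subst L
  P : List ℕ
  V : ℕ → Option (Subst L)
  F : CanExpr L → Option Bool

namespace Sequent

variable {L : ArithLanguage}

def empty (L : ArithLanguage) : Sequent L := ⟨fun _ => none, [], fun _ => none, fun _ => none⟩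

/-- `(e, u), Θ` (if `i = none`) or `(e, u, i), Θ`. -/
def add (Θ : Sequent L) (e : CanExpr L) (u : Val) (i : Option Bool) : Sequent L :=
  { Θ with S := Function.update Θ.S e (some u), F := Function.update Θ.F e i }

/-- `(e, ⊤, i, P_e, V_e), Θ`. -/
def addForm (Θ : Sequent L) (i : Bool) (Pe : List ℕ) (Ve : ℕ → Option (Subst L)) : Sequent L where
  S := fun e' => match e' with
    | .mem m => if m ∈ Pe then some .top else Θ.S (.mem m)
    | e' => Θ.S e'
  P := Θ.P ++ Pe
  V := fun m => if m ∈ Pe then Ve m else Θ.V m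
  F := fun e' => match e' with
    | .mem m => if m ∈ Pe then some i else Θ.F (.mem m)
    | e' => Θ.F e'

end Sequent

namespace System

variable (𝔖 : System)

/-- The tuple `(S, P, V, F)` is a sequent: `S` is an `ε`-substitution, `(P, V)` is a history in which
`P` lists the `n ∈ I` with value `⊤`, and the domain of `F` is the right one. -/
structure IsSequent (Θ : Sequent 𝔖.L) : Prop where
  subst : ∀ e u, Θ.S e = some u → e.InLang ∧ u.Fits e
  history : 𝔖.IsHistory Θ.P Θ.V
  mem_P : ∀ n, n ∈ Θ.P ↔ Θ.S (.mem n) = some .top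
  dom_F : ∀ e, Θ.F e ≠ none ↔ ∃ u, Θ.S e = some u ∧ (u = .unk ∨ 𝔖.rk e = Ω)

/-- The `F`-component after an `H`-step leading to the substitution `S'`: old values are kept, and
`F = t` on new expressions. -/
def newF (Θ : Sequent 𝔖.L) (S' : Subst 𝔖.L) : CanExpr 𝔖.L → Option Bool := fun e =>
  match S' e with
  | none => none
  | some u => if u = .unk ∨ 𝔖.rk e = Ω then some ((Θ.F e).getD true) else none

/-- `H(Θ)` when the `H`-expression `e` has rank different from `Ω`. -/
def hOther (Θ : Sequent 𝔖.L) (e : CanExpr 𝔖.L) (v : Val) : Sequent 𝔖.L :=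
  let S' : Subst 𝔖.L :=
    Function.update (Θ.S.restrict fun e' _ => 𝔖.rk e' ≤ 𝔖.rk e) e (some v)
  { S := S'
    P := if Ω < 𝔖.rk e then Θ.P else []
    V := if Ω < 𝔖.rk e then Θ.V else fun _ => none
    F := 𝔖.newF Θ S' }

/-- `H(Θ)` when the `H`-expression is the positive `Ω` expression `n ∈ I`. -/
def hPos (Θ : Sequent 𝔖.L) (n : ℕ) : Sequent 𝔖.L :=
  let S' : Subst 𝔖.L :=
    Function.update (Θ.S.restrict fun e' u => 𝔖.rk e' < Ω ∨ 𝔖.IsPos e' u) (.mem n) (some .top)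
  { S := S'
    P := Θ.P ++ [n]
    V := Function.update Θ.V n (some (Θ.S.restrict 𝔖.IsNeg))
    F := 𝔖.newF Θ S' }

/-- `H(Θ)` when the `H`-expression is the negative `Ω` expression `c_n`.  The new substitution is
`S_{<Ω} ∪ S' ∪ V' ∪ {(c_n, v)}`; should `V'` disagree with another part, the latter prevails. -/
def hNeg (Θ : Sequent 𝔖.L) (n : ℕ) (v : Val) : Sequent 𝔖.L :=
  let P' := Θ.P.takeWhile fun m => decide (m ≠ n)
  let V' : Subst 𝔖.L :=
    if n ∈ Θ.P then (Θ.V n).getD fun _ => none else Θ.S.restrict 𝔖.IsNeg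
  let S₀ : Subst 𝔖.L := Θ.S.restrict fun e' u => 𝔖.rk e' < Ω ∨
    ∃ m ∈ P', (e' = 𝔖.c m ∧ u = .unk) ∨ (e' = .mem m ∧ u = .top)
  let S' : Subst 𝔖.L := Function.update (fun e' => (S₀ e').or (V' e')) (𝔖.c n) (some v)
  { S := S'
    P := P'
    V := fun m => if m ∈ P' then Θ.V m else none
    F := 𝔖.newF Θ S' }

/-- `H(Θ)`, for the `H`-expression `e` and the `H`-value `v`. -/
def hStep (Θ : Sequent 𝔖.L) (e : CanExpr 𝔖.L) (v : Val) : Sequent 𝔖.L :=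
  if h : ∃ n, e = 𝔖.c n then 𝔖.hNeg Θ h.choose v
  else
    match e with
    | .mem n => 𝔖.hPos Θ n
    | e => 𝔖.hOther Θ e v

/-- `e'` is active at `Θ`, where the `H`-step applies with `H`-expression `e` and `H`-value `v`. -/
def Active (Θ : Sequent 𝔖.L) (e : CanExpr 𝔖.L) (v : Val) (e' : CanExpr 𝔖.L) : Prop :=
  Θ.S e' ≠ none ∧ 𝔖.rk e' = 𝔖.rk e ∧ (𝔖.hStep Θ e v).S e' ≠ Θ.S e'

/-- `P_e` is proper for `n ∈ I, Θ`.  The last clause makes `(e, ⊤, i, P_e, V_e), Θ` single-valued. -/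
def Proper (Θ : Sequent 𝔖.L) (n : ℕ) (Pe : List ℕ) : Prop :=
  Pe.Nodup ∧ (∀ m ∈ Pe, ∀ u, Θ.S (𝔖.c m) = some u → u = .unk) ∧
    𝔖.Admissible (Θ.P ++ Pe) ∧ Pe.getLast? = some n ∧ List.Disjoint Θ.P Pe ∧
    ∀ m ∈ Pe, Θ.S (.mem m) = none

/-! ## Axioms, inference rules and deductions -/

def AxF (Θ : Sequent 𝔖.L) : Prop := 𝔖.CI Θ.S

def AxS (Θ : Sequent 𝔖.L) : Prop := 𝔖.Solving Θ.S

def AxH (e : CanExpr 𝔖.L) (v : Val) (Θ : Sequent 𝔖.L) : Prop :=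
  𝔖.HApplies Θ.S Θ.P e v ∧ ∃ e', 𝔖.Active Θ e v e' ∧ Θ.F e' = some false

def IsAxiom (Θ : Sequent 𝔖.L) : Prop := 𝔖.AxF Θ ∨ 𝔖.AxS Θ ∨ ∃ e v, 𝔖.AxH e v Θ

end System

/-- The inference rules with their main expression. -/
inductive Rule (L : ArithLanguage) where
  | cut (e : CanExpr L)
  | cutFr (e : CanExpr L)
  /-- `Cut^{Ω,term}` -/
  | cutTerm (e : CanExpr L)
  /-- `CutFr^{Ω,term}` -/
  | cutFrTerm (e : CanExpr L)
  /-- `Cut^{Ω,form}`, with main expression `n ∈ I` -/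
  | cutForm (n : ℕ)
  | fr (e : CanExpr L)
  | h (e : CanExpr L) (v : Val)

namespace System

variable (𝔖 : System)

/-- `e` is a canonical expression outside the domain of `Θ`. -/
def Fresh (Θ : Sequent 𝔖.L) (e : CanExpr 𝔖.L) : Prop := e.InLang ∧ Θ.S e = none

/-- `Θ` can be the conclusion of an instance of the rule. -/
def Applies (Θ : Sequent 𝔖.L) : Rule 𝔖.L → Prop
  | .cut e => 𝔖.Fresh Θ e ∧ e.IsTerm ∧ 𝔖.rk e ≠ Ω
  | .cutFr e => 𝔖.Fresh Θ e ∧ e.IsTerm ∧ 𝔖.rk e ≠ Ω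
  | .cutTerm e => 𝔖.Fresh Θ e ∧ e.IsTerm ∧ 𝔖.rk e = Ω
  | .cutFrTerm e => 𝔖.Fresh Θ e ∧ e.IsTerm ∧ 𝔖.rk e = Ω
  | .cutForm n => 𝔖.Fresh Θ (.mem n)
  | .fr e => 𝔖.Fresh Θ e
  | .h e v => 𝔖.HApplies Θ.S Θ.P e v ∧ Θ.F e = some true ∧
      ∀ e', 𝔖.Active Θ e v e' → Θ.F e' = some true

/-- `Θ'` is one of the premises of the instance of the rule with conclusion `Θ`. -/
def IsPremise (Θ Θ' : Sequent 𝔖.L) : Rule 𝔖.L → Prop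
  | .cut e => Θ' = Θ.add e .unk (some false) ∨ ∃ u, Θ' = Θ.add e (.num u) none
  | .cutFr e => Θ' = Θ.add e .unk (some true) ∨ ∃ u, Θ' = Θ.add e (.num u) none
  | .cutTerm e =>
      Θ' = Θ.add e .unk (some false) ∨ ∃ u, Θ' = Θ.add e (.num u) (some false)
  | .cutFrTerm e =>
      Θ' = Θ.add e .unk (some true) ∨ ∃ u, Θ' = Θ.add e (.num u) (some false)
  | .cutForm n =>
      Θ' = Θ.add (.mem n) .unk (some false) ∨
        ∃ Pe Ve, 𝔖.Proper Θ n Pe ∧ 𝔖.IsHistory Pe Ve ∧ Θ' = Θ.addForm false Pe Ve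
  | .fr e => Θ' = Θ.add e .unk (some true)
  | .h e v => Θ' = 𝔖.hStep Θ e v

/-- Deductions from a set `𝒮` of sequents: well-founded trees built by the rules. -/
inductive Deduction (𝒮 : Set (Sequent 𝔖.L)) : Sequent 𝔖.L → Type where
  | hyp (Θ : Sequent 𝔖.L) (hs : 𝔖.IsSequent Θ) (hΘ : Θ ∈ 𝒮) : Deduction 𝒮 Θ
  | ax (Θ : Sequent 𝔖.L) (hs : 𝔖.IsSequent Θ) (hΘ : 𝔖.IsAxiom Θ) : Deduction 𝒮 Θ
  | infer (ρ : Rule 𝔖.L) (Θ : Sequent 𝔖.L) (hs : 𝔖.IsSequent Θ) (hρ : 𝔖.Applies Θ ρ)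
      (d : ∀ Θ', 𝔖.IsPremise Θ Θ' ρ → Deduction 𝒮 Θ') : Deduction 𝒮 Θ

/-- Derivations are deductions from the empty set. -/
abbrev Derivation (Θ : Sequent 𝔖.L) : Type := 𝔖.Deduction ∅ Θ

variable {𝔖}

namespace Deduction

variable {𝒮 : Set (Sequent 𝔖.L)}

/-- Every inference of the deduction has the property `p`. -/
def AllRules (p : Rule 𝔖.L → Prop) : {Θ : Sequent 𝔖.L} → 𝔖.Deduction 𝒮 Θ → Prop
  | _, .hyp _ _ _ => True
  | _, .ax _ _ _ => True
  | _, .infer ρ _ _ _ d => p ρ ∧ ∀ Θ' h, (d Θ' h).AllRules p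

/-- Every axiom of the deduction has the property `p`. -/
def AllAxioms (p : Sequent 𝔖.L → Prop) : {Θ : Sequent 𝔖.L} → 𝔖.Deduction 𝒮 Θ → Prop
  | _, .hyp _ _ _ => True
  | _, .ax Θ _ _ => p Θ
  | _, .infer _ _ _ _ d => ∀ Θ' h, (d Θ' h).AllAxioms p

/-- The ranks of all `Cut`, `Cut^{Ω,term}` and `Cut^{Ω,form}` inferences satisfy `p`. -/
def CutRanks {Θ : Sequent 𝔖.L} (d : 𝔖.Deduction 𝒮 Θ) (p : Ordinal.{0} → Prop) : Prop :=
  d.AllRules fun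
    | .cut e => p (𝔖.rk e)
    | .cutTerm e => p (𝔖.rk e)
    | .cutForm n => p (𝔖.rk (.mem n))
    | _ => True

/-- The ranks of all `CutFr` and `CutFr^{Ω,term}` inferences satisfy `p`. -/
def CutFrRanks {Θ : Sequent 𝔖.L} (d : 𝔖.Deduction 𝒮 Θ) (p : Ordinal.{0} → Prop) : Prop :=
  d.AllRules fun
    | .cutFr e => p (𝔖.rk e)
    | .cutFrTerm e => p (𝔖.rk e)
    | _ => True

def FrRanks {Θ : Sequent 𝔖.L} (d : 𝔖.Deduction 𝒮 Θ) (p : Ordinal.{0} → Prop) : Prop :=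
  d.AllRules fun
    | .fr e => p (𝔖.rk e)
    | _ => True

def HRanks {Θ : Sequent 𝔖.L} (d : 𝔖.Deduction 𝒮 Θ) (p : Ordinal.{0} → Prop) : Prop :=
  d.AllRules fun
    | .h e _ => p (𝔖.rk e)
    | _ => True

/-- The deduction is an `r`-deduction. -/
def IsRDeduction (r : Ordinal.{0}) {Θ : Sequent 𝔖.L} (d : 𝔖.Deduction 𝒮 Θ) : Prop :=
  d.CutRanks (· < r) ∧ d.CutFrRanks (· < 0) ∧ d.FrRanks (r ≤ ·) ∧ d.HRanks (r ≤ ·)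

/-- The deduction is an `Ω*`-deduction. -/
def IsOmegaStar {Θ : Sequent 𝔖.L} (d : 𝔖.Deduction 𝒮 Θ) : Prop :=
  d.CutRanks (· ≤ Ω) ∧ d.CutFrRanks (· = Ω) ∧ d.FrRanks (Ω < ·) ∧ d.HRanks (Ω ≤ ·) ∧
    d.AllRules fun
      | .cutTerm _ => False
      | _ => True

/-- The list of sequents is a path that starts at the root of the deduction. -/
inductive HasPath : {Θ : Sequent 𝔖.L} → 𝔖.Deduction 𝒮 Θ → List (Sequent 𝔖.L) → Prop where
  | root {Θ : Sequent 𝔖.L} (d : 𝔖.Deduction 𝒮 Θ) : HasPath d [Θ]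
  | step {ρ : Rule 𝔖.L} {Θ : Sequent 𝔖.L} {hs : 𝔖.IsSequent Θ} {hρ : 𝔖.Applies Θ ρ}
      {d : ∀ Θ', 𝔖.IsPremise Θ Θ' ρ → 𝔖.Deduction 𝒮 Θ'} (Θ' : Sequent 𝔖.L)
      (h : 𝔖.IsPremise Θ Θ' ρ) (l : List (Sequent 𝔖.L)) (hl : HasPath (d Θ' h) l) :
      HasPath (.infer ρ Θ hs hρ d) (Θ :: l)

end Deduction

variable (𝔖)

/-- An `r`-path: a path from the empty sequent in some `r`-deduction. -/
def IsRPath (r : Ordinal.{0}) (p : List (Sequent 𝔖.L)) : Prop :=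
  ∃ (𝒮 : Set (Sequent 𝔖.L)) (d : 𝔖.Deduction 𝒮 (.empty 𝔖.L)), d.IsRDeduction r ∧ d.HasPath p

/-- `Θ^{term → t}`: all terms of rank `Ω` with value `?` become temporary. -/
def termToT (Θ : Sequent 𝔖.L) : Sequent 𝔖.L :=
  { Θ with
    F := fun e =>
      if 𝔖.rk e = Ω ∧ e.IsTerm ∧ Θ.S e = some .unk then some true else Θ.F e }

end System

end EpsID

end

/-!
The sequents on an `Ω+1`-path satisfy an invariant `PathInv`, which gives `Inv` for `Θ^{term → t}`.
Every sequent with `Inv` has an `Ω*`-derivation of the kind required: one decides, by cuts, whatever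
the next `H`-step consults, and carries out the step.  Under `Inv` an `H`-step is either an axiom or
an inference that is allowed in `Ω*`-derivations.  That the tree built in this way is well-founded
is shown by the classical limit argument for the termination of the substitution process
(`not_isRun`): an infinite branch yields, by passing to an ultrafilter limit of its states at the
steps of least rank that occur infinitely often, an infinite process with steps of higher ranks
only, and there are finitely many ranks.
-/

noncomputable section

namespace EpsID

open scoped Classical
open EpsID.Expr

/-! ## Termination of abstract step processes -/

section Run

open Filter

variable {X W : Type*} (b : W) (ρ : X → Ordinal.{0}) (o : Ordinal.{0})
  (N : (X → W) → Set (X × W))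

/-! The labels of `Θ^{term → t}` follow a simple pattern, `Inv`: formulas and terms of rank below
`Ω` are fixed, while terms of rank at least `Ω` with value `?` are temporary. Every sequent with
this pattern is derivable in the required way; the proof assumes the contrary and follows
underivable premises upwards (`Bad`).

Any fresh expression can be put into the domain by a permitted rule whose premises keep the pattern
(`Bad.exists_cut`), so an underivable sequent can be extended until everything that matters is
decided (`Ready`). Not being an axiom, it is computationally consistent and nonsolving. Consistency,
the decided matrices, admissibility of the history and positivity of `B` make it correct
(`Ready.correct`), and then every unsatisfied critical formula proposes a new value for an
expression whose present value is `?` (`Ready.exists_proposal`). So the `H`-step applies, and since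
the sequent is no `AxH`, no fixed expression is active. This excludes `H`-expressions of rank below
`Ω`, formulas, and those `c_n` with `n ∈ I` in the history, for which the fixed pair `(n ∈ I, ⊤)`
would be lost. The remaining steps leave the history alone and are ordinary steps of the
substitution method; they are permitted inferences, so their premise is again underivable
(`Bad.exists_stepTo`). The same look at active expressions gives the extra property of the axioms
(`Inv.axHMem`).

Repetition yields an infinite process, which `not_isRun` excludes. Let `r` be the least rank
occurring infinitely often. Entries of rank at most `r` are eventually constant, and those above `r`
are blank right after each step of rank `r`; hence the states following these steps have a pointwise
limit along an ultrafilter. Proposals depend on finitely many entries and come from finite sets, so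
the subsequent steps stabilise along the ultrafilter too, and the limits form another infinite
process. A limit step of rank at most `r` would refill again and again an entry that persists once
filled, so only ranks above `r` survive; but there are finitely many ranks. The one proposal not
bounded by the state alone is the history entry proposed by Closure. Histories only grow at the end,
so the entry is bounded in terms of the witness of failure (`BoundsUpTo`). -/

/-- An infinite process on states `X → W`: at stage `k` the blank entry at `x k` is filled with a
value taken from `N`, entries of higher rank become blank, and other entries of rank above `o`
are kept.  Filled entries of rank at most that of `x k` are kept as well, but blank entries of
rank at most `o` may get filled spontaneously. -/
structure IsRun (s : ℕ → X → W) (x : ℕ → X) : Prop where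
  choice : ∀ k, (x k, s (k + 1) (x k)) ∈ N (s k)
  blank : ∀ k, s k (x k) = b
  filled : ∀ k, s (k + 1) (x k) ≠ b
  persist : ∀ k y, ρ y ≤ ρ (x k) → s k y ≠ b → s (k + 1) y = s k y
  erase : ∀ k y, ρ (x k) < ρ y → s (k + 1) y = b
  keep : ∀ k y, o < ρ y → ρ y ≤ ρ (x k) → y ≠ x k → s (k + 1) y = s k y
  rank_ge : ∀ k, o ≤ ρ (x k)

variable {b ρ o N}

theorem IsRun.persist_forever {s : ℕ → X → W} {x : ℕ → X} (h : IsRun b ρ o N s x) {K : ℕ} {y : X}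
    (hK : ∀ k, K ≤ k → ρ y ≤ ρ (x k)) {k : ℕ} (hk : K ≤ k) (hb : s k y ≠ b) (i : ℕ) :
    s (k + i) y = s k y := by
  induction i with
  | zero => rfl
  | succ i ih =>
    rw [← ih, ← add_assoc]
    exact h.persist _ _ (hK _ (by omega)) (by rwa [ih])

theorem eventually_eq_of_finite {ι α : Type*} {U : Ultrafilter ι} {f : ι → α} {t : Set α}
    (ht : t.Finite) (h : ∀ᶠ i in (U : Filter ι), f i ∈ t) :
    ∃ a ∈ t, ∀ᶠ i in (U : Filter ι), f i = a := by
  have h' : (⋃ a ∈ t, {i | f i = a}) ∈ U := by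
    filter_upwards [h] with i hi
    simpa using hi
  exact (Ultrafilter.finite_biUnion_mem_iff ht).1 h'

/-- Pigeonhole on the finite set `R`: some rank is frequent, and each rank below the least frequent
one occurs only finitely often, so a single `K` lies beyond all of them. -/
theorem exists_min_frequent_rank {f : ℕ → Ordinal.{0}} {R : Finset Ordinal.{0}}
    (hR : ∀ k, f k ∈ R) :
    ∃ r ∈ R, (∃ᶠ k in atTop, f k = r) ∧ ∃ K, ∀ k, K ≤ k → r ≤ f k := by
  have hne : (R.filter fun r => ∃ᶠ k in atTop, f k = r).Nonempty := by
    by_contra hcon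
    rw [Finset.not_nonempty_iff_eq_empty, Finset.filter_eq_empty_iff] at hcon
    have : ∀ᶠ k in atTop, ∀ r ∈ R, ¬ f k = r :=
      (eventually_all_finset R).2 fun r hr => not_frequently.1 (hcon hr)
    obtain ⟨k, hk⟩ := this.exists
    exact hk _ (hR k) rfl
  obtain ⟨r, hr, hmin⟩ := Finset.exists_min_image _ id hne
  rw [Finset.mem_filter] at hr
  refine ⟨r, hr.1, hr.2, ?_⟩
  have : ∀ᶠ k in atTop, ∀ q ∈ R, q < r → ¬ f k = q := by
    refine (eventually_all_finset R).2 fun q hq => ?_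
    by_cases hqr : q < r
    · have : ¬ ∃ᶠ k in atTop, f k = q := fun hf =>
        absurd (hmin q (Finset.mem_filter.2 ⟨hq, hf⟩)) (not_le.2 hqr)
      filter_upwards [not_frequently.1 this] with k hk _ using hk
    · exact Eventually.of_forall fun _ h => absurd h hqr
  obtain ⟨K, hK⟩ := eventually_atTop.1 this
  exact ⟨K, fun k hk => not_lt.1 fun hlt => hK k hk _ (hR k) hlt rfl⟩

/-- Finiteness and local constancy of `N` act as a compactness condition: they let a pointwise limit
of runs be a run. The induction is on the set of ranks that may still occur; a limit at the least
frequent rank removes that rank. -/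
theorem not_isRun (hfin : ∀ σ, (N σ).Finite)
    (hloc : ∀ τ, ∃ D : Finset X, ∀ σ, (∀ y ∈ D, σ y = τ y) → N σ = N τ)
    (R : Finset Ordinal.{0}) :
    ∀ (s : ℕ → X → W) (x : ℕ → X), (∀ k, ρ (x k) ∈ R) → ¬ IsRun b ρ o N s x := by
  induction R using Finset.strongInduction with
  | H R ih =>
  intro s x hR h
  obtain ⟨r, hrR, hfreq, K, hK⟩ := exists_min_frequent_rank hR
  have hor : o ≤ r := by
    obtain ⟨k, hk⟩ := hfreq.exists
    exact hk ▸ h.rank_ge k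
  -- After stage `K` no step has rank below `r`, so an entry of rank at most `r` is never erased: it
  -- stays blank for good or freezes when it is first filled.
  have hlow : ∀ y, ρ y ≤ r → ∃ t, ∀ᶠ k in atTop, s k y = t := by
    intro y hy
    by_cases hex : ∃ k, K ≤ k ∧ s k y ≠ b
    · obtain ⟨k, hk, hb⟩ := hex
      refine ⟨s k y, eventually_atTop.2 ⟨k, fun l hl => ?_⟩⟩
      obtain ⟨i, rfl⟩ := Nat.exists_eq_add_of_le hl
      exact h.persist_forever (fun k hk => hy.trans (hK k hk)) hk hb i
    · push Not at hex
      exact ⟨b, eventually_atTop.2 ⟨K, hex⟩⟩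
  let A : Set ℕ := {k | ρ (x k) = r}
  have hne : NeBot (atTop ⊓ 𝓟 A) := by
    rw [← frequently_iff_neBot]
    exact hfreq
  -- `U` lives on the late stages with a step of rank `r`. The limits below are taken at distance `j
  -- + 1` after such a stage.
  let U : Ultrafilter ℕ := Ultrafilter.of (atTop ⊓ 𝓟 A)
  have hUtop : (U : Filter ℕ) ≤ atTop := (Ultrafilter.of_le _).trans inf_le_left
  have hUA : ∀ᶠ k in (U : Filter ℕ), ρ (x k) = r :=
    (Ultrafilter.of_le (atTop ⊓ 𝓟 A)) (mem_inf_of_right (mem_principal_self A))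
  have hshift : ∀ {p : ℕ → Prop} (i : ℕ), (∀ᶠ k in atTop, p k) →
      ∀ᶠ k in (U : Filter ℕ), p (k + i) := fun i hp =>
    hUtop ((tendsto_add_atTop_nat i).eventually hp)
  -- Near a limit state the set of proposals is that of the limit, which is finite; hence along `U`
  -- the filled entry and its value are constant.
  have hstep : ∀ (j : ℕ) (τ : X → W), (∀ y, ∀ᶠ k in (U : Filter ℕ), s (k + (j + 1)) y = τ y) →
      (∀ᶠ k in (U : Filter ℕ), N (s (k + (j + 1))) = N τ) ∧
      ∃ y w, ∀ᶠ k in (U : Filter ℕ),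
        x (k + (j + 1)) = y ∧ s (k + (j + 2)) y = w := by
    intro j τ hτ
    obtain ⟨D, hD⟩ := hloc τ
    have hN : ∀ᶠ k in (U : Filter ℕ), N (s (k + (j + 1))) = N τ := by
      filter_upwards [(eventually_all_finset D).2 fun y _ => hτ y] with k hk using hD _ hk
    refine ⟨hN, ?_⟩
    obtain ⟨⟨y, w⟩, -, hyw⟩ := eventually_eq_of_finite (U := U)
      (f := fun k => (x (k + (j + 1)), s (k + (j + 2)) (x (k + (j + 1))))) (hfin τ) (by
        filter_upwards [hN] with k hk
        rw [← hk]
        exact h.choice _)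
    refine ⟨y, w, ?_⟩
    filter_upwards [hyw] with k hk
    obtain ⟨h1, h2⟩ := Prod.mk.inj hk
    exact ⟨h1, by rw [← h1]; exact h2⟩
  have hlim : ∀ j, ∃ τ : X → W, ∀ y, ∀ᶠ k in (U : Filter ℕ), s (k + (j + 1)) y = τ y := by
    intro j
    induction j with
    | zero =>
      suffices H : ∀ y, ∃ t, ∀ᶠ k in (U : Filter ℕ), s (k + (0 + 1)) y = t from
        ⟨fun y => (H y).choose, fun y => (H y).choose_spec⟩
      intro y
      by_cases hy : ρ y ≤ r
      · obtain ⟨t, ht⟩ := hlow y hy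
        exact ⟨t, hshift 1 ht⟩
      · refine ⟨b, ?_⟩
        filter_upwards [hUA] with k hk
        exact h.erase k y (by rw [hk]; exact not_le.1 hy)
    | succ j ihj =>
      obtain ⟨τ, hτ⟩ := ihj
      obtain ⟨-, y₀, w₀, hyw⟩ := hstep j τ hτ
      suffices H : ∀ y, ∃ t, ∀ᶠ k in (U : Filter ℕ), s (k + (j + 1 + 1)) y = t from
        ⟨fun y => (H y).choose, fun y => (H y).choose_spec⟩
      intro y
      by_cases hy : ρ y ≤ r
      · obtain ⟨t, ht⟩ := hlow y hy
        exact ⟨t, hshift (j + 1 + 1) ht⟩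
      by_cases hy0 : y = y₀
      · subst hy0
        exact ⟨w₀, hyw.mono fun k hk => hk.2⟩
      by_cases hle : ρ y ≤ ρ y₀
      -- Here `o ≤ r < ρ y`, so `keep` applies. Entries that may get filled spontaneously have rank
      -- at most `o ≤ r` and converge by `hlow`.
      · refine ⟨τ y, ?_⟩
        filter_upwards [hyw, hτ y] with k hk hky
        rw [← hky]
        exact h.keep (k + (j + 1)) y (hor.trans_lt (not_le.1 hy)) (by rw [hk.1]; exact hle)
          (by rw [hk.1]; exact hy0)
      · refine ⟨b, ?_⟩
        filter_upwards [hyw] with k hk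
        exact h.erase (k + (j + 1)) y (by rw [hk.1]; exact not_le.1 hle)
  choose τ hτ using hlim
  have hstep' := fun j => (hstep j (τ j) (hτ j)).2
  choose x' w' hx' using hstep'
  have hrun : IsRun b ρ o N τ x' := by
    constructor
    · intro j
      obtain ⟨k, hk1, hk2, hk3⟩ :=
        (((hstep j (τ j) (hτ j)).1).and ((hx' j).and (hτ (j + 1) (x' j)))).exists
      have := h.choice (k + (j + 1))
      rw [hk1, hk2.1] at this
      rw [← hk3]
      exact this
    · intro j
      obtain ⟨k, hk1, hk2⟩ := ((hx' j).and (hτ j (x' j))).exists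
      rw [← hk2, ← hk1.1]
      exact h.blank _
    · intro j
      obtain ⟨k, hk1, hk2⟩ := ((hx' j).and (hτ (j + 1) (x' j))).exists
      rw [← hk2, ← hk1.1]
      exact h.filled _
    · intro j y hy hb
      obtain ⟨k, hk1, hk2, hk3⟩ := ((hx' j).and ((hτ j y).and (hτ (j + 1) y))).exists
      rw [← hk2] at hb ⊢
      rw [← hk3]
      exact h.persist (k + (j + 1)) _ (by rw [hk1.1]; exact hy) hb
    · intro j y hy
      obtain ⟨k, hk1, hk3⟩ := ((hx' j).and (hτ (j + 1) y)).exists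
      rw [← hk3]
      exact h.erase (k + (j + 1)) _ (by rw [hk1.1]; exact hy)
    · intro j y hy hle hne
      obtain ⟨k, hk1, hk2, hk3⟩ := ((hx' j).and ((hτ j y).and (hτ (j + 1) y))).exists
      rw [← hk2, ← hk3]
      exact h.keep (k + (j + 1)) _ hy (by rw [hk1.1]; exact hle) (by rw [hk1.1]; exact hne)
    · intro j
      obtain ⟨k, hk1⟩ := (hx' j).exists
      rw [← hk1.1]
      exact h.rank_ge _
  -- The limit run has steps of rank above `r` only.
  refine ih (R.filter (r < ·)) ?_ τ x' (fun j => ?_) hrun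
  · exact Finset.filter_ssubset.2 ⟨r, hrR, lt_irrefl r⟩
  · refine Finset.mem_filter.2 ⟨?_, ?_⟩
    · obtain ⟨k, hk1⟩ := (hx' j).exists
      rw [← hk1.1]
      exact hR _
    · by_contra hle
      rw [not_lt] at hle
      -- Two late stages `k < l` near which the same entry of rank at most `r` is filled: having
      -- been filled after `k`, it persists and cannot be blank again at `l + (j + 1)`.
      obtain ⟨k, hk, hkK⟩ := ((hx' j).and (hUtop (eventually_ge_atTop K))).exists
      obtain ⟨l, hl, hlk⟩ := ((hx' j).and (hUtop (eventually_ge_atTop (k + 1)))).exists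
      have h1 : s (k + (j + 1) + 1) (x' j) ≠ b := by
        rw [← hk.1]
        exact h.filled _
      obtain ⟨i, rfl⟩ := Nat.exists_eq_add_of_le hlk
      have h2 := h.persist_forever (K := K) (fun k hk => hle.trans (hK k hk))
        (by omega) h1 i
      apply h1
      rw [← h2, show k + (j + 1) + 1 + i = k + 1 + i + (j + 1) by omega]
      nth_rewrite 1 [← hl.1]
      exact h.blank _

end Run

/-! ## Evaluation under a total valuation -/

namespace Expr

variable {L : ArithLanguage}

/-- The value of an expression when Skolem terms are evaluated by `g` and `I` is interpreted
by `X`. -/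
def ev (g : CanExpr L → ℕ) (X : ℕ → Prop) :
    {κ : Kind} → {n : ℕ} → (Fin n → ℕ) → Expr L κ n → κ.Sem
  | _, _, a, .var i => a i
  | _, _, a, .fn f t => L.fn f fun i => (t i).ev g X a
  | _, _, a, .sk φ t => g (.term φ fun i => (t i).ev g X a)
  | _, _, a, .rel R t => L.rel R fun i => (t i).ev g X a
  | _, _, a, .mem t => X (t.ev g X a)
  | _, _, _, .top => True
  | _, _, _, .bot => False
  | _, _, a, .neg φ => ¬ (φ.ev g X a : Prop)
  | _, _, a, .and φ ψ => (φ.ev g X a : Prop) ∧ (ψ.ev g X a : Prop)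
  | _, _, a, .or φ ψ => (φ.ev g X a : Prop) ∨ (ψ.ev g X a : Prop)

/-- The value of a term. -/
abbrev evT (g : CanExpr L → ℕ) (X : ℕ → Prop) {n : ℕ} (a : Fin n → ℕ) (t : Tm L n) : ℕ :=
  t.ev g X a

/-- The truth value of a formula. -/
abbrev evF (g : CanExpr L → ℕ) (X : ℕ → Prop) {n : ℕ} (a : Fin n → ℕ) (φ : Fml L n) : Prop :=
  φ.ev g X a

section

variable {g : CanExpr L → ℕ} {X : ℕ → Prop} {n : ℕ} {a : Fin n → ℕ}

theorem evT_zero : evT g X a (zero : Tm L n) = 0 := L.fn_zero _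

theorem evT_succ (t : Tm L n) : evT g X a t.succ = evT g X a t + 1 := L.fn_succ _

theorem evT_numeral (m : ℕ) : evT g X a (numeral m : Tm L n) = m := by
  induction m with
  | zero => exact evT_zero
  | succ m ih => exact (evT_succ _).trans (by rw [ih])

theorem evF_eq (s t : Tm L n) : evF g X a (s.eq t) ↔ evT g X a s = evT g X a t := L.rel_eq _

theorem evF_neg (φ : Fml L n) : evF g X a φ.neg ↔ ¬ evF g X a φ := Iff.rfl

theorem evF_and (φ ψ : Fml L n) : evF g X a (φ.and ψ) ↔ evF g X a φ ∧ evF g X a ψ := Iff.rfl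

theorem evF_imp (φ ψ : Fml L n) : evF g X a (φ.imp ψ) ↔ (evF g X a φ → evF g X a ψ) :=
  imp_iff_not_or.symm

theorem evF_mem (t : Tm L n) : evF g X a (.mem t) ↔ X (evT g X a t) := Iff.rfl

theorem evT_sk {k : ℕ} (φ : Fml L (k + 1)) (t : Fin k → Tm L n) :
    evT g X a (.sk φ t) = g (.term φ fun i => evT g X a (t i)) := rfl

end

/-- Replacing `t ∈ I` by `χ(t)` amounts to interpreting `I` by the set that `χ` defines. The index
of a Skolem symbol is not replaced, in agreement with `ev`, which passes the index to `g` unchanged.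
-/
theorem ev_replace {g : CanExpr L → ℕ} {X Y : ℕ → Prop} {m : ℕ} {χ : Tm L m → Fml L m}
    {b : Fin m → ℕ} (hχ : ∀ t, evF g X b (χ t) ↔ Y (evT g X b t)) {κ : Kind} {n : ℕ}
    (σ : Fin n → Tm L m) (E : Expr L κ n) :
    (E.replace χ σ).ev g X b = E.ev g Y fun i => evT g X b (σ i) := by
  induction E with
  | var i => rfl
  | fn f t ih => simp only [replace, ev, ih]; rfl
  | sk φ t _ ih => simp only [replace, ev, ih]; rfl
  | rel R t ih => simp only [replace, ev, ih]; rfl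
  | mem t ih =>
    simp only [replace, ev]
    rw [← ih σ]
    exact propext (hχ _)
  | top => rfl
  | bot => rfl
  | neg φ ih => simp only [replace, ev, ih]; rfl
  | and φ ψ ih₁ ih₂ => simp only [replace, ev, ih₁, ih₂]; rfl
  | or φ ψ ih₁ ih₂ => simp only [replace, ev, ih₁, ih₂]; rfl

section

variable {g : CanExpr L → ℕ} {X : ℕ → Prop} {k m : ℕ} {b : Fin m → ℕ}

theorem evF_subst {n : ℕ} (σ : Fin n → Tm L m) (φ : Fml L n) :
    evF g X b (φ.subst σ) ↔ evF g X (fun i => evT g X b (σ i)) φ :=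
  iff_of_eq (ev_replace (fun _ => Iff.rfl) σ φ)

theorem evF_app (φ : Fml L (k + 1)) (t : Tm L m) (s : Fin k → Tm L m) :
    evF g X b (φ.app t s) ↔ evF g X (Fin.cons (evT g X b t) fun i => evT g X b (s i)) φ := by
  rw [app, evF_subst]
  refine iff_of_eq (congrArg (fun c => evF g X c φ) ?_)
  funext i
  refine Fin.cases rfl (fun _ => rfl) i

theorem evF_ex (φ : Fml L (k + 1)) (s : Fin k → Tm L m) :
    evF g X b (φ.ex s) ↔
      evF g X (Fin.cons (g (.term φ fun i => evT g X b (s i))) fun i => evT g X b (s i)) φ :=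
  evF_app _ _ _

theorem evF_all (φ : Fml L (k + 1)) (s : Fin k → Tm L m) :
    evF g X b (φ.all s) ↔
      evF g X (Fin.cons (g (.term φ.neg fun i => evT g X b (s i))) fun i => evT g X b (s i)) φ :=
  evF_app _ _ _

end

end Expr

namespace InductiveOperator

variable {L : ArithLanguage} (Op : InductiveOperator L) {g : CanExpr L → ℕ} {X : ℕ → Prop}
  {k m : ℕ} {b : Fin m → ℕ}

theorem evF_AI (y : Tm L m) :
    evF g X b (Op.AI y) ↔
      evF g X ![g (.term Op.B.neg ![evT g X b y]), evT g X b y] Op.B := by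
  rw [AI, evF_all]
  have : (fun i => evT g X b ((![y] : Fin 1 → Tm L m) i)) = ![evT g X b y] := by
    funext i; fin_cases i; rfl
  rw [this]
  rfl

/-- `B(x, y, φ)` is `B` with `I` read as `{m | φ(m, z)}`. In this form monotonicity of `B` transfers
facts about the history to `φ`. -/
theorem evF_BOf (φ : Fml L (k + 1)) (x y : ℕ) (z : Fin k → ℕ) :
    evF g X (Fin.cons x (Fin.cons y z)) (Op.BOf φ) ↔
      evF g (fun m => evF g X (Fin.cons m z) φ) ![x, y] Op.B := by
  refine iff_of_eq ((ev_replace (Y := fun m => evF g X (Fin.cons m z) φ) (fun t => ?_) _ _).trans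
    (congrArg (fun c => evF g _ c Op.B) ?_))
  · rw [evF_app]
    rfl
  · funext i; fin_cases i <;> rfl

theorem evF_AOf (φ : Fml L (k + 1)) (y : Tm L m) (z : Fin k → Tm L m) :
    evF g X b (Op.AOf φ y z) ↔
      evF g (fun m => evF g X (Fin.cons m fun i => evT g X b (z i)) φ)
        ![g (.term (Op.BOf φ).neg (Fin.cons (evT g X b y) fun i => evT g X b (z i))),
          evT g X b y] Op.B := by
  rw [AOf, evF_all]
  have : (fun i => evT g X b ((Fin.cons y z : Fin (k + 1) → Tm L m) i)) =
      Fin.cons (evT g X b y) fun i => evT g X b (z i) := by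
    funext i
    refine Fin.cases rfl (fun _ => rfl) i
  rw [this, evF_BOf]

theorem evF_closedUnder (φ : Fml L (k + 1)) (x : ℕ) (z : Fin k → ℕ) :
    evF g X (Fin.cons x z) (Op.closedUnder φ) ↔
      (evF g (fun m => evF g X (Fin.cons m z) φ)
        ![g (.term (Op.BOf φ).neg (Fin.cons x z)), x] Op.B → evF g X (Fin.cons x z) φ) := by
  rw [closedUnder, evF_imp, evF_AOf]
  rfl

end InductiveOperator

/-! ### Monotonicity in `I` and locality of evaluation -/

/-- Implication of propositions as a relation. -/
abbrev Implies (p q : Prop) : Prop := p → q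

/-- Comparison of values in the direction given by a polarity. -/
def Kind.SemLE : (κ : Kind) → Bool → κ.Sem → κ.Sem → Prop
  | .tm, _, x, y => x = y
  | .fml, true, p, q => Implies p q
  | .fml, false, p, q => Implies q p

/-- Without Skolem symbols the valuations `g`, `g'` play no role, so only `I` matters; negation
reverses both the polarity and the implication. -/
theorem Expr.ev_semLE {L : ArithLanguage} {g g' : CanExpr L → ℕ} {X Y : ℕ → Prop}
    (hXY : ∀ m, X m → Y m) {κ : Kind} {n : ℕ} (E : Expr L κ n) (a : Fin n → ℕ) (b : Bool)
    (hsf : E.SkolemFree) (hp : E.Polar b) : κ.SemLE b (E.ev g X a) (E.ev g' Y a) := by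
  induction E generalizing b with
  | var i => exact rfl
  | fn f t ih =>
    have : (fun i => (t i).ev g X a) = fun i => (t i).ev g' Y a := by
      funext i
      -- `Polar` holds trivially for terms, whatever the polarity.
      have hpi : (t i).Polar true := by
        have := hsf i
        cases h : t i <;> simp_all [Polar]
      exact ih i a true (hsf i) hpi
    exact congrArg (L.fn f) this
  | sk φ t _ ih => exact hsf.elim
  | rel R t ih =>
    have : (fun i => (t i).ev g X a) = fun i => (t i).ev g' Y a := by
      funext i
      have hpi : (t i).Polar true := by
        have := hsf i
        cases h : t i <;> simp_all [Polar]
      exact ih i a true (hsf i) hpi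
    have h2 : (rel R t).ev g X a = (rel R t).ev g' Y a := congrArg (L.rel R) this
    rw [h2]
    cases b <;> exact id
  | mem t ih =>
    cases (hp : b = true)
    have hpi : t.Polar true := by
      cases t <;> simp_all [Polar]
    have : t.ev g X a = t.ev g' Y a := ih a true hsf hpi
    change Implies (X (t.ev g X a)) (Y (t.ev g' Y a))
    rw [← this]
    exact hXY _
  | top => cases b <;> exact id
  | bot => cases b <;> exact id
  | neg φ ih =>
    have := ih a (!b) hsf hp
    cases b <;> exact fun h h' => h (this h')
  | and φ ψ ih₁ ih₂ =>
    have h1 := ih₁ a b hsf.1 hp.1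
    have h2 := ih₂ a b hsf.2 hp.2
    cases b <;> exact fun h => ⟨h1 h.1, h2 h.2⟩
  | or φ ψ ih₁ ih₂ =>
    have h1 := ih₁ a b hsf.1 hp.1
    have h2 := ih₂ a b hsf.2 hp.2
    cases b <;> exact fun h => h.imp h1 h2

theorem InductiveOperator.evF_mono {L : ArithLanguage} (Op : InductiveOperator L)
    {g g' : CanExpr L → ℕ} {X Y : ℕ → Prop} (hXY : ∀ m, X m → Y m) (a : Fin 2 → ℕ)
    (h : evF g X a Op.B) : evF g' Y a Op.B :=
  Op.B.ev_semLE hXY a true Op.skolemFree Op.positive h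

/-- The value of an expression depends on finitely many values of canonical expressions. -/
theorem Expr.ev_local {L : ArithLanguage} (σ : CanExpr L → Val) (v : Val → ℕ) (q : Val → Prop)
    {κ : Kind} {n : ℕ} (E : Expr L κ n) (a : Fin n → ℕ) :
    ∃ D : Finset (CanExpr L), ∀ τ : CanExpr L → Val, (∀ e ∈ D, τ e = σ e) →
      E.ev (fun e => v (τ e)) (fun m => q (τ (.mem m))) a =
        E.ev (fun e => v (σ e)) (fun m => q (σ (.mem m))) a := by
  have hfam : ∀ {k n : ℕ} (t : Fin k → Tm L n) (a : Fin n → ℕ),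
      (∀ i a, ∃ D : Finset (CanExpr L), ∀ τ : CanExpr L → Val, (∀ e ∈ D, τ e = σ e) →
      (t i).ev (fun e => v (τ e)) (fun m => q (τ (.mem m))) a =
        (t i).ev (fun e => v (σ e)) (fun m => q (σ (.mem m))) a) →
      ∃ D : Finset (CanExpr L), ∀ τ : CanExpr L → Val, (∀ e ∈ D, τ e = σ e) →
      (fun i => (t i).ev (fun e => v (τ e)) (fun m => q (τ (.mem m))) a) =
        fun i => (t i).ev (fun e => v (σ e)) (fun m => q (σ (.mem m))) a := by
    intro k n t a h
    choose D hD using fun i => h i a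
    refine ⟨Finset.univ.biUnion D, fun τ hτ => ?_⟩
    funext i
    exact hD i τ fun e he => hτ e (Finset.mem_biUnion.2 ⟨i, Finset.mem_univ i, he⟩)
  induction E with
  | var i => exact ⟨∅, fun _ _ => rfl⟩
  | fn f t ih =>
    obtain ⟨D, hD⟩ := hfam t a ih
    exact ⟨D, fun τ hτ => congrArg (L.fn f) (hD τ hτ)⟩
  | sk φ t _ ih =>
    obtain ⟨D, hD⟩ := hfam t a ih
    refine ⟨insert (.term φ fun i => (t i).ev (fun e => v (σ e)) (fun m => q (σ (.mem m))) a) D,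
      fun τ hτ => ?_⟩
    have := hD τ fun e he => hτ e (Finset.mem_insert_of_mem he)
    simp only [ev, this]
    exact congrArg v (hτ _ (Finset.mem_insert_self _ _))
  | rel R t ih =>
    obtain ⟨D, hD⟩ := hfam t a ih
    exact ⟨D, fun τ hτ => congrArg (L.rel R) (hD τ hτ)⟩
  | mem t ih =>
    obtain ⟨D, hD⟩ := ih a
    refine ⟨insert (.mem (t.ev (fun e => v (σ e)) (fun m => q (σ (.mem m))) a)) D,
      fun τ hτ => ?_⟩
    have := hD τ fun e he => hτ e (Finset.mem_insert_of_mem he)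
    simp only [ev, this]
    exact congrArg q (hτ _ (Finset.mem_insert_self _ _))
  | top => exact ⟨∅, fun _ _ => rfl⟩
  | bot => exact ⟨∅, fun _ _ => rfl⟩
  | neg φ ih =>
    obtain ⟨D, hD⟩ := ih a
    exact ⟨D, fun τ hτ => congrArg Not (hD τ hτ)⟩
  | and φ ψ ih₁ ih₂ =>
    obtain ⟨D₁, hD₁⟩ := ih₁ a
    obtain ⟨D₂, hD₂⟩ := ih₂ a
    exact ⟨D₁ ∪ D₂, fun τ hτ => congrArg₂ And
      (hD₁ τ fun e he => hτ e (Finset.mem_union_left _ he))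
      (hD₂ τ fun e he => hτ e (Finset.mem_union_right _ he))⟩
  | or φ ψ ih₁ ih₂ =>
    obtain ⟨D₁, hD₁⟩ := ih₁ a
    obtain ⟨D₂, hD₂⟩ := ih₂ a
    exact ⟨D₁ ∪ D₂, fun τ hτ => congrArg₂ Or
      (hD₁ τ fun e he => hτ e (Finset.mem_union_left _ he))
      (hD₂ τ fun e he => hτ e (Finset.mem_union_right _ he))⟩

/-! ## Evaluation in a substitution -/

def Val.toNat : Val → ℕ
  | .num u => u
  | _ => 0

namespace Subst

variable {L : ArithLanguage}

/-- The total valuation with default value `?`. -/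
def val (S : Subst L) (e : CanExpr L) : Val := (S e).getD .unk

/-- The numerical value of a canonical term. -/
def nat (S : Subst L) (e : CanExpr L) : ℕ := (S.val e).toNat

/-- `n ∈ I` holds. -/
def holds (S : Subst L) (n : ℕ) : Prop := S.val (.mem n) ≠ .unk

end Subst

namespace Expr

variable {L : ArithLanguage}

/-- All canonical expressions met when evaluating the expression are in the domain of `S`. -/
def Dec (S : Subst L) : {κ : Kind} → {n : ℕ} → (Fin n → ℕ) → Expr L κ n → Prop
  | _, _, _, .var _ => True
  | _, _, a, .fn _ t => ∀ i, (t i).Dec S a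
  | _, _, a, .sk φ t =>
      (∀ i, (t i).Dec S a) ∧ S (.term φ fun i => evT S.nat S.holds a (t i)) ≠ none
  | _, _, a, .rel _ t => ∀ i, (t i).Dec S a
  | _, _, a, .mem t => t.Dec S a ∧ S (.mem (evT S.nat S.holds a t)) ≠ none
  | _, _, _, .top => True
  | _, _, _, .bot => True
  | _, _, a, .neg φ => φ.Dec S a
  | _, _, a, .and φ ψ => φ.Dec S a ∧ ψ.Dec S a
  | _, _, a, .or φ ψ => φ.Dec S a ∧ ψ.Dec S a

theorem dec_bar (S : Subst L) {κ : Kind} {n : ℕ} (a : Fin n → ℕ) (E : Expr L κ n) :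
    E.Dec S.bar a := by
  induction E with
  | var i => trivial
  | fn f t ih => exact fun i => ih i a
  | sk φ t _ ih => exact ⟨fun i => ih i a, Option.some_ne_none _⟩
  | rel R t ih => exact fun i => ih i a
  | mem t ih => exact ⟨ih a, Option.some_ne_none _⟩
  | top => trivial
  | bot => trivial
  | neg φ ih => exact ih a
  | and φ ψ ih₁ ih₂ => exact ⟨ih₁ a, ih₂ a⟩
  | or φ ψ ih₁ ih₂ => exact ⟨ih₁ a, ih₂ a⟩

/-- By induction the arguments keep their values, so evaluation in the extension meets the same
canonical expressions, with the same values. -/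
theorem Dec.mono {S T : Subst L} (hST : ∀ e u, S e = some u → T e = some u) {κ : Kind} {n : ℕ}
    {a : Fin n → ℕ} {E : Expr L κ n} (h : E.Dec S a) :
    E.Dec T a ∧ E.ev T.nat T.holds a = E.ev S.nat S.holds a := by
  induction E with
  | var i => exact ⟨trivial, rfl⟩
  | fn f t ih =>
    have := fun i => ih i (h i)
    exact ⟨fun i => (this i).1, congrArg (L.fn f) (funext fun i => (this i).2)⟩
  | sk φ t _ ih =>
    have h1 := fun i => ih i (h.1 i)
    have h2 : (fun i => evT T.nat T.holds a (t i)) = fun i => evT S.nat S.holds a (t i) :=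
      funext fun i => (h1 i).2
    obtain ⟨u, hu⟩ := Option.ne_none_iff_exists'.1 h.2
    have hv := hST _ _ hu
    rw [← h2] at hv
    refine ⟨⟨fun i => (h1 i).1, hv ▸ Option.some_ne_none _⟩, ?_⟩
    change T.nat (.term φ fun i => evT T.nat T.holds a (t i)) =
      S.nat (.term φ fun i => evT S.nat S.holds a (t i))
    simp only [Subst.nat, Subst.val, hu, hv]
  | rel R t ih =>
    have := fun i => ih i (h i)
    exact ⟨fun i => (this i).1, congrArg (L.rel R) (funext fun i => (this i).2)⟩
  | mem t ih =>
    obtain ⟨h1, h2⟩ := ih h.1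
    obtain ⟨u, hu⟩ := Option.ne_none_iff_exists'.1 h.2
    have hv := hST _ _ hu
    change T (.mem (t.ev S.nat S.holds a)) = _ at hv
    rw [← h2] at hv
    refine ⟨⟨h1, fun h0 => Option.some_ne_none _ (hv.symm.trans h0)⟩, ?_⟩
    change T.holds (evT T.nat T.holds a t) = S.holds (evT S.nat S.holds a t)
    have h2' : evT T.nat T.holds a t = evT S.nat S.holds a t := h2
    have hv' : T (.mem (evT T.nat T.holds a t)) = some u := hv
    simp only [Subst.holds, Subst.val, hu, hv']
  | top => exact ⟨trivial, rfl⟩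
  | bot => exact ⟨trivial, rfl⟩
  | neg φ ih => exact ⟨(ih h).1, congrArg Not (ih h).2⟩
  | and φ ψ ih₁ ih₂ =>
    exact ⟨⟨(ih₁ h.1).1, (ih₂ h.2).1⟩, congrArg₂ And (ih₁ h.1).2 (ih₂ h.2).2⟩
  | or φ ψ ih₁ ih₂ =>
    exact ⟨⟨(ih₁ h.1).1, (ih₂ h.2).1⟩, congrArg₂ Or (ih₁ h.1).2 (ih₂ h.2).2⟩

theorem dec_numeral {S : Subst L} {n : ℕ} {a : Fin n → ℕ} (m : ℕ) :
    (numeral m : Tm L n).Dec S a := by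
  induction m with
  | zero => exact fun i => i.elim0
  | succ m ih => intro i; fin_cases i; exact ih

theorem Dec.subst {S : Subst L} {κ : Kind} {n m : ℕ} {σ : Fin n → Tm L m} {b : Fin m → ℕ}
    (hσ : ∀ i, (σ i).Dec S b) {E : Expr L κ n}
    (h : E.Dec S fun i => evT S.nat S.holds b (σ i)) : (E.subst σ).Dec S b := by
  have hev : ∀ t : Tm L n, evT S.nat S.holds b (t.replace .mem σ) =
      evT S.nat S.holds (fun i => evT S.nat S.holds b (σ i)) t := fun t =>
    ev_replace (fun _ => Iff.rfl) σ t
  unfold Expr.subst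
  induction E with
  | var i => exact hσ i
  | fn f t ih => exact fun i => ih i hσ (h i) hev
  | sk φ t _ ih =>
    refine ⟨fun i => ih i hσ (h.1 i) hev, ?_⟩
    simp only [hev]
    exact h.2
  | rel R t ih => exact fun i => ih i hσ (h i) hev
  | mem t ih =>
    refine ⟨ih hσ h.1 hev, ?_⟩
    rw [hev]
    exact h.2
  | top => trivial
  | bot => trivial
  | neg φ ih => exact ih hσ h hev
  | and φ ψ ih₁ ih₂ => exact ⟨ih₁ hσ h.1 hev, ih₂ hσ h.2 hev⟩
  | or φ ψ ih₁ ih₂ => exact ⟨ih₁ hσ h.1 hev, ih₂ hσ h.2 hev⟩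

theorem interp_numeral {n : ℕ} (a : Fin n → ℕ) (m : ℕ) :
    (numeral m : Tm L n).interp a = m := by
  induction m with
  | zero => exact L.fn_zero _
  | succ m ih => exact (L.fn_succ _).trans (congrArg (· + 1) ih)

theorem isPA_numeral {n : ℕ} (m : ℕ) : (numeral m : Tm L n).IsPA := by
  induction m with
  | zero => exact fun i => i.elim0
  | succ m ih => intro i; fin_cases i; exact ih

theorem numeral_injective {n : ℕ} : Function.Injective (numeral : ℕ → Tm L n) := by
  intro m m' h
  have := congrArg (Expr.interp (L := L) (fun _ : Fin n => 0)) h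
  exact (interp_numeral _ m).symm.trans (this.trans (interp_numeral _ m'))

/-- The reduced expression is the numeral, or an arithmetical sentence with the truth value,
given. -/
def HasValue : {κ : Kind} → {n : ℕ} → (Fin n → ℕ) → Expr L κ n → κ.Sem → Prop
  | .tm, _, _, E, m => E = numeral m
  | .fml, _, a, E, p => E.IsPA ∧ ((E.interp a : Prop) ↔ (p : Prop))

/-- This links the syntactic reduction with `ev`. The equation `n = 0` stands for closedness in a
form that survives the induction over the indexed family; the arguments picked by `choose` in
`reduce` are the right ones because numerals are injective. -/
theorem hasValue_reduce (S : Subst L) {κ : Kind} {n : ℕ} (h0 : n = 0) (a : Fin n → ℕ)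
    (E : Expr L κ n) (h : E.Dec S a) :
    HasValue a (E.reduce S) (E.ev S.nat S.holds a) := by
  induction E with
  | var i => subst h0; exact i.elim0
  | fn f t ih =>
    have h1 : ∀ i, (t i).reduce S = numeral ((t i).ev S.nat S.holds a) := fun i => ih i h0 a (h i)
    have h2 : ∃ a : _ → ℕ, ∀ i, (t i).reduce S = numeral (a i) := ⟨_, h1⟩
    have h3 : h2.choose = fun i => (t i).ev S.nat S.holds a :=
      funext fun i => numeral_injective ((h2.choose_spec i).symm.trans (h1 i))
    change reduce S (.fn f t) = _
    rw [reduce, dif_pos h2, h3]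
    rfl
  | sk φ t _ ih =>
    have h1 : ∀ i, (t i).reduce S = numeral ((t i).ev S.nat S.holds a) :=
      fun i => ih i h0 a (h.1 i)
    have h2 : ∃ a : _ → ℕ, ∀ i, (t i).reduce S = numeral (a i) := ⟨_, h1⟩
    have h3 : h2.choose = fun i => evT S.nat S.holds a (t i) :=
      funext fun i => numeral_injective ((h2.choose_spec i).symm.trans (h1 i))
    change reduce S (.sk φ t) = numeral (S.nat (.term φ fun i => evT S.nat S.holds a (t i)))
    rw [reduce, dif_pos h2, h3]
    have h4 := h.2
    cases hS : S (.term φ fun i => evT S.nat S.holds a (t i)) with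
    | none => exact absurd hS h4
    | some u => cases u <;> simp [Subst.nat, Subst.val, hS, Val.toNat]
  | rel R t ih =>
    have h1 : ∀ i, (t i).reduce S = numeral ((t i).ev S.nat S.holds a) := fun i => ih i h0 a (h i)
    refine ⟨fun i => ?_, ?_⟩
    · change ((t i).reduce S).IsPA
      rw [h1]
      exact isPA_numeral _
    · refine iff_of_eq (congrArg (L.rel R) (funext fun i => ?_))
      exact (congrArg (Expr.interp a) (h1 i)).trans (interp_numeral _ _)
  | mem t ih =>
    have h1 : t.reduce S = numeral (evT S.nat S.holds a t) := ih h0 a h.1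
    have h2 : ∃ m : ℕ, t.reduce S = numeral m := ⟨_, h1⟩
    have h3 : h2.choose = evT S.nat S.holds a t :=
      numeral_injective (h2.choose_spec.symm.trans h1)
    change (reduce S (.mem t)).IsPA ∧ ((reduce S (.mem t)).interp a ↔
      S.val (.mem (evT S.nat S.holds a t)) ≠ .unk)
    rw [reduce, dif_pos h2, h3]
    have h4 := h.2
    cases hS : S (.mem (evT S.nat S.holds a t)) with
    | none => exact absurd hS h4
    | some u => cases u <;> simp [Subst.val, hS, IsPA, interp]
  | top => exact ⟨trivial, Iff.rfl⟩
  | bot => exact ⟨trivial, Iff.rfl⟩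
  | neg φ ih =>
    obtain ⟨h1, h2⟩ := ih h0 a h
    exact ⟨h1, not_congr h2⟩
  | and φ ψ ih₁ ih₂ =>
    obtain ⟨h1, h2⟩ := ih₁ h0 a h.1
    obtain ⟨h3, h4⟩ := ih₂ h0 a h.2
    exact ⟨⟨h1, h3⟩, and_congr h2 h4⟩
  | or φ ψ ih₁ ih₂ =>
    obtain ⟨h1, h2⟩ := ih₁ h0 a h.1
    obtain ⟨h3, h4⟩ := ih₂ h0 a h.2
    exact ⟨⟨h1, h3⟩, or_congr h2 h4⟩

end Expr

namespace Subst

variable {L : ArithLanguage} {S : Subst L}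

/-- Truth of a closed formula under the standard extension. -/
abbrev IsTrue (S : Subst L) (φ : Fml L 0) : Prop := evF S.nat S.holds Fin.elim0 φ

/-- Value of a closed term under the standard extension. -/
abbrev num (S : Subst L) (t : Tm L 0) : ℕ := evT S.nat S.holds Fin.elim0 t

theorem models_iff {φ : Fml L 0} (h : φ.Dec S Fin.elim0) : S.Models φ ↔ S.IsTrue φ := by
  obtain ⟨h1, h2⟩ := hasValue_reduce S rfl Fin.elim0 φ h
  exact ⟨fun hm => h2.1 hm.2, fun ht => ⟨h1, h2.2 ht⟩⟩

theorem evals_iff {t : Tm L 0} (h : t.Dec S Fin.elim0) {m : ℕ} : S.Evals t m ↔ S.num t = m := by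
  have h1 : t.reduce S = numeral (S.num t) := hasValue_reduce S rfl Fin.elim0 t h
  rw [Evals, h1]
  exact numeral_injective.eq_iff

theorem decides {φ : Fml L 0} (h : φ.Dec S Fin.elim0) : S.Decides φ := by
  by_cases ht : S.IsTrue φ
  · exact .inl ((models_iff h).2 ht)
  · exact .inr ((models_iff (φ := φ.neg) h).2 ht)

theorem models_bar_iff {φ : Fml L 0} : S.bar.Models φ ↔ S.IsTrue φ :=
  models_iff (dec_bar S _ φ)

theorem evals_bar_iff {t : Tm L 0} {m : ℕ} : S.bar.Evals t m ↔ S.num t = m :=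
  evals_iff (dec_bar S _ t)

end Subst

/-! ## Membership in the Skolemized language -/

namespace Expr

variable {L : ArithLanguage}

theorem Simple.hasVar {κ : Kind} {n : ℕ} {t : Expr L κ n} (hκ : κ = .tm) (h : t.Simple) :
    t.HasVar := by
  cases t with
  | var i => trivial
  | fn f t => exact h.1
  | sk φ t => exact h.1
  | _ => cases hκ

theorem HasVar.replace {m : ℕ} {χ : Tm L m → Fml L m} {κ : Kind} {n : ℕ} {σ : Fin n → Tm L m}
    (hσ : ∀ i, (σ i).HasVar) {t : Expr L κ n} (hκ : κ = .tm) (h : t.HasVar) :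
    (t.replace χ σ).HasVar := by
  induction t with
  | var i => exact hσ i
  | fn f t ih => exact h.imp fun i hi => ih i hσ rfl hi
  | sk φ t _ ih => exact h.imp fun i hi => ih i hσ rfl hi
  | _ => cases hκ

/-- A simple term contains a variable, so simple terms substituted for the variables cannot create a
closed term. -/
theorem Simple.replace {m : ℕ} {χ : Tm L m → Fml L m} (hχ : ∀ t, t.Simple → (χ t).Simple)
    {κ : Kind} {n : ℕ} {σ : Fin n → Tm L m} (hσ : ∀ i, (σ i).Simple) {E : Expr L κ n}
    (h : E.Simple) : (E.replace χ σ).Simple := by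
  have hv : ∀ i, (σ i).HasVar := fun i => (hσ i).hasVar rfl
  induction E with
  | var i => exact hσ i
  | fn f t ih => exact ⟨h.1.imp fun i hi => hi.replace hv rfl, fun i => ih i hσ (h.2 i) hv⟩
  | sk φ t _ ih => exact ⟨h.1.imp fun i hi => hi.replace hv rfl, fun i => ih i hσ (h.2 i) hv⟩
  | rel R t ih => exact fun i => ih i hσ (h i) hv
  | mem t ih => exact hχ _ (ih hσ h hv)
  | top => trivial
  | bot => trivial
  | neg φ ih => exact ih hσ h hv
  | and φ ψ ih₁ ih₂ => exact ⟨ih₁ hσ h.1 hv, ih₂ hσ h.2 hv⟩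
  | or φ ψ ih₁ ih₂ => exact ⟨ih₁ hσ h.1 hv, ih₂ hσ h.2 hv⟩

theorem InLang.replace {m : ℕ} {χ : Tm L m → Fml L m} (hχ : ∀ t, t.InLang → (χ t).InLang)
    {κ : Kind} {n : ℕ} {σ : Fin n → Tm L m} (hσ : ∀ i, (σ i).InLang) {E : Expr L κ n}
    (h : E.InLang) : (E.replace χ σ).InLang := by
  induction E with
  | var i => exact hσ i
  | fn f t ih => exact fun i => ih i hσ (h i)
  | sk φ t _ ih => exact ⟨h.1, h.2.1, fun i => ih i hσ (h.2.2 i)⟩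
  | rel R t ih => exact fun i => ih i hσ (h i)
  | mem t ih => exact hχ _ (ih hσ h)
  | top => trivial
  | bot => trivial
  | neg φ ih => exact ih hσ h
  | and φ ψ ih₁ ih₂ => exact ⟨ih₁ hσ h.1, ih₂ hσ h.2⟩
  | or φ ψ ih₁ ih₂ => exact ⟨ih₁ hσ h.1, ih₂ hσ h.2⟩

theorem SkolemFree.inLang {κ : Kind} {n : ℕ} {E : Expr L κ n} (h : E.SkolemFree) : E.InLang := by
  induction E with
  | var i => trivial
  | fn f t ih => exact fun i => ih i (h i)
  | sk φ t _ ih => exact h.elim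
  | rel R t ih => exact fun i => ih i (h i)
  | mem t ih => exact ih h
  | top => trivial
  | bot => trivial
  | neg φ ih => exact ih h
  | and φ ψ ih₁ ih₂ => exact ⟨ih₁ h.1, ih₂ h.2⟩
  | or φ ψ ih₁ ih₂ => exact ⟨ih₁ h.1, ih₂ h.2⟩

theorem inLang_zero {n : ℕ} : (zero : Tm L n).InLang := fun i => i.elim0

theorem InLang.succ {n : ℕ} {t : Tm L n} (h : t.InLang) : t.succ.InLang := by
  intro i
  fin_cases i
  exact h

theorem inLang_numeral {n : ℕ} (m : ℕ) : (numeral m : Tm L n).InLang := by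
  induction m with
  | zero => exact inLang_zero
  | succ m ih => exact ih.succ

theorem InLang.imp {n : ℕ} {φ ψ : Fml L n} (hφ : φ.InLang) (hψ : ψ.InLang) : (φ.imp ψ).InLang :=
  ⟨hφ, hψ⟩

theorem forall_cons {m k : ℕ} {p : Tm L m → Prop} {t : Tm L m} {s : Fin k → Tm L m} (ht : p t)
    (hs : ∀ i, p (s i)) (i : Fin (k + 1)) : p ((Fin.cons t s : Fin (k + 1) → Tm L m) i) :=
  Fin.cases ht hs i

section

variable {m k : ℕ} {φ : Fml L (k + 1)} {t : Tm L m} {s : Fin k → Tm L m}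

theorem InLang.app (h : φ.InLang) (ht : t.InLang) (hs : ∀ i, (s i).InLang) :
    (φ.app t s).InLang :=
  h.replace (fun _ ht => ht) (forall_cons ht hs)

theorem Simple.app (h : φ.Simple) (ht : t.Simple) (hs : ∀ i, (s i).Simple) :
    (φ.app t s).Simple :=
  h.replace (fun _ ht => ht) (forall_cons ht hs)

theorem InLang.ex (h : φ.InLang) (h' : φ.Simple) (hs : ∀ i, (s i).InLang) : (φ.ex s).InLang :=
  h.app ⟨h', h, hs⟩ hs

theorem InLang.all (h : φ.InLang) (h' : φ.Simple) (hs : ∀ i, (s i).InLang) : (φ.all s).InLang :=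
  h.app ⟨h', h, hs⟩ hs

theorem InLang.indMatrix (h : φ.InLang) : (indMatrix φ).InLang :=
  ⟨h, h.app (InLang.succ (t := .var 0) trivial) fun _ => trivial⟩

theorem Simple.indMatrix (h : φ.Simple) : (indMatrix φ).Simple := by
  refine ⟨h, h.app (t := .succ (.var 0)) ⟨⟨0, trivial⟩, fun i => ?_⟩ fun _ => trivial⟩
  fin_cases i
  trivial

theorem InLang.memImp (h : φ.InLang) : (memImp φ).InLang := ⟨trivial, h⟩

theorem Simple.memImp (h : φ.Simple) : (memImp φ).Simple := ⟨trivial, h⟩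

end

theorem inLang_predMatrix : (predMatrix L).InLang := by
  intro i
  fin_cases i
  · trivial
  · exact InLang.succ (t := .var 0) trivial

theorem simple_predMatrix : (predMatrix L).Simple := by
  intro i
  fin_cases i
  · trivial
  · refine ⟨⟨0, trivial⟩, fun i => ?_⟩
    fin_cases i
    trivial

end Expr

namespace InductiveOperator

variable {L : ArithLanguage} (Op : InductiveOperator L) {k m : ℕ} {φ : Fml L (k + 1)}
  {y : Tm L m} {z : Fin k → Tm L m}

theorem inLang_B : Op.B.InLang := Op.skolemFree.inLang

theorem inLang_AI (hy : y.InLang) : (Op.AI y).InLang :=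
  Op.inLang_B.all Op.simple fun i => by fin_cases i; exact hy

theorem inLang_BOf (h : φ.InLang) : (Op.BOf φ).InLang :=
  Op.inLang_B.replace (fun _ ht => h.app (s := fun i => .var i.succ.succ) ht fun _ => trivial)
    fun i => by fin_cases i <;> trivial

theorem simple_BOf (h : φ.Simple) : (Op.BOf φ).Simple :=
  Op.simple.replace (fun _ ht => h.app (s := fun i => .var i.succ.succ) ht fun _ => trivial)
    fun i => by fin_cases i <;> trivial

theorem inLang_AOf (h : φ.InLang) (h' : φ.Simple) (hy : y.InLang) (hz : ∀ i, (z i).InLang) :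
    (Op.AOf φ y z).InLang :=
  (Op.inLang_BOf h).all (Op.simple_BOf h') (forall_cons hy hz)

theorem simple_AOf (h : φ.Simple) (hy : y.Simple) (hz : ∀ i, (z i).Simple) :
    (Op.AOf φ y z).Simple :=
  (Op.simple_BOf h).app ⟨⟨0, hy.hasVar rfl⟩, forall_cons hy hz⟩ (forall_cons hy hz)

theorem inLang_closedUnder (h : φ.InLang) (h' : φ.Simple) : (Op.closedUnder φ).InLang :=
  ⟨Op.inLang_AOf h h' (y := .var 0) trivial fun _ => trivial, h⟩

theorem simple_closedUnder (h : φ.Simple) : (Op.closedUnder φ).Simple :=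
  ⟨Op.simple_AOf h (y := .var 0) trivial fun _ => trivial, h⟩

end InductiveOperator

theorem Crit.InLang.toFml {L : ArithLanguage} (Op : InductiveOperator L) {C : Crit L}
    (h : C.InLang) : (C.toFml Op).InLang := by
  cases C with
  | pred s =>
    have h' : s.InLang := h
    refine InLang.imp (φ := .neg _) (fun i => ?_) (inLang_predMatrix.ex simple_predMatrix fun i => ?_)
    · fin_cases i
      · exact h'
      · exact inLang_zero
    · fin_cases i
      exact h'
  | eps φ s t => exact (h.2.1.app h.2.2.2 h.2.2.1).imp (h.2.1.ex h.1 h.2.2.1)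
  | ind φ s t =>
    exact InLang.imp (φ := .and _ _) ⟨h.2.1.app inLang_zero h.2.2.1, h.2.1.app h.2.2.2 h.2.2.1⟩
      (h.2.1.indMatrix.ex h.1.indMatrix h.2.2.1)
  | indDef t => exact (Op.inLang_AI h).imp h
  | closure φ s =>
    exact ((Op.inLang_closedUnder h.2.1 h.1).all (Op.simple_closedUnder h.1) h.2.2).imp
      (h.2.1.memImp.all h.1.memImp h.2.2)

/-! ## Ranks -/

namespace System

variable (𝔖 : System)

theorem natCast_lt_Ω (n : ℕ) : (n : Ordinal.{0}) < Ω :=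
  (Ordinal.natCast_lt_omega0 n).trans_le (Ordinal.omega0_le_omega 1)

theorem c_injective : Function.Injective 𝔖.c := by
  intro m n h
  simp only [c, CanExpr.term.injEq, heq_eq_eq, true_and] at h
  exact congrFun h 0

theorem rk_c (n : ℕ) : 𝔖.rk (𝔖.c n) = Ω := if_pos rfl

theorem rk_mem (n : ℕ) : 𝔖.rk (.mem n) = Ω := rfl

theorem c_ne_mem (m n : ℕ) : 𝔖.c m ≠ .mem n := nofun

theorem isTerm_c (n : ℕ) : (𝔖.c n).IsTerm := trivial

variable {𝔖}

/-- Terms with other symbols have a finite rank or a rank of the form `Ω + m + 1`, never `Ω` itself.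
-/
theorem exists_eq_c {e : CanExpr 𝔖.L} (ht : e.IsTerm) (h : 𝔖.rk e = Ω) : ∃ n, e = 𝔖.c n := by
  cases e with
  | mem n => exact ht.elim
  | @term k φ a =>
    by_cases h1 : (⟨k, φ⟩ : SkolemFn 𝔖.L) = 𝔖.Op.cSym
    · obtain ⟨rfl, h2⟩ := Sigma.mk.inj h1
      cases h2
      refine ⟨a 0, ?_⟩
      rw [c]
      congr
      funext i
      fin_cases i
      rfl
    · rw [rk, if_neg h1] at h
      split_ifs at h
      · exact absurd h (ne_of_gt (by
          rw [← Order.succ_eq_add_one, Order.lt_succ_iff]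
          exact le_self_add))
      · exact absurd h (natCast_lt_Ω _).ne

theorem isTerm_of_rk_ne {e : CanExpr 𝔖.L} (h : 𝔖.rk e ≠ Ω) : e.IsTerm := by
  cases e with
  | mem n => exact absurd rfl h
  | term φ a => trivial

/-- A canonical expression is of rank different from `Ω`, or a term `c_n`, or a formula. -/
theorem canExpr_cases (e : CanExpr 𝔖.L) :
    𝔖.rk e ≠ Ω ∨ (∃ n, e = 𝔖.c n) ∨ ∃ n, e = .mem n := by
  by_cases h : 𝔖.rk e = Ω
  · cases e with
    | mem n => exact .inr (.inr ⟨n, rfl⟩)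
    | term φ a => exact .inr (.inl (exists_eq_c trivial h))
  · exact .inl h

end System

namespace System

variable {𝔖 : System}

/-! ## Derivability by `Ω*`-derivations -/

/-- Axioms `AxH_{c_n, v}` contain `(n ∈ I, ⊤)`. -/
def AxHMem (Υ : Sequent 𝔖.L) : Prop := ∀ n v, 𝔖.AxH (𝔖.c n) v Υ → Υ.S (.mem n) = some .top

/-- There is an `Ω*`-derivation in which the axioms `AxH_{c_n, v}` contain `(n ∈ I, ⊤)`. -/
def Good (Θ : Sequent 𝔖.L) : Prop :=
  ∃ d : 𝔖.Derivation Θ, d.IsOmegaStar ∧ d.AllAxioms AxHMem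

variable (𝔖) in
/-- The inferences allowed in `Ω*`-derivations. -/
def StarRule : Rule 𝔖.L → Prop
  | .cut e => 𝔖.rk e ≤ Ω
  | .cutFr e => 𝔖.rk e = Ω
  | .cutTerm _ => False
  | .cutFrTerm e => 𝔖.rk e = Ω
  | .cutForm _ => True
  | .fr e => Ω < 𝔖.rk e
  | .h e _ => Ω ≤ 𝔖.rk e

theorem good_of_isAxiom {Θ : Sequent 𝔖.L} (hs : 𝔖.IsSequent Θ) (hax : 𝔖.IsAxiom Θ)
    (hm : AxHMem Θ) : Good Θ :=
  ⟨.ax Θ hs hax, ⟨trivial, trivial, trivial, trivial, trivial⟩, hm⟩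

theorem good_of_infer {Θ : Sequent 𝔖.L} {ρ : Rule 𝔖.L} (hs : 𝔖.IsSequent Θ)
    (hρ : 𝔖.Applies Θ ρ) (hstar : 𝔖.StarRule ρ) (h : ∀ Θ', 𝔖.IsPremise Θ Θ' ρ → Good Θ') :
    Good Θ := by
  choose d hd using h
  refine ⟨.infer ρ Θ hs hρ d, ⟨⟨?_, fun Θ' h => (hd Θ' h).1.1⟩, ⟨?_, fun Θ' h => (hd Θ' h).1.2.1⟩,
    ⟨?_, fun Θ' h => (hd Θ' h).1.2.2.1⟩, ⟨?_, fun Θ' h => (hd Θ' h).1.2.2.2.1⟩,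
    ⟨?_, fun Θ' h => (hd Θ' h).1.2.2.2.2⟩⟩, fun Θ' h => (hd Θ' h).2⟩
  all_goals cases ρ <;> trivial

/-! ## An invariant of the sequents in `Ω*`-derivations -/

/-- Formulas and terms of rank below `Ω` are fixed, other terms with value `?` are temporary. -/
structure Inv (Θ : Sequent 𝔖.L) : Prop where
  seq : 𝔖.IsSequent Θ
  fin : {e | Θ.S e ≠ none}.Finite
  adm : 𝔖.Admissible Θ.P
  fixed : ∀ e i, 𝔖.rk e < Ω ∨ ¬ e.IsTerm → Θ.F e = some i → i = false
  temp : ∀ e, e.IsTerm → Ω ≤ 𝔖.rk e → Θ.S e = some .unk → Θ.F e = some true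

section Inv

variable {Θ : Sequent 𝔖.L}

theorem Inv.add (h : Inv Θ) {e : CanExpr 𝔖.L} {u : Val} {i : Option Bool} (hf : 𝔖.Fresh Θ e)
    (hu : u.Fits e) (htop : u ≠ .top) (hi : i ≠ none ↔ u = .unk ∨ 𝔖.rk e = Ω)
    (hfix : 𝔖.rk e < Ω ∨ ¬ e.IsTerm → i ≠ some true)
    (htemp : u = .unk → e.IsTerm → Ω ≤ 𝔖.rk e → i = some true) : Inv (Θ.add e u i) := by
  refine ⟨⟨fun e' u' hu' => ?_, h.seq.history, fun n => ?_, fun e' => ?_⟩, ?_, h.adm,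
    fun e' i' he' hi' => ?_, fun e' ht he' hu' => ?_⟩
  · by_cases hee : e' = e
    · subst hee
      simp only [Sequent.add, Function.update_self, Option.some.injEq] at hu'
      exact hu' ▸ ⟨hf.1, hu⟩
    · simp only [Sequent.add, Function.update_of_ne hee] at hu'
      exact h.seq.subst e' u' hu'
  · by_cases hee : .mem n = e
    · subst hee
      simp only [Sequent.add, Function.update_self, Option.some.injEq, htop, iff_false]
      intro hn
      have := (h.seq.mem_P n).1 hn
      rw [hf.2] at this
      cases this
    · simp only [Sequent.add, Function.update_of_ne hee]
      exact h.seq.mem_P n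
  · by_cases hee : e' = e
    · subst hee
      simp only [Sequent.add, Function.update_self, Option.some.injEq, exists_eq_left']
      exact hi
    · simp only [Sequent.add, Function.update_of_ne hee]
      exact h.seq.dom_F e'
  · refine (h.fin.insert e).subset fun e' he' => ?_
    by_cases hee : e' = e
    · exact .inl hee
    · simp only [Sequent.add, Set.mem_ofPred_eq, Function.update_of_ne hee] at he'
      exact .inr he'
  · by_cases hee : e' = e
    · subst hee
      simp only [Sequent.add, Function.update_self] at hi'
      cases i'
      · rfl
      · exact absurd hi' (hfix he')
    · simp only [Sequent.add, Function.update_of_ne hee] at hi'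
      exact h.fixed e' i' he' hi'
  · by_cases hee : e' = e
    · subst hee
      simp only [Sequent.add, Function.update_self, Option.some.injEq] at hu' ⊢
      exact htemp hu' ht he'
    · simp only [Sequent.add, Function.update_of_ne hee] at hu' ⊢
      exact h.temp e' ht he' hu'

theorem addForm_S_mem {Pe : List ℕ} {Ve : ℕ → Option (Subst 𝔖.L)} (m : ℕ) :
    (Θ.addForm false Pe Ve).S (.mem m) = if m ∈ Pe then some .top else Θ.S (.mem m) := rfl

theorem addForm_S_of_isTerm {Pe : List ℕ} {Ve : ℕ → Option (Subst 𝔖.L)} {e : CanExpr 𝔖.L}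
    (he : e.IsTerm) : (Θ.addForm false Pe Ve).S e = Θ.S e := by
  cases e with
  | mem n => exact he.elim
  | term φ a => rfl

theorem addForm_F_mem {Pe : List ℕ} {Ve : ℕ → Option (Subst 𝔖.L)} (m : ℕ) :
    (Θ.addForm false Pe Ve).F (.mem m) = if m ∈ Pe then some false else Θ.F (.mem m) := rfl

theorem addForm_F_of_isTerm {Pe : List ℕ} {Ve : ℕ → Option (Subst 𝔖.L)} {e : CanExpr 𝔖.L}
    (he : e.IsTerm) : (Θ.addForm false Pe Ve).F e = Θ.F e := by
  cases e with
  | mem n => exact he.elim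
  | term φ a => rfl

theorem isSequent_addForm (h : 𝔖.IsSequent Θ) {n : ℕ} {Pe : List ℕ}
    {Ve : ℕ → Option (Subst 𝔖.L)} (hp : 𝔖.Proper Θ n Pe) (hh : 𝔖.IsHistory Pe Ve) :
    𝔖.IsSequent (Θ.addForm false Pe Ve) := by
  refine ⟨fun e u hu => ?_, ⟨?_, fun m => ?_, fun m T hT => ?_⟩, fun m => ?_, fun e => ?_⟩
  · cases e with
    | term φ a => exact h.subst _ _ hu
    | mem m =>
      rw [addForm_S_mem] at hu
      split_ifs at hu
      · cases hu
        exact ⟨trivial, trivial⟩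
      · exact h.subst _ _ hu
  · exact List.nodup_append'.2 ⟨h.history.1, hp.1, hp.2.2.2.2.1⟩
  · change m ∈ Θ.P ++ Pe ↔ (if m ∈ Pe then Ve m else Θ.V m) ≠ none
    rw [List.mem_append]
    split_ifs with hm
    · simp only [hm, or_true, true_iff]
      exact (hh.2.1 m).1 hm
    · simp only [hm, or_false]
      exact h.history.2.1 m
  · change (if m ∈ Pe then Ve m else Θ.V m) = some T at hT
    split_ifs at hT
    · exact hh.2.2 m T hT
    · exact h.history.2.2 m T hT
  · change m ∈ Θ.P ++ Pe ↔ _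
    rw [List.mem_append, addForm_S_mem, h.mem_P m]
    split_ifs with hm <;> simp [hm]
  · cases e with
    | term φ a => exact h.dom_F _
    | mem m =>
      rw [addForm_S_mem, addForm_F_mem]
      split_ifs with hm
      · simp [rk_mem]
      · exact h.dom_F _

theorem finite_addForm (h : {e | Θ.S e ≠ none}.Finite) (Pe : List ℕ)
    (Ve : ℕ → Option (Subst 𝔖.L)) : {e | (Θ.addForm false Pe Ve).S e ≠ none}.Finite := by
  refine (h.union ((Pe.toFinset.finite_toSet).image CanExpr.mem)).subset fun e he => ?_
  cases e with
  | term φ a => exact .inl he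
  | mem m =>
    by_cases hm : m ∈ Pe
    · exact .inr ⟨m, by simpa using hm, rfl⟩
    · rw [Set.mem_ofPred_eq, addForm_S_mem, if_neg hm] at he
      exact .inl he

theorem Inv.addForm (h : Inv Θ) {n : ℕ} {Pe : List ℕ} {Ve : ℕ → Option (Subst 𝔖.L)}
    (hp : 𝔖.Proper Θ n Pe) (hh : 𝔖.IsHistory Pe Ve) : Inv (Θ.addForm false Pe Ve) := by
  refine ⟨isSequent_addForm h.seq hp hh, finite_addForm h.fin Pe Ve, hp.2.2.1,
    fun e i he hi => ?_, fun e ht he hu => ?_⟩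
  · cases e with
    | term φ a => exact h.fixed _ i he hi
    | mem m =>
      rw [addForm_F_mem] at hi
      split_ifs at hi
      · exact (Option.some.inj hi).symm
      · exact h.fixed _ i he hi
  · rw [addForm_S_of_isTerm ht] at hu
    rw [addForm_F_of_isTerm ht]
    exact h.temp e ht he hu

end Inv

/-! ## Sequents that are not derivable -/

/-- The invariant holds, but there is no derivation. -/
def Bad (Θ : Sequent 𝔖.L) : Prop := Inv Θ ∧ ¬ Good Θ

/-- `Θ'` extends `Θ`; new expressions of rank above `Ω` get the value `?`. -/
structure Ext (Θ Θ' : Sequent 𝔖.L) : Prop where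
  sub : ∀ e u, Θ.S e = some u → Θ'.S e = some u
  pre : Θ.P <+: Θ'.P
  high : ∀ e, Ω < 𝔖.rk e → Θ.S e = none → ∀ u, Θ'.S e = some u → u = .unk

theorem Ext.refl (Θ : Sequent 𝔖.L) : Ext Θ Θ :=
  ⟨fun _ _ h => h, List.prefix_rfl, fun e _ h u hu => by rw [h] at hu; cases hu⟩

theorem Ext.ne_none {Θ Θ' : Sequent 𝔖.L} (h : Ext Θ Θ') {e : CanExpr 𝔖.L} (he : Θ.S e ≠ none) :
    Θ'.S e ≠ none := by
  obtain ⟨u, hu⟩ := Option.ne_none_iff_exists'.1 he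
  rw [h.sub e u hu]
  exact Option.some_ne_none _

theorem Ext.trans {Θ Θ' Θ'' : Sequent 𝔖.L} (h : Ext Θ Θ') (h' : Ext Θ' Θ'') : Ext Θ Θ'' := by
  refine ⟨fun e u hu => h'.sub e u (h.sub e u hu), h.pre.trans h'.pre, fun e he hn u hu => ?_⟩
  cases hS : Θ'.S e with
  | none => exact h'.high e he hS u hu
  | some w =>
    have := h'.sub e w hS
    rw [hu] at this
    rw [Option.some.inj this]
    exact h.high e he hn w hS

theorem ext_add {Θ : Sequent 𝔖.L} {e : CanExpr 𝔖.L} {u : Val} {i : Option Bool}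
    (hf : Θ.S e = none) (hu : Ω < 𝔖.rk e → u = .unk) : Ext Θ (Θ.add e u i) := by
  refine ⟨fun e' u' h => ?_, List.prefix_rfl, fun e' he' hn u' h => ?_⟩
  · have : e' ≠ e := by
      rintro rfl
      rw [hf] at h
      cases h
    simpa only [Sequent.add, Function.update_of_ne this] using h
  · by_cases hee : e' = e
    · subst hee
      simp only [Sequent.add, Function.update_self, Option.some.injEq] at h
      exact h ▸ hu he'
    · simp only [Sequent.add, Function.update_of_ne hee] at h
      rw [hn] at h
      cases h

theorem ext_addForm {Θ : Sequent 𝔖.L} {n : ℕ} {Pe : List ℕ} {Ve : ℕ → Option (Subst 𝔖.L)}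
    (hp : 𝔖.Proper Θ n Pe) : Ext Θ (Θ.addForm false Pe Ve) := by
  refine ⟨fun e u h => ?_, List.prefix_append _ _, fun e he hn u h => ?_⟩
  · cases e with
    | term φ a => exact h
    | mem m =>
      rw [addForm_S_mem, if_neg]
      · exact h
      · intro hm
        rw [hp.2.2.2.2.2 m hm] at h
        cases h
  · have := isTerm_of_rk_ne (ne_of_gt he)
    rw [addForm_S_of_isTerm this, hn] at h
    cases h

/-- If all premises of a permitted inference were derivable, so would be the conclusion. A path of
underivable premises thus replaces the construction of a tree. -/
theorem Bad.exists_of_infer {Θ : Sequent 𝔖.L} (h : Bad Θ) {ρ : Rule 𝔖.L} (hρ : 𝔖.Applies Θ ρ)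
    (hstar : 𝔖.StarRule ρ) : ∃ Θ', 𝔖.IsPremise Θ Θ' ρ ∧ ¬ Good Θ' := by
  by_contra! hcon
  exact h.2 (good_of_infer h.1.seq hρ hstar hcon)

/-- A fresh expression can be put into the domain of an underivable sequent. -/
theorem Bad.exists_cut {Θ : Sequent 𝔖.L} (h : Bad Θ) {e : CanExpr 𝔖.L} (hf : 𝔖.Fresh Θ e) :
    ∃ Θ', Bad Θ' ∧ Ext Θ Θ' ∧ Θ'.S e ≠ none ∧
      ∀ e', e'.IsTerm → e' ≠ e → Θ'.S e' = Θ.S e' := by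
  have key : ∀ u i, ¬ Good (Θ.add e u i) → Inv (Θ.add e u i) → (Ω < 𝔖.rk e → u = .unk) →
      ∃ Θ', Bad Θ' ∧ Ext Θ Θ' ∧ Θ'.S e ≠ none ∧
        ∀ e', e'.IsTerm → e' ≠ e → Θ'.S e' = Θ.S e' := fun u i h2 h1 h3 =>
    ⟨_, ⟨h1, h2⟩, ext_add hf.2 h3, by simp [Sequent.add], fun e' _ he' => by
      simp [Sequent.add, Function.update_of_ne he']⟩
  -- The rank dictates the rule: `Cut` below `Ω`, `Fr` above, `CutFr^{Ω,term}` for `c_n`,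
  -- `Cut^{Ω,form}` for `n ∈ I`. The labels in their premises are those that `Inv` demands. `Fr` has
  -- only the premise with value `?`, whence the clause `high` of `Ext`.
  rcases canExpr_cases e with hne | ⟨n, rfl⟩ | ⟨n, rfl⟩
  · have ht := isTerm_of_rk_ne hne
    rcases lt_or_gt_of_ne hne with hlt | hgt
    · obtain ⟨Θ', rfl | ⟨u, rfl⟩, hg⟩ :=
        h.exists_of_infer (ρ := .cut e) ⟨hf, ht, hne⟩ hlt.le
      · refine key _ _ hg (h.1.add hf ?_ nofun (by simp) (by simp) fun _ _ hle => ?_)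
          fun _ => rfl
        · cases e <;> trivial
        · exact absurd hlt (not_lt.2 hle)
      · refine key _ _ hg (h.1.add hf ?_ nofun (by simp [hne]) (by simp) nofun)
          fun hgt => absurd hlt hgt.asymm
        cases e with
        | mem n => exact ht.elim
        | term φ a => trivial
    · obtain ⟨Θ', rfl, hg⟩ := h.exists_of_infer (ρ := .fr e) hf hgt
      refine key _ _ hg (h.1.add hf ?_ nofun (by simp) ?_ fun _ _ _ => rfl) fun _ => rfl
      · cases e <;> trivial
      · rintro (hlt | hnt)
        · exact absurd hlt hgt.asymm
        · exact absurd ht hnt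
  · obtain ⟨Θ', rfl | ⟨u, rfl⟩, hg⟩ :=
      h.exists_of_infer (ρ := .cutFrTerm (𝔖.c n)) ⟨hf, trivial, 𝔖.rk_c n⟩ (𝔖.rk_c n)
    · refine key _ _ hg (h.1.add hf trivial nofun (by simp) ?_ fun _ _ _ => rfl) fun _ => rfl
      rintro (hlt | hnt)
      · exact absurd hlt (by simp [rk_c])
      · exact absurd trivial hnt
    · refine key _ _ hg (h.1.add hf trivial nofun (by simp [rk_c]) (by simp) nofun)
        fun hgt => absurd hgt (by simp [rk_c])
  · obtain ⟨Θ', rfl | ⟨Pe, Ve, hp, hh, rfl⟩, hg⟩ :=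
      h.exists_of_infer (ρ := .cutForm n) hf trivial
    · exact key _ _ hg (h.1.add hf trivial nofun (by simp) (by simp) fun _ ht _ => ht.elim)
        fun _ => rfl
    · refine ⟨_, ⟨h.1.addForm hp hh, hg⟩, ext_addForm hp, ?_, fun e' he' _ =>
        addForm_S_of_isTerm he'⟩
      rw [addForm_S_mem, if_pos]
      · exact Option.some_ne_none _
      · exact List.mem_of_getLast? hp.2.2.2.1

end System

namespace System

variable {𝔖 : System}

/-! ## Deciding expressions in underivable sequents -/

/-- If `e` is a term whose value is a numeral `u`, then what has to be consulted to check
`F(e, u)` is in the domain. -/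
def Justified (S : Subst 𝔖.L) : CanExpr 𝔖.L → Prop
  | .term φ a => ∀ u : ℕ+, S (.term φ a) = some (.num u) →
      ∀ v ≤ (u : ℕ), φ.Dec S (Fin.cons v a : Fin _ → ℕ)
  | .mem _ => True

theorem Justified.mono {S T : Subst 𝔖.L} (hST : ∀ e u, S e = some u → T e = some u)
    {e : CanExpr 𝔖.L} (he : S e ≠ none) (h : Justified S e) : Justified T e := by
  cases e with
  | mem n => trivial
  | term φ a =>
    intro u hu v hv
    obtain ⟨w, hw⟩ := Option.ne_none_iff_exists'.1 he
    have := hST _ _ hw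
    rw [hu] at this
    rw [← this] at hw
    exact ((h u hw v hv).mono hST).1

/-- An extension in which the numerical values of new terms are justified. -/
structure DExt (Θ Θ' : Sequent 𝔖.L) : Prop extends Ext Θ Θ' where
  just : ∀ e, Θ.S e = none → Justified Θ'.S e

theorem DExt.refl (Θ : Sequent 𝔖.L) : DExt Θ Θ := by
  refine ⟨Ext.refl Θ, fun e he => ?_⟩
  cases e with
  | mem n => trivial
  | term φ a =>
    intro u hu
    rw [he] at hu
    cases hu

theorem DExt.trans {Θ Θ' Θ'' : Sequent 𝔖.L} (h : DExt Θ Θ') (h' : DExt Θ' Θ'') : DExt Θ Θ'' := by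
  refine ⟨h.toExt.trans h'.toExt, fun e he => ?_⟩
  by_cases he' : Θ'.S e = none
  · exact h'.just e he'
  · exact (h.just e he).mono h'.sub he'

theorem DExt.justified {Θ Θ' : Sequent 𝔖.L} (h : DExt Θ Θ') (hΘ : ∀ e, Justified Θ.S e)
    (e : CanExpr 𝔖.L) : Justified Θ'.S e := by
  by_cases he : Θ.S e = none
  · exact h.just e he
  · exact (hΘ e).mono h.sub he

/-- Properties stable under extension can be achieved one after the other. -/
theorem Bad.exists_forall {ι : Type*} {p : ι → Sequent 𝔖.L → Prop}
    (hmono : ∀ i Θ Θ', Ext Θ Θ' → p i Θ → p i Θ') (l : List ι)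
    (h : ∀ i ∈ l, ∀ Θ, Bad Θ → ∃ Θ', Bad Θ' ∧ DExt Θ Θ' ∧ p i Θ') {Θ : Sequent 𝔖.L} (hΘ : Bad Θ) :
    ∃ Θ', Bad Θ' ∧ DExt Θ Θ' ∧ ∀ i ∈ l, p i Θ' := by
  induction l with
  | nil => exact ⟨Θ, hΘ, .refl Θ, nofun⟩
  | cons i l ih =>
    obtain ⟨Θ₁, hb₁, hx₁, hp₁⟩ := ih fun j hj => h j (List.mem_cons_of_mem _ hj)
    obtain ⟨Θ₂, hb₂, hx₂, hp₂⟩ := h i List.mem_cons_self Θ₁ hb₁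
    refine ⟨Θ₂, hb₂, hx₁.trans hx₂, fun j hj => ?_⟩
    rcases List.mem_cons.1 hj with rfl | hj
    · exact hp₂
    · exact hmono j _ _ hx₂.toExt (hp₁ j hj)

/-- Induction on the expression, cutting each canonical expression when evaluation reaches it. The
induction also covers the index of a Skolem symbol, which is what allows new numerical values to be
justified at once. -/
theorem Bad.exists_dec {κ : Kind} {n : ℕ} {E : Expr 𝔖.L κ n} (hE : E.InLang) (a : Fin n → ℕ)
    {Θ : Sequent 𝔖.L} (hΘ : Bad Θ) : ∃ Θ', Bad Θ' ∧ DExt Θ Θ' ∧ E.Dec Θ'.S a := by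
  have hfam : ∀ {k n : ℕ} (t : Fin k → Tm 𝔖.L n) (a : Fin n → ℕ),
      (∀ i (Θ : Sequent 𝔖.L), Bad Θ → ∃ Θ', Bad Θ' ∧ DExt Θ Θ' ∧ (t i).Dec Θ'.S a) →
      ∀ Θ : Sequent 𝔖.L, Bad Θ → ∃ Θ', Bad Θ' ∧ DExt Θ Θ' ∧ ∀ i, (t i).Dec Θ'.S a := by
    intro k n t a h Θ hΘ
    obtain ⟨Θ', hb, hx, hd⟩ := hΘ.exists_forall
      (p := fun i Υ => (t i).Dec Υ.S a) (fun i _ _ hx hd => (hd.mono hx.sub).1)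
      (List.finRange k) (fun i _ => h i)
    exact ⟨Θ', hb, hx, fun i => hd i (List.mem_finRange i)⟩
  induction E generalizing Θ with
  | var i => exact ⟨Θ, hΘ, .refl Θ, trivial⟩
  | fn f t ih => exact hfam t a (fun i _ hΘ => ih i (hE i) a hΘ) Θ hΘ
  | sk φ t ihφ ih =>
    obtain ⟨Θ₁, hb₁, hx₁, hd₁⟩ := hfam t a (fun i _ hΘ => ih i (hE.2.2 i) a hΘ) Θ hΘ
    let c : Fin _ → ℕ := fun i => evT Θ₁.S.nat Θ₁.S.holds a (t i)
    by_cases he : Θ₁.S (.term φ c) = none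
    · obtain ⟨Θ₂, hb₂, hx₂, hne₂, hterm₂⟩ := hb₁.exists_cut (e := .term φ c) ⟨⟨hE.1, hE.2.1⟩, he⟩
      -- The cut may have given the term a numeral `u`; so `φ` is decided at all `v ≤ u`. If the
      -- value is `?`, this concerns only `v = 0`.
      obtain ⟨Θ₃, hb₃, hx₃, hd₃⟩ := hb₂.exists_forall
        (p := fun v Υ => φ.Dec Υ.S (Fin.cons v c : Fin _ → ℕ))
        (fun i _ _ hx hd => (hd.mono hx.sub).1)
        (List.range (Θ₂.S.nat (.term φ c) + 1)) (fun v _ Υ hΥ => ihφ hE.2.1 _ hΥ)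
      have hx₁₃ := hx₂.trans hx₃.toExt
      have hj : DExt Θ₁ Θ₃ := by
        refine ⟨hx₁₃, fun e' he' => ?_⟩
        by_cases hee : e' = .term φ c
        · subst hee
          intro u hu v hv
          refine hd₃ v (List.mem_range.2 ?_)
          obtain ⟨w, hw⟩ := Option.ne_none_iff_exists'.1 hne₂
          have := hx₃.sub _ _ hw
          rw [hu] at this
          rw [← this] at hw
          simp only [Subst.nat, Subst.val, hw, Option.getD_some, Val.toNat]
          omega
        · cases e' with
          | mem n => trivial
          | term ψ b => exact hx₃.just _ ((hterm₂ (.term ψ b) trivial hee).trans he')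
      refine ⟨Θ₃, hb₃, hx₁.trans hj, fun i => ((hd₁ i).mono hx₁₃.sub).1, ?_⟩
      have : (fun i => evT Θ₃.S.nat Θ₃.S.holds a (t i)) = c :=
        funext fun i => ((hd₁ i).mono hx₁₃.sub).2
      rw [this]
      exact hx₃.ne_none hne₂
    · exact ⟨Θ₁, hb₁, hx₁, hd₁, he⟩
  | rel R t ih => exact hfam t a (fun i _ hΘ => ih i (hE i) a hΘ) Θ hΘ
  | mem t ih =>
    obtain ⟨Θ₁, hb₁, hx₁, hd₁⟩ := ih hE a hΘ
    by_cases he : Θ₁.S (.mem (evT Θ₁.S.nat Θ₁.S.holds a t)) = none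
    · obtain ⟨Θ₂, hb₂, hx₂, hne₂, hterm₂⟩ := hb₁.exists_cut
        (e := .mem (evT Θ₁.S.nat Θ₁.S.holds a t)) ⟨trivial, he⟩
      have hj : DExt Θ₁ Θ₂ := by
        refine ⟨hx₂, fun e' he' => ?_⟩
        cases e' with
        | mem n => trivial
        | term ψ b =>
          intro u hu
          rw [hterm₂ (.term ψ b) trivial nofun, he'] at hu
          cases hu
      have h2 := hd₁.mono hx₂.sub
      refine ⟨Θ₂, hb₂, hx₁.trans hj, h2.1, ?_⟩
      have : evT Θ₂.S.nat Θ₂.S.holds a t = evT Θ₁.S.nat Θ₁.S.holds a t := h2.2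
      rw [this]
      exact hne₂
    · exact ⟨Θ₁, hb₁, hx₁, hd₁, he⟩
  | top => exact ⟨Θ, hΘ, .refl Θ, trivial⟩
  | bot => exact ⟨Θ, hΘ, .refl Θ, trivial⟩
  | neg φ ih => exact ih hE a hΘ
  | and φ ψ ih₁ ih₂ =>
    obtain ⟨Θ₁, hb₁, hx₁, hd₁⟩ := ih₁ hE.1 a hΘ
    obtain ⟨Θ₂, hb₂, hx₂, hd₂⟩ := ih₂ hE.2 a hb₁
    exact ⟨Θ₂, hb₂, hx₁.trans hx₂, (hd₁.mono hx₂.sub).1, hd₂⟩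
  | or φ ψ ih₁ ih₂ =>
    obtain ⟨Θ₁, hb₁, hx₁, hd₁⟩ := ih₁ hE.1 a hΘ
    obtain ⟨Θ₂, hb₂, hx₂, hd₂⟩ := ih₂ hE.2 a hb₁
    exact ⟨Θ₂, hb₂, hx₁.trans hx₂, (hd₁.mono hx₂.sub).1, hd₂⟩

theorem Bad.exists_dec_list (l : List (Σ κ, Expr 𝔖.L κ 0)) (hl : ∀ x ∈ l, x.2.InLang)
    {Θ : Sequent 𝔖.L} (hΘ : Bad Θ) :
    ∃ Θ', Bad Θ' ∧ DExt Θ Θ' ∧ ∀ x ∈ l, x.2.Dec Θ'.S Fin.elim0 :=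
  hΘ.exists_forall (p := fun x Υ => x.2.Dec Υ.S Fin.elim0)
    (fun _ _ _ hx hd => (hd.mono hx.sub).1) l fun x hx _ hΥ => hΥ.exists_dec (hl x hx) _

/-- The domain is finite, so the old terms can be treated one by one; terms added on the way are
justified by `DExt`. -/
theorem Bad.exists_justified {Θ : Sequent 𝔖.L} (hΘ : Bad Θ) :
    ∃ Θ', Bad Θ' ∧ Ext Θ Θ' ∧ ∀ e, Justified Θ'.S e := by
  obtain ⟨Θ', hb, hx, hd⟩ := hΘ.exists_forall
    (p := fun e Υ => match e with
      | .term φ a => ∀ v ∈ List.range (Θ.S.nat (.term φ a) + 1),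
          φ.Dec Υ.S (Fin.cons v a : Fin _ → ℕ)
      | .mem _ => True)
    (fun e Υ Υ' hx hd => by
      cases e with
      | mem n => trivial
      | term φ a => exact fun v hv => ((hd v hv).mono hx.sub).1)
    hΘ.1.fin.toFinset.toList
    (fun e he Υ hΥ => by
      cases e with
      | mem n => exact ⟨Υ, hΥ, .refl Υ, trivial⟩
      | term φ a =>
        obtain ⟨u, hu⟩ : ∃ u, Θ.S (.term φ a) = some u := by
          simpa [Option.ne_none_iff_exists'] using he
        exact hΥ.exists_forall (p := fun v Υ => φ.Dec Υ.S (Fin.cons v a : Fin _ → ℕ))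
          (fun i _ _ hx hd => (hd.mono hx.sub).1) _
          (fun v _ Υ hΥ => hΥ.exists_dec (hΘ.1.seq.subst _ _ hu).1.2 _))
  refine ⟨Θ', hb, hx.toExt, fun e => ?_⟩
  by_cases he : Θ.S e = none
  · exact hx.just e he
  · cases e with
    | mem n => trivial
    | term φ a =>
      intro u hu v hv
      refine hd (.term φ a) (by simpa using he) v (List.mem_range.2 ?_)
      obtain ⟨w, hw⟩ := Option.ne_none_iff_exists'.1 he
      have := hx.sub _ _ hw
      rw [hu] at this
      rw [← this] at hw
      simp only [Subst.nat, Subst.val, hw, Option.getD_some, Val.toNat]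
      omega

/-! ### What the critical formulas consult -/

/-- The closed expressions to be decided for a critical formula. -/
def critExprs (Op : InductiveOperator 𝔖.L) : Crit 𝔖.L → List (Σ κ, Expr 𝔖.L κ 0)
  | .pred s => [⟨_, (Crit.pred s).toFml Op⟩, ⟨_, s⟩, ⟨_, .sk (predMatrix 𝔖.L) ![s]⟩]
  | .eps φ s t => [⟨_, (Crit.eps φ s t).toFml Op⟩, ⟨_, t⟩, ⟨_, .sk φ s⟩]
  | .ind φ s t => [⟨_, (Crit.ind φ s t).toFml Op⟩, ⟨_, t⟩, ⟨_, .sk (indMatrix φ) s⟩]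
  | .indDef t => [⟨_, (Crit.indDef t).toFml Op⟩, ⟨_, .mem t⟩, ⟨_, .sk Op.B.neg ![t]⟩]
  | .closure φ s => [⟨_, (Crit.closure φ s).toFml Op⟩, ⟨_, .sk (Op.closedUnder φ).neg s⟩,
      ⟨_, .mem (.sk (memImp φ).neg s)⟩]

theorem toFml_mem_critExprs (Op : InductiveOperator 𝔖.L) (C : Crit 𝔖.L) :
    ⟨_, C.toFml Op⟩ ∈ critExprs Op C := by
  cases C <;> exact List.mem_cons_self

theorem inLang_critExprs (Op : InductiveOperator 𝔖.L) {C : Crit 𝔖.L} (h : C.InLang) :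
    ∀ x ∈ critExprs Op C, x.2.InLang := by
  have h0 := h.toFml Op
  have key : ∀ {κ₁ κ₂ : Kind} {E₁ : Expr 𝔖.L κ₁ 0} {E₂ : Expr 𝔖.L κ₂ 0}, E₁.InLang → E₂.InLang →
      ∀ x ∈ [(⟨_, C.toFml Op⟩ : Σ κ, Expr 𝔖.L κ 0), ⟨_, E₁⟩, ⟨_, E₂⟩], x.2.InLang := by
    intro κ₁ κ₂ E₁ E₂ h1 h2 x hx
    simp only [List.mem_cons, List.not_mem_nil, or_false] at hx
    rcases hx with rfl | rfl | rfl
    exacts [h0, h1, h2]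
  cases C with
  | pred s =>
    exact key h ⟨simple_predMatrix, inLang_predMatrix, fun i => by fin_cases i; exact h⟩
  | eps φ s t => exact key h.2.2.2 ⟨h.1, h.2.1, h.2.2.1⟩
  | ind φ s t => exact key h.2.2.2 ⟨h.1.indMatrix, h.2.1.indMatrix, h.2.2.1⟩
  | indDef t =>
    have h' : t.InLang := h
    exact key h' ⟨Op.simple, Op.inLang_B, fun i => by fin_cases i; exact h'⟩
  | closure φ s =>
    exact key (E₂ := .mem _) ⟨Op.simple_closedUnder h.1, Op.inLang_closedUnder h.2.1 h.1, h.2.2⟩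
      ⟨h.1.memImp, h.2.1.memImp, h.2.2⟩

/-- What is consulted by the `H`-step for a critical formula has been decided. -/
def Consulted (Θ : Sequent 𝔖.L) : Crit 𝔖.L → Prop
  | .ind φ s t => ∀ m ≤ Θ.S.num t, (φ.app (.numeral m) s).Dec Θ.S Fin.elim0
  | .closure φ s => ∃ P₀, P₀ <+: Θ.P ∧
      (Θ.S.holds (Θ.S.num (.sk (memImp φ).neg s)) → Θ.S.num (.sk (memImp φ).neg s) ∈ P₀) ∧
      ∀ m ∈ P₀, (φ.app (.numeral m) s).Dec Θ.S Fin.elim0 ∧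
        (𝔖.Op.AOf φ (.numeral m) s).Dec Θ.S Fin.elim0 ∧
        (Expr.sk (𝔖.Op.BOf φ).neg (Fin.cons (.numeral m) s)).Dec Θ.S Fin.elim0 ∧
        Θ.S (𝔖.c m) ≠ none
  | _ => True

/-- A critical formula and everything connected with its `H`-step has been decided. -/
def CritDecided (C : Crit 𝔖.L) (Θ : Sequent 𝔖.L) : Prop :=
  (∀ x ∈ critExprs 𝔖.Op C, x.2.Dec Θ.S Fin.elim0) ∧ Consulted Θ C

theorem CritDecided.mono {C : Crit 𝔖.L} {Θ Θ' : Sequent 𝔖.L} (hx : Ext Θ Θ')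
    (h : CritDecided C Θ) : CritDecided C Θ' := by
  refine ⟨fun x hm => ((h.1 x hm).mono hx.sub).1, ?_⟩
  obtain ⟨h1, h2⟩ := h
  cases C with
  | pred s => trivial
  | eps φ s t => trivial
  | indDef t => trivial
  | ind φ s t =>
    have ht : t.Dec Θ.S Fin.elim0 := h1 ⟨_, t⟩ (by simp [critExprs])
    have : Θ'.S.num t = Θ.S.num t := (ht.mono hx.sub).2
    intro m hm
    rw [this] at hm
    exact ((h2 m hm).mono hx.sub).1
  | closure φ s =>
    have hw : (Expr.mem (.sk (memImp φ).neg s)).Dec Θ.S Fin.elim0 :=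
      h1 ⟨_, .mem (.sk (memImp φ).neg s)⟩ (by simp [critExprs])
    have e1 : Θ'.S.num (.sk (memImp φ).neg s) = Θ.S.num (.sk (memImp φ).neg s) :=
      (hw.1.mono hx.sub).2
    have e2 : Θ'.S.holds (Θ'.S.num (.sk (memImp φ).neg s)) =
        Θ.S.holds (Θ.S.num (.sk (memImp φ).neg s)) := (hw.mono hx.sub).2
    -- The history may have grown, but the same initial segment `P₀` still contains the witness of
    -- failure, whose value has been decided.
    obtain ⟨P₀, hp, hP, hd⟩ := h2
    refine ⟨P₀, hp.trans hx.pre, ?_, fun m hm => ?_⟩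
    · rw [e2, e1]
      exact hP
    · obtain ⟨a1, a2, a3, a4⟩ := hd m hm
      exact ⟨(a1.mono hx.sub).1, (a2.mono hx.sub).1, (a3.mono hx.sub).1, hx.ne_none a4⟩

theorem IsSequent.eq_top {Θ : Sequent 𝔖.L} (h : 𝔖.IsSequent Θ) {n : ℕ} (hn : Θ.S.holds n) :
    Θ.S (.mem n) = some .top := by
  cases hS : Θ.S (.mem n) with
  | none => exact absurd (by simp [Subst.val, hS]) hn
  | some u =>
    cases u with
    | unk => exact absurd (by simp [Subst.val, hS]) hn
    | top => rfl
    | num u => exact (h.subst _ _ hS).2.elim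

/-- Two passes are needed: the value of `t` in Induction, or the witness and the history in Closure,
is known only after the first, and determines what the second has to decide. -/
theorem Bad.exists_critDecided {C : Crit 𝔖.L} (hC : C.InLang) {Θ : Sequent 𝔖.L} (hΘ : Bad Θ) :
    ∃ Θ', Bad Θ' ∧ DExt Θ Θ' ∧ CritDecided C Θ' := by
  obtain ⟨Θ₁, hb₁, hx₁, hd₁⟩ := hΘ.exists_dec_list _ (inLang_critExprs 𝔖.Op hC)
  cases C with
  | pred s => exact ⟨Θ₁, hb₁, hx₁, hd₁, trivial⟩
  | eps φ s t => exact ⟨Θ₁, hb₁, hx₁, hd₁, trivial⟩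
  | indDef t => exact ⟨Θ₁, hb₁, hx₁, hd₁, trivial⟩
  | ind φ s t =>
    obtain ⟨Θ₂, hb₂, hx₂, hd₂⟩ := hb₁.exists_dec_list
      ((List.range (Θ₁.S.num t + 1)).map fun m => ⟨_, φ.app (.numeral m) s⟩)
      (by
        intro x hx
        obtain ⟨m, -, rfl⟩ := List.mem_map.1 hx
        exact hC.2.1.app (inLang_numeral m) hC.2.2.1)
    refine ⟨Θ₂, hb₂, hx₁.trans hx₂, fun x hm => ((hd₁ x hm).mono hx₂.sub).1, fun m hm => ?_⟩
    have ht : t.Dec Θ₁.S Fin.elim0 := hd₁ ⟨_, t⟩ (by simp [critExprs])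
    have : Θ₂.S.num t = Θ₁.S.num t := (ht.mono hx₂.sub).2
    rw [this] at hm
    exact hd₂ ⟨_, φ.app (.numeral m) s⟩
      (List.mem_map.2 ⟨m, List.mem_range.2 (Nat.lt_succ_of_le hm), rfl⟩)
  | closure φ s =>
    obtain ⟨Θ₂, hb₂, hx₂, hd₂⟩ := hb₁.exists_dec_list
      (Θ₁.P.flatMap fun m => [⟨_, φ.app (.numeral m) s⟩, ⟨_, 𝔖.Op.AOf φ (.numeral m) s⟩,
        ⟨_, .sk (𝔖.Op.BOf φ).neg (Fin.cons (.numeral m) s)⟩, ⟨_, .sk 𝔖.Op.B.neg ![.numeral m]⟩])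
      (by
        intro x hx
        obtain ⟨m, -, hm⟩ := List.mem_flatMap.1 hx
        simp only [List.mem_cons, List.not_mem_nil, or_false] at hm
        rcases hm with rfl | rfl | rfl | rfl
        · exact hC.2.1.app (inLang_numeral m) hC.2.2
        · exact 𝔖.Op.inLang_AOf hC.2.1 hC.1 (inLang_numeral m) hC.2.2
        · exact ⟨𝔖.Op.simple_BOf hC.1, 𝔖.Op.inLang_BOf hC.2.1,
            forall_cons (inLang_numeral m) hC.2.2⟩
        · exact ⟨𝔖.Op.simple, 𝔖.Op.inLang_B, fun i => by fin_cases i; exact inLang_numeral m⟩)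
    -- `P₀` is the history after the first pass. Cuts in the second pass may append entries for
    -- which nothing is decided; they come after the witness of failure and do no harm.
    refine ⟨Θ₂, hb₂, hx₁.trans hx₂, fun x hm => ((hd₁ x hm).mono hx₂.sub).1, Θ₁.P, hx₂.pre,
      fun hw => ?_, fun m hm => ?_⟩
    · have hdw : (Expr.mem (.sk (memImp φ).neg s)).Dec Θ₁.S Fin.elim0 :=
        hd₁ ⟨_, .mem (.sk (memImp φ).neg s)⟩ (by simp [critExprs])
      have e1 : Θ₂.S.num (.sk (memImp φ).neg s) = Θ₁.S.num (.sk (memImp φ).neg s) :=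
        (hdw.1.mono hx₂.sub).2
      have e2 : Θ₂.S.holds (Θ₂.S.num (.sk (memImp φ).neg s)) =
          Θ₁.S.holds (Θ₁.S.num (.sk (memImp φ).neg s)) := (hdw.mono hx₂.sub).2
      rw [e1]
      rw [e2] at hw
      exact (hb₁.1.seq.mem_P _).2 (hb₁.1.seq.eq_top hw)
    · have hmem := fun x hx => hd₂ x (List.mem_flatMap.2 ⟨m, hm, hx⟩)
      refine ⟨hmem ⟨_, _⟩ (List.mem_cons_self),
        hmem ⟨_, _⟩ (List.mem_cons_of_mem _ List.mem_cons_self),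
        hmem ⟨_, _⟩ (List.mem_cons_of_mem _ (List.mem_cons_of_mem _ List.mem_cons_self)), ?_⟩
      have h4 := (hmem ⟨_, _⟩ (List.mem_cons_of_mem _ (List.mem_cons_of_mem _
        (List.mem_cons_of_mem _ List.mem_cons_self)))).2
      have : (fun i => evT Θ₂.S.nat Θ₂.S.holds Fin.elim0
          ((![.numeral m] : Fin 1 → Tm 𝔖.L 0) i)) = ![m] := by
        funext i
        fin_cases i
        exact evT_numeral m
      rw [this] at h4
      exact h4

/-- `Cut^{Ω,form}` adds formulas only. As no term changes, no new `c_m` calls for a further `m ∈ I`,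
and justifications are not disturbed. -/
theorem Bad.exists_mem_dom (l : List ℕ) {Θ : Sequent 𝔖.L} (hΘ : Bad Θ) :
    ∃ Θ', Bad Θ' ∧ Ext Θ Θ' ∧ (∀ m ∈ l, Θ'.S (.mem m) ≠ none) ∧
      ∀ e, e.IsTerm → Θ'.S e = Θ.S e := by
  induction l with
  | nil => exact ⟨Θ, hΘ, .refl Θ, nofun, fun _ _ => rfl⟩
  | cons n l ih =>
    obtain ⟨Θ₁, hb₁, hx₁, hm₁, ht₁⟩ := ih
    by_cases hn : Θ₁.S (.mem n) = none
    · obtain ⟨Θ₂, hb₂, hx₂, hn₂, ht₂⟩ := hb₁.exists_cut (e := .mem n) ⟨trivial, hn⟩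
      refine ⟨Θ₂, hb₂, hx₁.trans hx₂, fun m hm => ?_, fun e he => ?_⟩
      · rcases List.mem_cons.1 hm with rfl | hm
        · exact hn₂
        · exact hx₂.ne_none (hm₁ m hm)
      · rw [ht₂ e he (by rintro rfl; exact he), ht₁ e he]
    · refine ⟨Θ₁, hb₁, hx₁, fun m hm => ?_, ht₁⟩
      rcases List.mem_cons.1 hm with rfl | hm
      · exact hn
      · exact hm₁ m hm

/-- An underivable sequent in which everything the `H`-step depends on is decided. -/
structure Ready (Θ : Sequent 𝔖.L) : Prop where
  bad : Bad Θ
  just : ∀ e, Justified Θ.S e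
  crit : ∀ J, CritDecided (𝔖.Cr J) Θ
  mem_dom : ∀ m, Θ.S (𝔖.c m) ≠ none → Θ.S (.mem m) ≠ none

theorem Bad.exists_ready {Θ : Sequent 𝔖.L} (hΘ : Bad Θ) : ∃ Θ', Ready Θ' ∧ Ext Θ Θ' := by
  obtain ⟨Θ₁, hb₁, hx₁, hj₁⟩ := hΘ.exists_justified
  obtain ⟨Θ₂, hb₂, hx₂, hc₂⟩ := hb₁.exists_forall (p := fun J => CritDecided (𝔖.Cr J))
    (fun _ _ _ hx h => h.mono hx) (List.finRange 𝔖.N)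
    (fun J _ Υ hΥ => hΥ.exists_critDecided (𝔖.cr_inLang J))
  have hj₂ := hx₂.justified hj₁
  have hfin : {m | Θ₂.S (𝔖.c m) ≠ none}.Finite :=
    hb₂.1.fin.preimage 𝔖.c_injective.injOn
  obtain ⟨Θ₃, hb₃, hx₃, hm₃, ht₃⟩ := hb₂.exists_mem_dom hfin.toFinset.toList
  refine ⟨Θ₃, ⟨hb₃, fun e => ?_, fun J => (hc₂ J (List.mem_finRange J)).mono hx₃, fun m hm => ?_⟩,
    (hx₁.trans hx₂.toExt).trans hx₃⟩
  · cases e with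
    | mem n => trivial
    | term φ a =>
      intro u hu v hv
      rw [ht₃ (.term φ a) trivial] at hu
      exact ((hj₂ (.term φ a) u hu v hv).mono hx₃.sub).1
  · refine hm₃ m ?_
    rw [ht₃ _ (𝔖.isTerm_c m)] at hm
    simpa using hm

end System

namespace System

variable {𝔖 : System}

/-! ## The `H`-step on `Ω`-expressions -/

section HStep

variable {Θ : Sequent 𝔖.L}

theorem hStep_c (n : ℕ) (v : Val) : 𝔖.hStep Θ (𝔖.c n) v = 𝔖.hNeg Θ n v := by
  have h : ∃ m, 𝔖.c n = 𝔖.c m := ⟨n, rfl⟩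
  rw [hStep, dif_pos h, ← 𝔖.c_injective h.choose_spec]

theorem hStep_mem (n : ℕ) (v : Val) : 𝔖.hStep Θ (.mem n) v = 𝔖.hPos Θ n := by
  rw [hStep, dif_neg]
  rintro ⟨m, hm⟩
  exact 𝔖.c_ne_mem m n hm.symm

theorem hStep_of_rk_ne {e : CanExpr 𝔖.L} (he : 𝔖.rk e ≠ Ω) (v : Val) :
    𝔖.hStep Θ e v = 𝔖.hOther Θ e v := by
  rw [hStep, dif_neg]
  · cases e with
    | mem n => exact absurd rfl he
    | term φ a => rfl
  · rintro ⟨m, rfl⟩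
    exact he (𝔖.rk_c m)

theorem takeWhile_ne {P : List ℕ} {n : ℕ} (hn : n ∉ P) :
    (P.takeWhile fun m => decide (m ≠ n)) = P := by
  rw [List.takeWhile_eq_self_iff]
  intro m hm
  simp only [ne_eq, decide_eq_true_eq]
  rintro rfl
  exact hn hm

theorem hNeg_S_self (n : ℕ) (v : Val) : (𝔖.hNeg Θ n v).S (𝔖.c n) = some v := by
  simp only [hNeg, Function.update_self]

theorem hNeg_S_of_notMem {n : ℕ} (hn : n ∉ Θ.P) (v : Val) {e : CanExpr 𝔖.L} (he : e ≠ 𝔖.c n) :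
    (𝔖.hNeg Θ n v).S e =
      ((Θ.S.restrict fun e' u => 𝔖.rk e' < Ω ∨
        ∃ m ∈ Θ.P, (e' = 𝔖.c m ∧ u = .unk) ∨ (e' = .mem m ∧ u = .top)) e).or
          (Θ.S.restrict 𝔖.IsNeg e) := by
  simp only [hNeg, Function.update_of_ne he, takeWhile_ne hn, if_neg hn]

/-- The pairs kept by the `H`-step with `H`-expression `c_n`, `n ∈ I` not in the history. -/
theorem hNeg_S_kept (hs : 𝔖.IsSequent Θ) {n : ℕ} (hn : n ∉ Θ.P) (v : Val) {e : CanExpr 𝔖.L}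
    (he : e ≠ 𝔖.c n) (hr : 𝔖.rk e ≤ Ω) {u : Val} (hu : Θ.S e = some u)
    (hnu : ¬ (u = .unk ∧ ∃ m, e = 𝔖.c m)) : (𝔖.hNeg Θ n v).S e = some u := by
  rw [hNeg_S_of_notMem hn v he]
  simp only [Subst.restrict, hu]
  rcases canExpr_cases e with hne | ⟨m, rfl⟩ | ⟨m, rfl⟩
  · rw [if_pos (.inl (lt_of_le_of_ne hr hne))]
    rfl
  · have : 𝔖.IsNeg (𝔖.c m) u := by
      cases u with
      | unk => exact absurd ⟨rfl, m, rfl⟩ hnu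
      | num w => exact .inr ⟨m, w, rfl, rfl⟩
      | top => exact (hs.subst _ _ hu).2.elim
    rw [if_pos this]
    split_ifs <;> rfl
  · cases u with
    | unk =>
      have : 𝔖.IsNeg (.mem m) .unk := .inl ⟨m, rfl, rfl⟩
      rw [if_pos this]
      split_ifs <;> rfl
    | num w => exact (hs.subst _ _ hu).2.elim
    | top =>
      rw [if_pos (.inr ⟨m, (hs.mem_P m).2 hu, .inr ⟨rfl, rfl⟩⟩)]
      rfl

theorem of_hNeg_S {n : ℕ} (hn : n ∉ Θ.P) {v : Val} {e : CanExpr 𝔖.L} (he : e ≠ 𝔖.c n) {u : Val}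
    (hu : (𝔖.hNeg Θ n v).S e = some u) : Θ.S e = some u ∧ 𝔖.rk e ≤ Ω := by
  rw [hNeg_S_of_notMem hn v he] at hu
  simp only [Subst.restrict] at hu
  cases hS : Θ.S e with
  | none => simp [hS] at hu
  | some w =>
    simp only [hS] at hu
    split_ifs at hu with h1 h2 h3
    · obtain rfl := Option.some.inj hu
      refine ⟨rfl, ?_⟩
      rcases h1 with h1 | ⟨m, -, ⟨rfl, -⟩ | ⟨rfl, -⟩⟩
      · exact h1.le
      · exact (𝔖.rk_c m).le
      · exact (𝔖.rk_mem m).le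
    · obtain rfl := Option.some.inj hu
      refine ⟨rfl, ?_⟩
      rcases h1 with h1 | ⟨m, -, ⟨rfl, -⟩ | ⟨rfl, -⟩⟩
      · exact h1.le
      · exact (𝔖.rk_c m).le
      · exact (𝔖.rk_mem m).le
    · obtain rfl := Option.some.inj hu
      refine ⟨rfl, ?_⟩
      rcases h3 with ⟨m, rfl, -⟩ | ⟨m, w, rfl, -⟩
      · exact (𝔖.rk_mem m).le
      · exact (𝔖.rk_c m).le
    · cases hu

/-- With `n ∈ I` outside the history, the step on `c_n` retains all pairs of rank at most `Ω` other
than those of the form `(c_m, ?)`. -/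
theorem active_c (hs : 𝔖.IsSequent Θ) {n : ℕ} (hn : n ∉ Θ.P) (hu : Θ.S (𝔖.c n) = some .unk)
    {v : Val} {e : CanExpr 𝔖.L} (h : 𝔖.Active Θ (𝔖.c n) v e) :
    Θ.S e = some .unk ∧ ∃ m, e = 𝔖.c m := by
  by_cases he : e = 𝔖.c n
  · subst he
    exact ⟨hu, n, rfl⟩
  · obtain ⟨h1, h2, h3⟩ := h
    obtain ⟨u, hu⟩ := Option.ne_none_iff_exists'.1 h1
    rw [hStep_c] at h3
    rw [rk_c] at h2
    by_contra hcon
    refine h3 (hu ▸ hNeg_S_kept hs hn v he h2.le hu fun ⟨h4, h5⟩ => hcon ⟨h4 ▸ hu, h5⟩)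

/-- Were `n ∈ I` not in the history, all active expressions would be terms of rank `Ω` with value
`?`, which `Inv` makes temporary; so there would be no `AxH`. -/
theorem Inv.axHMem (h : Inv Θ) : AxHMem Θ := by
  rintro n v ⟨hH, e, ha, hF⟩
  by_contra hcon
  have hn : n ∉ Θ.P := fun hn => hcon ((h.seq.mem_P n).1 hn)
  obtain ⟨hu, m, rfl⟩ := active_c h.seq hn hH.2.2.2.2.2.1 ha
  rw [h.temp _ (𝔖.isTerm_c m) (𝔖.rk_c m).ge hu] at hF
  cases hF

theorem Bad.not_isAxiom (h : Bad Θ) : ¬ 𝔖.IsAxiom Θ := fun hax =>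
  h.2 (good_of_isAxiom h.1.seq hax h.1.axHMem)

end HStep

/-! ## Correctness -/

section Correct

variable {Θ : Sequent 𝔖.L}

theorem dec_conj {S : Subst 𝔖.L} {l : List (Fml 𝔖.L 0)} (h : ∀ φ ∈ l, φ.Dec S Fin.elim0) :
    (conj l).Dec S Fin.elim0 := by
  induction l with
  | nil => trivial
  | cons φ l ih =>
    rw [List.forall_mem_cons] at h
    exact ⟨h.1, ih h.2⟩

theorem dec_app_numeral {S : Subst 𝔖.L} {k : ℕ} {φ : Fml 𝔖.L (k + 1)} {v : ℕ} {a : Fin k → ℕ}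
    (h : φ.Dec S (Fin.cons v a : Fin _ → ℕ)) :
    (φ.app (.numeral v) fun i => .numeral (a i)).Dec S Fin.elim0 := by
  refine Dec.subst (forall_cons (p := fun t => t.Dec S Fin.elim0) (dec_numeral _)
    fun _ => dec_numeral _) ?_
  convert h using 1
  funext i
  refine Fin.cases ?_ (fun i => ?_) i
  · exact evT_numeral _
  · exact evT_numeral _

theorem isTrue_app_numeral {S : Subst 𝔖.L} {k : ℕ} {φ : Fml 𝔖.L (k + 1)} {v : ℕ}
    {a : Fin k → ℕ} : S.IsTrue (φ.app (.numeral v) fun i => .numeral (a i)) ↔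
      evF S.nat S.holds (Fin.cons v a) φ := by
  rw [Subst.IsTrue, evF_app]
  simp only [evT_numeral]

theorem Correct.evF {S : Subst 𝔖.L} (h : 𝔖.Correct S) {k : ℕ} {φ : Fml 𝔖.L (k + 1)}
    {a : Fin k → ℕ} {u : ℕ+} (hu : S (.term φ a) = some (.num u)) :
    evF S.nat S.holds (Fin.cons (u : ℕ) a) φ :=
  isTrue_app_numeral.1 (Subst.models_bar_iff.1 (h _ _ hu)).1

/-- Admissibility speaks of the set of earlier entries; positivity of `B` extends it to any larger
set, be it `I` itself or the set defined by some `φ` that holds of the earlier entries. -/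
theorem admissible_evF {P l r : List ℕ} {n : ℕ} (h : 𝔖.Admissible P) (hP : P = l ++ n :: r)
    (g : CanExpr 𝔖.L → ℕ) {X : ℕ → Prop} (hX : ∀ m ∈ l, X m) : evF g X ![0, n] 𝔖.Op.B := by
  have h1 := Subst.models_bar_iff.1 (h l n r hP)
  rw [Subst.IsTrue, evF_subst] at h1
  have : (fun i => evT (Subst.ofList (L := 𝔖.L) l).nat (Subst.ofList (L := 𝔖.L) l).holds Fin.elim0
      ((![.numeral 0, .numeral n] : Fin 2 → Tm 𝔖.L 0) i)) = ![0, n] := by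
    funext i
    fin_cases i
    · exact evT_numeral 0
    · exact evT_numeral n
  rw [this] at h1
  refine 𝔖.Op.evF_mono (fun m hm => hX m ?_) _ h1
  by_contra hcon
  exact hm (by simp [Subst.val, Subst.ofList, hcon])

theorem Ready.not_CI (h : Ready Θ) : ¬ 𝔖.CI Θ.S := fun hci => h.bad.not_isAxiom (.inl hci)

theorem Ready.c_eq_unk (h : Ready Θ) {n : ℕ} (hn : n ∈ Θ.P) (hd : Θ.S (𝔖.c n) ≠ none) :
    Θ.S (𝔖.c n) = some .unk := by
  obtain ⟨u, hu⟩ := Option.ne_none_iff_exists'.1 hd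
  cases u with
  | unk => exact hu
  | num u => exact absurd (.inr ⟨n, u, hu, (h.bad.1.seq.mem_P n).1 hn⟩) h.not_CI
  | top => exact (h.bad.1.seq.subst _ _ hu).2.elim

/-- For a numerical value, `F(e, u)` is decided in `S`, so its failure would be a computational
inconsistency. For `(n ∈ I, ⊤)`, consistency forbids a numeral at `c_n`. -/
theorem Ready.correct (h : Ready Θ) : 𝔖.Correct Θ.S := by
  intro e u hu
  rw [Subst.models_bar_iff]
  cases e with
  | term φ a =>
    cases u with
    | unk => trivial
    | top => trivial
    | num u =>
      have hj := h.just (.term φ a) u hu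
      have hd : (𝔖.F (.term φ a) (.num u)).Dec Θ.S Fin.elim0 := by
        refine ⟨dec_app_numeral (hj u le_rfl), dec_conj fun ψ hψ => ?_⟩
        obtain ⟨v, hv, rfl⟩ := List.mem_map.1 hψ
        exact dec_app_numeral (hj v (List.mem_range.1 hv).le)
      by_contra hcon
      exact h.not_CI (.inl ⟨_, _, hu, (Subst.models_iff (φ := Expr.neg _) hd).2 hcon⟩)
  | mem n =>
    cases u with
    | unk => trivial
    | num u => trivial
    | top =>
      have hn := (h.bad.1.seq.mem_P n).2 hu
      -- So `A(n, I)` reduces to `B(0, n, I)`, which is what admissibility of the history provides.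
      have h0 : Θ.S.nat (𝔖.c n) = 0 := by
        by_cases hd : Θ.S (𝔖.c n) = none
        · simp [Subst.nat, Subst.val, hd, Val.toNat]
        · simp [Subst.nat, Subst.val, h.c_eq_unk hn hd, Val.toNat]
      change Θ.S.IsTrue (𝔖.Op.AI (.numeral n))
      rw [Subst.IsTrue, 𝔖.Op.evF_AI, evT_numeral]
      change evF _ _ ![Θ.S.nat (𝔖.c n), n] _
      rw [h0]
      obtain ⟨l, r, hP⟩ := List.append_of_mem hn
      refine admissible_evF h.bad.1.adm hP _ fun m hm => ?_
      have hm' : Θ.S (.mem m) = some .top :=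
        (h.bad.1.seq.mem_P m).1 (hP ▸ List.mem_append_left _ hm)
      simp [Subst.holds, Subst.val, hm']

end Correct

end System

namespace System

variable {𝔖 : System}

/-! ## Existence of the `H`-expression and the `H`-value -/

/-- `β w` bounds all entries of `P` up to `w`. -/
def BoundsUpTo (β : ℕ → ℕ) (P : List ℕ) : Prop :=
  ∀ w ∈ P, ∀ n, (∀ P₀, P₀ <+: P → w ∈ P₀ → n ∈ P₀) → n ≤ β w

/-- The expression proposed by a critical formula, with a bound for the value proposed, unless the
expression is a formula or a term `c_n` with `n ∈ I` in the history. -/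
def critStep (Op : InductiveOperator 𝔖.L) (β : ℕ → ℕ) (g : CanExpr 𝔖.L → ℕ) (X : ℕ → Prop) :
    Crit 𝔖.L → CanExpr 𝔖.L × ℕ
  | .pred s => (.term (predMatrix 𝔖.L) ![evT g X Fin.elim0 s], evT g X Fin.elim0 s)
  | .eps φ s t => (.term φ fun i => evT g X Fin.elim0 (s i), evT g X Fin.elim0 t)
  | .ind φ s t => (.term (indMatrix φ) fun i => evT g X Fin.elim0 (s i), evT g X Fin.elim0 t)
  | .indDef t => (.mem (evT g X Fin.elim0 t), 0)
  | .closure φ s => (.term (Op.closedUnder φ).neg fun i => evT g X Fin.elim0 (s i),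
      β (evT g X Fin.elim0 (.sk (memImp φ).neg s)))

/-- `e` and `v` are proposed by the critical formula `C`, and all calculations take place in the
sequent. -/
structure Proposal (Θ : Sequent 𝔖.L) (C : Crit 𝔖.L) (e : CanExpr 𝔖.L) (v : Val) : Prop where
  expr : 𝔖.IsHExpr Θ.S.bar Θ.P e C
  value : 𝔖.IsHValue Θ.S.bar Θ.P v C
  uniq : ∀ e', 𝔖.IsHExpr Θ.S.bar Θ.P e' C → e' = e
  unk : Θ.S e = some .unk
  calcIn : 𝔖.CalcIn Θ.S Θ.P C
  c_dom : ∀ n, e = .mem n → Θ.S (𝔖.c n) ≠ none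
  fits : v.Fits e
  ne_unk : v ≠ .unk
  bound : ∀ β, BoundsUpTo β Θ.P → (∃ n ∈ Θ.P, e = 𝔖.c n) ∨ (∃ n, e = .mem n) ∨
    e = (critStep 𝔖.Op β Θ.S.nat Θ.S.holds C).1 ∧
      ∃ u : ℕ+, v = .num u ∧ (u : ℕ) ≤ (critStep 𝔖.Op β Θ.S.nat Θ.S.holds C).2

section Proposal

variable {Θ : Sequent 𝔖.L}

theorem evals_bar_iff_eq {S : Subst 𝔖.L} {k : ℕ} {s : Fin k → Tm 𝔖.L 0} {a : Fin k → ℕ} :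
    (∀ i, S.bar.Evals (s i) (a i)) ↔ a = fun i => S.num (s i) := by
  simp only [Subst.evals_bar_iff, funext_iff]
  exact forall_congr' fun _ => eq_comm

theorem isTrue_app {S : Subst 𝔖.L} {k : ℕ} {φ : Fml 𝔖.L (k + 1)} {m : ℕ}
    {s : Fin k → Tm 𝔖.L 0} : S.IsTrue (φ.app (.numeral m) s) ↔
      evF S.nat S.holds (Fin.cons m fun i => S.num (s i)) φ := by
  rw [Subst.IsTrue, evF_app, evT_numeral]

theorem models_bar_app {S : Subst 𝔖.L} {k : ℕ} {φ : Fml 𝔖.L (k + 1)} {m : ℕ}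
    {s : Fin k → Tm 𝔖.L 0} : S.bar.Models (φ.app (.numeral m) s) ↔
      evF S.nat S.holds (Fin.cons m fun i => S.num (s i)) φ :=
  Subst.models_bar_iff.trans isTrue_app

theorem models_bar_neg {S : Subst 𝔖.L} {φ : Fml 𝔖.L 0} : S.bar.Models φ.neg ↔ ¬ S.IsTrue φ :=
  Subst.models_bar_iff

/-- If the Skolem term `c_{∃x φ}(a)` does not yield a witness, then its value is `?`. -/
theorem Ready.eq_unk (h : Ready Θ) {k : ℕ} {φ : Fml 𝔖.L (k + 1)} {a : Fin k → ℕ}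
    (hd : Θ.S (.term φ a) ≠ none)
    (hn : ¬ evF Θ.S.nat Θ.S.holds (Fin.cons (Θ.S.nat (.term φ a)) a) φ) :
    Θ.S (.term φ a) = some .unk ∧ ¬ evF Θ.S.nat Θ.S.holds (Fin.cons 0 a) φ := by
  obtain ⟨u, hu⟩ := Option.ne_none_iff_exists'.1 hd
  have hnat : Θ.S.nat (.term φ a) = u.toNat := by simp [Subst.nat, Subst.val, hu]
  rw [hnat] at hn
  cases u with
  | unk => exact ⟨hu, hn⟩
  | num u => exact absurd (Correct.evF h.correct hu) hn
  | top => exact (h.bad.1.seq.subst _ _ hu).2.elim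

/-- The default value `0` of the Skolem term is not a witness, so `|s| ≠ 1`; with `|s| ≠ 0` the
proposed value `|s| - 1` is positive. -/
theorem Ready.proposal_pred (h : Ready Θ) {s : Tm 𝔖.L 0} (hd : CritDecided (.pred s) Θ)
    (hns : ¬ Θ.S.IsTrue ((Crit.pred s).toFml 𝔖.Op)) : ∃ e v, Proposal Θ (.pred s) e v := by
  have hds : s.Dec Θ.S Fin.elim0 := hd.1 ⟨_, s⟩ (by simp [critExprs])
  have hdsk : (Expr.sk (predMatrix 𝔖.L) ![s]).Dec Θ.S Fin.elim0 :=
    hd.1 ⟨_, .sk (predMatrix 𝔖.L) ![s]⟩ (by simp [critExprs])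
  have harg : (fun i => evT Θ.S.nat Θ.S.holds Fin.elim0 ((![s] : Fin 1 → Tm 𝔖.L 0) i)) =
      ![Θ.S.num s] := by
    funext i; fin_cases i; rfl
  have hdom : Θ.S (.term (predMatrix 𝔖.L) ![Θ.S.num s]) ≠ none := harg ▸ hdsk.2
  rw [Crit.toFml, Subst.IsTrue, evF_imp, evF_ex, harg, evF_neg, evF_eq, evT_zero] at hns
  push Not at hns
  obtain ⟨hu, h0⟩ := h.eq_unk hdom hns.2
  have hmat : ∀ v : ℕ, evF Θ.S.nat Θ.S.holds (Fin.cons v ![Θ.S.num s]) (predMatrix 𝔖.L) ↔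
      Θ.S.num s = v + 1 := fun v => by
    rw [predMatrix, evF_eq, evT_succ]
    rfl
  rw [hmat] at h0
  have hpos : 0 < Θ.S.num s - 1 := by
    have := hns.1
    change Θ.S.num s ≠ 0 at this
    omega
  refine ⟨.term (predMatrix 𝔖.L) ![Θ.S.num s], .num ⟨Θ.S.num s - 1, hpos⟩,
    ⟨_, Subst.evals_bar_iff.2 rfl, rfl⟩,
    ⟨⟨Θ.S.num s - 1, hpos⟩, Subst.evals_bar_iff.2 ?_, rfl⟩, ?_, hu,
    ⟨_, (Subst.evals_iff hds).2 rfl⟩, nofun, trivial, nofun,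
    fun _ _ => .inr (.inr ⟨rfl, _, rfl, Nat.sub_le _ _⟩)⟩
  · change Θ.S.num s = Θ.S.num s - 1 + 1
    omega
  · rintro e' ⟨m, hm, rfl⟩
    rw [Subst.evals_bar_iff] at hm
    rw [hm]

/-- Since the Skolem term has value `?` and `0` is not a witness, `|t|` cannot be `0`. -/
theorem Ready.proposal_eps (h : Ready Θ) {k : ℕ} {φ : Fml 𝔖.L (k + 1)} {s : Fin k → Tm 𝔖.L 0}
    {t : Tm 𝔖.L 0} (hd : CritDecided (.eps φ s t) Θ)
    (hns : ¬ Θ.S.IsTrue ((Crit.eps φ s t).toFml 𝔖.Op)) :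
    ∃ e v, Proposal Θ (.eps φ s t) e v := by
  have hdt : t.Dec Θ.S Fin.elim0 := hd.1 ⟨_, t⟩ (by simp [critExprs])
  have hdsk : (Expr.sk φ s).Dec Θ.S Fin.elim0 := hd.1 ⟨_, .sk φ s⟩ (by simp [critExprs])
  rw [Crit.toFml, Subst.IsTrue, evF_imp, evF_ex, evF_app] at hns
  push Not at hns
  obtain ⟨hu, h0⟩ := h.eq_unk hdsk.2 hns.2
  have hpos : 0 < Θ.S.num t := by
    rw [Nat.pos_iff_ne_zero]
    intro ht
    refine h0 ?_
    have := hns.1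
    rwa [show evT Θ.S.nat Θ.S.holds Fin.elim0 t = 0 from ht] at this
  refine ⟨.term φ fun i => Θ.S.num (s i), .num ⟨Θ.S.num t, hpos⟩,
    ⟨_, evals_bar_iff_eq.2 rfl, rfl⟩, ⟨⟨Θ.S.num t, hpos⟩, Subst.evals_bar_iff.2 rfl, rfl⟩, ?_, hu,
    ⟨fun i => ⟨_, (Subst.evals_iff (hdsk.1 i)).2 rfl⟩, _, (Subst.evals_iff hdt).2 rfl⟩, nofun,
    trivial, nofun, fun _ _ => .inr (.inr ⟨rfl, _, rfl, le_rfl⟩)⟩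
  rintro e' ⟨a, ha, rfl⟩
  rw [evals_bar_iff_eq.1 ha]

theorem exists_least_drop {p : ℕ → Prop} {M : ℕ} (h0 : p 0) (hM : ¬ p M) :
    ∃ u, IsLeast {m : ℕ | m < M ∧ p m ∧ ¬ p (m + 1)} u := by
  have hne : ∃ m, m < M ∧ p m ∧ ¬ p (m + 1) := by
    by_contra! hcon
    have : ∀ m ≤ M, p m := by
      intro m
      induction m with
      | zero => exact fun _ => h0
      | succ m ih => exact fun hm => hcon m (by omega) (ih (by omega))
    exact hM (this M le_rfl)
  exact ⟨Nat.find hne, Nat.find_spec hne, fun m hm => Nat.find_min' hne hm⟩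

/-- The least drop of `φ` is not at `0`, for then the default value `0` would already witness the
existential formula. -/
theorem Ready.proposal_ind (h : Ready Θ) {k : ℕ} {φ : Fml 𝔖.L (k + 1)} {s : Fin k → Tm 𝔖.L 0}
    {t : Tm 𝔖.L 0} (hd : CritDecided (.ind φ s t) Θ)
    (hns : ¬ Θ.S.IsTrue ((Crit.ind φ s t).toFml 𝔖.Op)) :
    ∃ e v, Proposal Θ (.ind φ s t) e v := by
  have hdt : t.Dec Θ.S Fin.elim0 := hd.1 ⟨_, t⟩ (by simp [critExprs])
  have hdsk : (Expr.sk (indMatrix φ) s).Dec Θ.S Fin.elim0 :=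
    hd.1 ⟨_, .sk (indMatrix φ) s⟩ (by simp [critExprs])
  rw [Crit.toFml, Subst.IsTrue, evF_imp, evF_ex, evF_and, evF_neg, evF_app, evF_app,
    evT_zero] at hns
  push Not at hns
  obtain ⟨hu, h0⟩ := h.eq_unk hdsk.2 hns.2
  have hmat : ∀ (v : ℕ) (a : Fin k → ℕ),
      evF Θ.S.nat Θ.S.holds (Fin.cons v a) (indMatrix φ) ↔
      evF Θ.S.nat Θ.S.holds (Fin.cons v a) φ ∧
        ¬ evF Θ.S.nat Θ.S.holds (Fin.cons (v + 1) a) φ := fun v a => by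
    rw [indMatrix, evF_and, evF_neg, evF_app, evT_succ]
    rfl
  rw [hmat] at h0
  obtain ⟨u, hleast⟩ := exists_least_drop
    (p := fun m => evF Θ.S.nat Θ.S.holds (Fin.cons m fun i => Θ.S.num (s i)) φ) hns.1.1 hns.1.2
  have hpos : 0 < u := by
    rw [Nat.pos_iff_ne_zero]
    rintro rfl
    exact h0 hleast.1.2
  refine ⟨.term (indMatrix φ) fun i => Θ.S.num (s i), .num ⟨u, hpos⟩,
    ⟨_, evals_bar_iff_eq.2 rfl, rfl⟩,
    ⟨⟨u, hpos⟩, _, Subst.evals_bar_iff.2 rfl, rfl, ?_⟩, ?_, hu,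
    ⟨fun i => ⟨_, (Subst.evals_iff (hdsk.1 i)).2 rfl⟩, _, (Subst.evals_iff hdt).2 rfl,
      fun m hm => Subst.decides (hd.2 m hm)⟩, nofun,
    trivial, nofun, fun _ _ => .inr (.inr ⟨rfl, _, rfl, hleast.1.1.le⟩)⟩
  · simp only [models_bar_neg, models_bar_app, isTrue_app]
    exact hleast
  · rintro e' ⟨a, ha, rfl⟩
    rw [evals_bar_iff_eq.1 ha]

theorem proposal_indDef {t : Tm 𝔖.L 0} (hd : CritDecided (.indDef t) Θ)
    (hns : ¬ Θ.S.IsTrue ((Crit.indDef t).toFml 𝔖.Op)) :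
    ∃ e v, Proposal Θ (.indDef t) e v := by
  have hdm : (Expr.mem t).Dec Θ.S Fin.elim0 := hd.1 ⟨_, .mem t⟩ (by simp [critExprs])
  have hdsk : (Expr.sk 𝔖.Op.B.neg ![t]).Dec Θ.S Fin.elim0 :=
    hd.1 ⟨_, .sk 𝔖.Op.B.neg ![t]⟩ (by simp [critExprs])
  have harg : (fun i => evT Θ.S.nat Θ.S.holds Fin.elim0 ((![t] : Fin 1 → Tm 𝔖.L 0) i)) =
      ![Θ.S.num t] := by
    funext i; fin_cases i; rfl
  have hdom : Θ.S (.term 𝔖.Op.B.neg ![Θ.S.num t]) ≠ none := harg ▸ hdsk.2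
  rw [Crit.toFml, Subst.IsTrue, evF_imp, evF_mem] at hns
  push Not at hns
  refine ⟨.mem (Θ.S.num t), .top, ⟨_, Subst.evals_bar_iff.2 rfl, rfl⟩, rfl, ?_, ?_,
    ⟨_, (Subst.evals_iff hdm.1).2 rfl⟩, ?_, trivial, nofun, fun _ _ => .inr (.inl ⟨_, rfl⟩)⟩
  · rintro e' ⟨m, hm, rfl⟩
    rw [Subst.evals_bar_iff] at hm
    rw [hm]
  · obtain ⟨u, hu⟩ := Option.ne_none_iff_exists'.1 hdm.2
    have h2 : ¬ Θ.S.holds (Θ.S.num t) := hns.2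
    simp only [Subst.holds, Subst.val, hu, Option.getD_some, not_not] at h2
    rw [← h2]
    exact hu
  · rintro n hn
    cases hn
    exact hdom

theorem exists_first {p : ℕ → Prop} {P : List ℕ} {w : ℕ} (hw : w ∈ P) (hp : p w) :
    ∃ l n r, P = l ++ n :: r ∧ p n ∧ ∀ m ∈ l, ¬ p m := by
  induction P with
  | nil => cases hw
  | cons m P ih =>
    by_cases hm : p m
    · exact ⟨[], m, P, rfl, hm, nofun⟩
    · rcases List.mem_cons.1 hw with rfl | hw
      · exact absurd hp hm
      · obtain ⟨l, n, r, rfl, hn, hl⟩ := ih hw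
        refine ⟨m :: l, n, r, rfl, hn, fun m' hm' => ?_⟩
        rcases List.mem_cons.1 hm' with rfl | hm'
        · exact hm
        · exact hl m' hm'

/-- The part of a list up to the first failure is contained in each initial segment that contains
a failure. -/
theorem prefix_of_first {p : ℕ → Prop} {P P₀ l r : List ℕ} {n w : ℕ} (hP : P = l ++ n :: r)
    (hl : ∀ m ∈ l, ¬ p m) (hw : w ∈ P₀) (hp : p w) (h₀ : P₀ <+: P) : l ++ [n] <+: P₀ := by
  have h1 : l ++ [n] <+: P := ⟨r, by simp [hP]⟩
  rcases List.prefix_or_prefix_of_prefix h1 h₀ with h2 | h2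
  · exact h2
  · have hw' := h2.subset hw
    rcases List.mem_append.1 hw' with hw' | hw'
    · exact absurd hp (hl w hw')
    · rcases List.prefix_concat_iff.1 h2 with h3 | h3
      · rw [h3]
      · exact absurd hp (hl w (h3.subset hw))

theorem first_unique {p : ℕ → Prop} {P l r l' r' : List ℕ} {n n' : ℕ} (hP : P = l ++ n :: r)
    (hl : ∀ m ∈ l, ¬ p m) (hn : p n) (hP' : P = l' ++ n' :: r') (hl' : ∀ m ∈ l', ¬ p m)
    (hn' : p n') : l ++ [n] = l' ++ [n'] := by
  have h1 := prefix_of_first hP hl (P₀ := l' ++ [n']) (by simp) hn' ⟨r', by simp [hP']⟩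
  have h2 := prefix_of_first hP' hl' (P₀ := l ++ [n]) (by simp) hn ⟨r, by simp [hP]⟩
  exact h1.eq_of_length_le h2.length_le

/-- The Skolem term for `∃x ¬(x ∈ I → φ)` names an entry of the history where `φ` fails, so a first
failure `n` exists, and it lies in the decided segment `P₀`. `A(n, φ)` decides between the two
proposals. -/
theorem Ready.proposal_closure (h : Ready Θ) {k : ℕ}
    {φ : Fml 𝔖.L (k + 1)} {s : Fin k → Tm 𝔖.L 0} (hd : CritDecided (.closure φ s) Θ)
    (hns : ¬ Θ.S.IsTrue ((Crit.closure φ s).toFml 𝔖.Op)) :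
    ∃ e v, Proposal Θ (.closure φ s) e v := by
  have hdsk : (Expr.sk (𝔖.Op.closedUnder φ).neg s).Dec Θ.S Fin.elim0 :=
    hd.1 ⟨_, .sk (𝔖.Op.closedUnder φ).neg s⟩ (by simp [critExprs])
  obtain ⟨P₀, hP₀, hwP₀, hdP₀⟩ := hd.2
  rw [Crit.toFml, Subst.IsTrue, evF_imp, evF_all, evF_all, memImp, evF_imp, evF_mem] at hns
  push Not at hns
  obtain ⟨hcu, hw, hφw⟩ := hns
  have hw₀ := hwP₀ hw
  let p : ℕ → Prop := fun m =>
    ¬ evF Θ.S.nat Θ.S.holds (Fin.cons m fun i => Θ.S.num (s i)) φ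
  have hpw : p (Θ.S.num (.sk (memImp φ).neg s)) := hφw
  have hfail : ∀ m, Θ.S.bar.Models (φ.app (.numeral m) s).neg ↔ p m := fun m =>
    models_bar_neg.trans (not_congr isTrue_app)
  obtain ⟨l, n, r, hP, hpn, hl⟩ := exists_first (hP₀.subset hw₀) hpw
  have hln : l ++ [n] <+: P₀ := prefix_of_first hP hl hw₀ hpw hP₀
  have hnP : n ∈ Θ.P := by simp [hP]
  have hff : 𝔖.IsFirstFailure Θ.S.bar Θ.P φ s n :=
    ⟨l, r, hP, (hfail n).2 hpn, fun m hm hm' => hl m hm ((hfail m).1 hm')⟩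
  have huniq : ∀ n', 𝔖.IsFirstFailure Θ.S.bar Θ.P φ s n' → n' = n := by
    rintro n' ⟨l', r', hP', hn', hl'⟩
    have := first_unique hP hl hpn hP' (fun m hm hm' => hl' m hm ((hfail m).2 hm'))
      ((hfail n').1 hn')
    simpa using (congrArg List.getLast? this).symm
  have hcalc : 𝔖.CalcIn Θ.S Θ.P (.closure φ s) := by
    refine ⟨fun i => ⟨_, (Subst.evals_iff (hdsk.1 i)).2 rfl⟩, fun l' n' r' hP' hff' => ?_⟩
    obtain rfl := huniq n' hff'
    -- `n'` is not repeated in `P` and cannot lie in `l`, so it determines the splitting.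
    have hll : l' = l := by
      obtain ⟨l₂, r₂, hP₂, hn₂, hl₂⟩ := hff'
      have hnd := h.bad.1.seq.history.1
      rw [hP] at hnd hP'
      have hnl : n' ∉ l := fun hm => hl n' hm hpn
      rcases List.append_eq_append_iff.1 hP' with ⟨q, hq1, hq2⟩ | ⟨q, hq1, hq2⟩
      · cases q with
        | nil => simpa using hq1
        | cons x q =>
          simp only [List.cons_append, List.cons.injEq] at hq2
          have : n' ∈ r := by rw [hq2.2]; simp
          exact absurd this (List.nodup_cons.1 (List.nodup_append'.1 hnd).2.1).1
      · cases q with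
        | nil => simpa using hq1.symm
        | cons x q =>
          simp only [List.cons_append, List.cons.injEq] at hq2
          exact absurd (by rw [hq1, hq2.1]; simp) hnl
    subst hll
    have hmem : n' ∈ P₀ := hln.subset (by simp)
    exact ⟨fun m hm => Subst.decides (hdP₀ m (hln.subset hm)).1,
      Subst.decides (hdP₀ n' hmem).2.1,
      fun _ => ⟨_, (Subst.evals_iff (hdP₀ n' hmem).2.2.1).2 rfl⟩⟩
  have hargs : (fun i => evT Θ.S.nat Θ.S.holds Fin.elim0
      ((Fin.cons (.numeral n) s : Fin (k + 1) → Tm 𝔖.L 0) i)) =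
      Fin.cons n fun i => Θ.S.num (s i) := by
    funext i
    refine Fin.cases ?_ (fun _ => rfl) i
    exact evT_numeral n
  have hA : Θ.S.IsTrue (𝔖.Op.AOf φ (.numeral n) s) ↔
      evF Θ.S.nat (fun m => evF Θ.S.nat Θ.S.holds (Fin.cons m fun i => Θ.S.num (s i)) φ)
        ![Θ.S.nat (.term (𝔖.Op.BOf φ).neg (Fin.cons n fun i => Θ.S.num (s i))), n] 𝔖.Op.B := by
    rw [Subst.IsTrue, 𝔖.Op.evF_AOf, evT_numeral]
  by_cases hAn : Θ.S.IsTrue (𝔖.Op.AOf φ (.numeral n) s)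
  · have hAn' : ¬ Θ.S.bar.Models (𝔖.Op.AOf φ (.numeral n) s).neg := by
      rw [models_bar_neg, not_not]
      exact hAn
    obtain ⟨hu, h0⟩ := h.eq_unk hdsk.2 (fun hneg => hneg hcu)
    -- The default value `0` gives no counterexample to `A(x, φ) → φ(x)`, whereas `n` is one.
    have hpos : 0 < n := by
      rw [Nat.pos_iff_ne_zero]
      rintro rfl
      rw [evF_neg, not_not, 𝔖.Op.evF_closedUnder] at h0
      exact hpn (h0 (hA.1 hAn))
    refine ⟨.term (𝔖.Op.closedUnder φ).neg fun i => Θ.S.num (s i), .num ⟨n, hpos⟩,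
      ⟨n, hff, .inr ⟨hAn', _, evals_bar_iff_eq.2 rfl, rfl⟩⟩,
      ⟨n, hff, ⟨n, hpos⟩, rfl, .inr ⟨hAn', rfl⟩⟩, ?_, hu, hcalc, nofun, trivial, nofun,
      fun β hβ => .inr (.inr ⟨rfl, _, rfl, ?_⟩)⟩
    · rintro e' ⟨n', hff', ⟨hm, -⟩ | ⟨-, a, ha, rfl⟩⟩
      · rw [huniq n' hff'] at hm
        exact absurd hm hAn'
      · rw [evals_bar_iff_eq.1 ha]
    -- The first failure does not come after the witness, so each initial segment containing the
    -- witness contains `n`.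
    · exact hβ _ (hP₀.subset hw₀) n fun P₁ hP₁ hw₁ =>
        (prefix_of_first hP hl hw₁ hpw hP₁).subset (by simp)
  · have hAn' : Θ.S.bar.Models (𝔖.Op.AOf φ (.numeral n) s).neg := models_bar_neg.2 hAn
    -- `φ` holds of all entries before `n`, so `B(0, n, φ)` is true by admissibility and positivity.
    -- As `A(n, φ)` is false, the Skolem term in it does not have value `0`.
    have hpos : 0 < Θ.S.nat (.term (𝔖.Op.BOf φ).neg (Fin.cons n fun i => Θ.S.num (s i))) := by
      rw [Nat.pos_iff_ne_zero]
      intro h0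
      rw [hA, h0] at hAn
      exact hAn (admissible_evF h.bad.1.adm hP _ fun m hm => not_not.1 (hl m hm))
    refine ⟨𝔖.c n, .num ⟨_, hpos⟩, ⟨n, hff, .inl ⟨hAn', rfl⟩⟩,
      ⟨n, hff, ⟨_, hpos⟩, rfl, .inl ⟨hAn', Subst.evals_bar_iff.2 ?_⟩⟩, ?_,
      h.c_eq_unk hnP (hdP₀ n (hln.subset (by simp))).2.2.2, hcalc,
      fun m hm => absurd hm (𝔖.c_ne_mem n m), trivial, nofun,
      fun _ _ => .inl ⟨n, hnP, rfl⟩⟩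
    · rw [Subst.num, evT_sk, hargs]
      rfl
    · rintro e' ⟨n', hff', ⟨-, rfl⟩ | ⟨hm, -⟩⟩
      · rw [huniq n' hff']
      · rw [huniq n' hff'] at hm
        exact absurd hAn' hm

theorem Ready.exists_proposal (h : Ready Θ) (J : Fin 𝔖.N)
    (hJ : ¬ 𝔖.Sat Θ.S J) : ∃ e v, Proposal Θ (𝔖.Cr J) e v := by
  have hd := h.crit J
  rw [Sat, Subst.models_bar_iff] at hJ
  generalize 𝔖.Cr J = C at hd hJ ⊢
  cases C with
  | pred s => exact h.proposal_pred hd hJ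
  | eps φ s t => exact h.proposal_eps hd hJ
  | ind φ s t => exact h.proposal_ind hd hJ
  | indDef t => exact proposal_indDef hd hJ
  | closure φ s => exact h.proposal_closure hd hJ

/-- The `H`-expression is the lexicographic minimum of rank and index over the unsatisfied critical
formulas, each of which proposes exactly one expression. -/
theorem Ready.exists_hApplies (h : Ready Θ) :
    ∃ J e v, 𝔖.HApplies Θ.S Θ.P e v ∧ Proposal Θ (𝔖.Cr J) e v := by
  have hns : ¬ 𝔖.Solving Θ.S := fun hs => h.bad.not_isAxiom (.inr (.inl hs))
  have : Nonempty (CanExpr 𝔖.L) := ⟨.mem 0⟩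
  have : Nonempty Val := ⟨.unk⟩
  choose! e v hev using fun J (hJ : ¬ 𝔖.Sat Θ.S J) => h.exists_proposal J hJ
  have hne : (Finset.univ.filter fun J => ¬ 𝔖.Sat Θ.S J).Nonempty := by
    rw [Solving, not_forall] at hns
    obtain ⟨J, hJ⟩ := hns
    exact ⟨J, by simpa using hJ⟩
  obtain ⟨J, hJ, hmin⟩ := Finset.exists_min_image _ (fun J => toLex (𝔖.rk (e J), J)) hne
  replace hJ : ¬ 𝔖.Sat Θ.S J := by simpa using hJ
  have hp := hev J hJ
  refine ⟨J, e J, v J, ⟨h.correct, hns, ⟨J, hJ, hp.expr, hp.value, fun J' e' hJ' he' => ?_⟩,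
    fun J' => Subst.decides ((h.crit J').1 _ (toFml_mem_critExprs _ _)),
    fun J' hJ' => (hev J' hJ').calcIn, hp.unk, fun n hn => h.mem_dom n ?_, hp.c_dom,
    fun _ m hm => h.mem_dom m (by rw [hm]; exact Option.some_ne_none _)⟩, hp⟩
  · rw [(hev J' hJ').uniq e' he']
    exact Prod.Lex.toLex_le_toLex.1 (hmin J' (by simpa using hJ'))
  · rw [← hn, hp.unk]
    exact Option.some_ne_none _

end Proposal

end System

namespace System

variable {𝔖 : System}

/-! ## `H`-steps on underivable sequents -/

section Step

variable {Θ : Sequent 𝔖.L}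

theorem newF_ne_none_iff {S' : Subst 𝔖.L} {e : CanExpr 𝔖.L} :
    𝔖.newF Θ S' e ≠ none ↔ ∃ u, S' e = some u ∧ (u = .unk ∨ 𝔖.rk e = Ω) := by
  cases hS : S' e with
  | none => simp [newF, hS]
  | some u => simp [newF, hS, or_iff_not_imp_left]

theorem newF_eq {S' : Subst 𝔖.L} {e : CanExpr 𝔖.L} {u : Val} (hS : S' e = some u)
    (h : u = .unk ∨ 𝔖.rk e = Ω) : 𝔖.newF Θ S' e = some ((Θ.F e).getD true) := by
  simp [newF, hS, h]

/-- The invariant is preserved when a term with value `?` of rank at least `Ω` gets a numeral and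
other terms are dropped. -/
theorem Inv.of_step (h : Inv Θ) {Ξ : Sequent 𝔖.L} {e : CanExpr 𝔖.L} {v : Val} (ht : e.IsTerm)
    (hr : Ω ≤ 𝔖.rk e) (hu : Θ.S e = some .unk) (hf : v.Fits e) (hv : v ≠ .unk)
    (hS : ∀ e' u, Ξ.S e' = some u → Θ.S e' = some u ∨ e' = e ∧ u = v)
    (hm : ∀ m, Ξ.S (.mem m) = Θ.S (.mem m)) (hP : Ξ.P = Θ.P) (hV : Ξ.V = Θ.V)
    (hF : Ξ.F = 𝔖.newF Θ Ξ.S) : Inv Ξ := by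
  refine ⟨⟨fun e' u hu' => ?_, ?_, fun n => ?_, fun e' => ?_⟩, ?_, ?_, fun e' i he' hi => ?_,
    fun e' ht' he' hu' => ?_⟩
  · rcases hS e' u hu' with h1 | ⟨rfl, rfl⟩
    · exact h.seq.subst _ _ h1
    · exact ⟨(h.seq.subst _ _ hu).1, hf⟩
  · rw [hP, hV]
    exact h.seq.history
  · rw [hP, hm]
    exact h.seq.mem_P n
  · rw [hF]
    exact newF_ne_none_iff
  · refine h.fin.subset fun e' he' => ?_
    obtain ⟨u, hu'⟩ := Option.ne_none_iff_exists'.1 he'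
    rcases hS e' u hu' with h1 | ⟨rfl, rfl⟩
    · exact fun h0 => Option.some_ne_none _ (h1.symm.trans h0)
    · exact fun h0 => Option.some_ne_none _ (hu.symm.trans h0)
  · rw [hP]
    exact h.adm
  · rw [hF] at hi
    obtain ⟨u, hu', hc⟩ := newF_ne_none_iff.1 (hi ▸ Option.some_ne_none _)
    rw [newF_eq hu' hc] at hi
    rcases hS e' u hu' with h1 | ⟨rfl, rfl⟩
    · obtain ⟨j, hj⟩ := Option.ne_none_iff_exists'.1 ((h.seq.dom_F e').2 ⟨u, h1, hc⟩)
      rw [hj] at hi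
      obtain rfl : j = i := Option.some.inj hi
      exact h.fixed e' _ he' hj
    · rcases he' with he' | he'
      · exact absurd he' (not_lt.2 hr)
      · exact absurd ht he'
  · rw [hF, newF_eq hu' (.inl rfl)]
    rcases hS e' _ hu' with h1 | ⟨rfl, h2⟩
    · rw [h.temp e' ht' he' h1]
      rfl
    · exact absurd h2.symm hv

theorem hOther_S_self (e : CanExpr 𝔖.L) (v : Val) : (𝔖.hOther Θ e v).S e = some v := by
  simp only [hOther, Function.update_self]

theorem hOther_S_of_ne {e e' : CanExpr 𝔖.L} (v : Val) (h : e' ≠ e) :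
    (𝔖.hOther Θ e v).S e' = if 𝔖.rk e' ≤ 𝔖.rk e then Θ.S e' else none := by
  simp only [hOther, Function.update_of_ne h, Subst.restrict]
  cases Θ.S e' with
  | none => simp
  | some u => rfl

/-- What happens to an underivable sequent in an `H`-step. -/
structure StepTo (Θ : Sequent 𝔖.L) (e : CanExpr 𝔖.L) (v : Val) (Ξ : Sequent 𝔖.L) : Prop where
  isTerm : e.IsTerm
  rank_ge : Ω ≤ 𝔖.rk e
  not_mem : ∀ n ∈ Θ.P, e ≠ 𝔖.c n
  hP : Ξ.P = Θ.P
  filled : Ξ.S e = some v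
  erase : ∀ e', 𝔖.rk e < 𝔖.rk e' → Ξ.S e' = none
  persist : ∀ e' u, 𝔖.rk e' ≤ 𝔖.rk e → e' ≠ e → Θ.S e' = some u → u ≠ .unk → Ξ.S e' = some u
  keep : ∀ e', Ω < 𝔖.rk e' → 𝔖.rk e' ≤ 𝔖.rk e → e' ≠ e → Ξ.S e' = Θ.S e'

theorem Inv.stepTo_hOther (h : Inv Θ) {e : CanExpr 𝔖.L} {v : Val} (hr : Ω < 𝔖.rk e)
    (hu : Θ.S e = some .unk) (hf : v.Fits e) (hv : v ≠ .unk) :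
    Inv (𝔖.hOther Θ e v) ∧ StepTo Θ e v (𝔖.hOther Θ e v) := by
  have ht := isTerm_of_rk_ne hr.ne'
  have hP : (𝔖.hOther Θ e v).P = Θ.P := if_pos hr
  refine ⟨h.of_step ht hr.le hu hf hv (fun e' u hu' => ?_) (fun m => ?_) hP (if_pos hr) rfl,
    ht, hr.le, fun n _ hn => ?_, hP, hOther_S_self e v, fun e' he' => ?_,
    fun e' u hle hne hu' _ => ?_, fun e' _ hle hne => ?_⟩
  · by_cases hee : e' = e
    · subst hee
      rw [hOther_S_self] at hu'
      exact .inr ⟨rfl, (Option.some.inj hu').symm⟩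
    · rw [hOther_S_of_ne v hee] at hu'
      split_ifs at hu'
      exact .inl hu'
  · rw [hOther_S_of_ne v (by rintro rfl; exact ht), if_pos]
    exact hr.le
  · rw [hn, rk_c] at hr
    exact lt_irrefl _ hr
  · rw [hOther_S_of_ne v (by rintro rfl; exact lt_irrefl _ he'), if_neg (not_le.2 he')]
  · rw [hOther_S_of_ne v hne, if_pos hle, hu']
  · rw [hOther_S_of_ne v hne, if_pos hle]

/-- The history and the negative pairs survive intact. The pairs dropped at rank `Ω` have the form
`(c_m, ?)`, which a total valuation does not distinguish from absent ones. -/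
theorem Inv.stepTo_hNeg (h : Inv Θ) {n : ℕ} {v : Val} (hn : n ∉ Θ.P)
    (hu : Θ.S (𝔖.c n) = some .unk) (hf : v.Fits (𝔖.c n)) (hv : v ≠ .unk) :
    Inv (𝔖.hNeg Θ n v) ∧ StepTo Θ (𝔖.c n) v (𝔖.hNeg Θ n v) := by
  have hP : (𝔖.hNeg Θ n v).P = Θ.P := takeWhile_ne hn
  have hV : (𝔖.hNeg Θ n v).V = Θ.V := by
    funext m
    simp only [hNeg, takeWhile_ne hn]
    split_ifs with hm
    · rfl
    · by_contra hcon
      exact hm ((h.seq.history.2.1 m).2 (Ne.symm hcon))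
  refine ⟨h.of_step (𝔖.isTerm_c n) (𝔖.rk_c n).ge hu hf hv (fun e' u hu' => ?_) (fun m => ?_) hP
    hV rfl, 𝔖.isTerm_c n, (𝔖.rk_c n).ge, fun m hm hnm => ?_, hP, hNeg_S_self n v,
    fun e' he' => ?_, fun e' u hle hne hu' hnu => ?_, fun e' hlt hle _ => ?_⟩
  · by_cases hee : e' = 𝔖.c n
    · subst hee
      rw [hNeg_S_self] at hu'
      exact .inr ⟨rfl, (Option.some.inj hu').symm⟩
    · exact .inl (of_hNeg_S hn hee hu').1
  · have hne : CanExpr.mem m ≠ 𝔖.c n := (𝔖.c_ne_mem n m).symm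
    cases hS : Θ.S (.mem m) with
    | none =>
      by_contra hcon
      obtain ⟨u, hu'⟩ := Option.ne_none_iff_exists'.1 hcon
      have := (of_hNeg_S hn hne hu').1
      rw [hS] at this
      cases this
    | some u =>
      exact hNeg_S_kept h.seq hn v hne (𝔖.rk_mem m).le hS
        fun ⟨_, m', hm'⟩ => 𝔖.c_ne_mem m' m hm'.symm
  · rw [𝔖.c_injective hnm] at hn
    exact hn hm
  · rw [rk_c] at he'
    by_contra hcon
    obtain ⟨u, hu'⟩ := Option.ne_none_iff_exists'.1 hcon
    have hne : e' ≠ 𝔖.c n := by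
      rintro rfl
      rw [rk_c] at he'
      exact lt_irrefl _ he'
    exact not_lt.2 (of_hNeg_S hn hne hu').2 he'
  · rw [rk_c] at hle
    exact hNeg_S_kept h.seq hn v hne hle hu' fun h' => hnu h'.1
  · rw [rk_c] at hle
    exact absurd hlt (not_lt.2 hle)

theorem Bad.not_active_fixed (h : Bad Θ) {e : CanExpr 𝔖.L} {v : Val}
    (hH : 𝔖.HApplies Θ.S Θ.P e v) {e' : CanExpr 𝔖.L} (ha : 𝔖.Active Θ e v e') :
    Θ.F e' ≠ some false := fun hF =>
  h.not_isAxiom (.inr (.inr ⟨e, v, hH, e', ha, hF⟩))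

/-- An expression that is fixed by the invariant cannot be active. -/
theorem Bad.not_active (h : Bad Θ) {e : CanExpr 𝔖.L} {v : Val} (hH : 𝔖.HApplies Θ.S Θ.P e v)
    {e' : CanExpr 𝔖.L} (hfix : 𝔖.rk e' < Ω ∨ ¬ e'.IsTerm) {u : Val} (hu : Θ.S e' = some u)
    (hc : u = .unk ∨ 𝔖.rk e' = Ω) : ¬ 𝔖.Active Θ e v e' := by
  intro ha
  obtain ⟨i, hi⟩ := Option.ne_none_iff_exists'.1 ((h.1.seq.dom_F e').2 ⟨u, hu, hc⟩)
  exact h.not_active_fixed hH ha (h.1.fixed e' i hfix hi ▸ hi)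

/-- For rank below `Ω` and for formulas the `H`-expression is itself active and fixed, so the
sequent would be an `AxH`. Above `Ω` it is the only active expression; for `c_n` with `n ∈ I`
outside the history all active ones are terms `c_m` with value `?`. In these cases `Inv` makes them
temporary and the `H`-inference is permitted. -/
theorem Bad.exists_stepTo (h : Bad Θ) {e : CanExpr 𝔖.L} {v : Val}
    (hH : 𝔖.HApplies Θ.S Θ.P e v) (hf : v.Fits e) (hv : v ≠ .unk) :
    ∃ Ξ, Bad Ξ ∧ StepTo Θ e v Ξ := by
  have hu : Θ.S e = some .unk := hH.2.2.2.2.2.1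
  have hvu : some v ≠ some Val.unk := fun h => hv (Option.some.inj h)
  suffices H : Inv (𝔖.hStep Θ e v) ∧ StepTo Θ e v (𝔖.hStep Θ e v) ∧
      ∀ e', 𝔖.Active Θ e v e' → Θ.F e' = some true by
    refine ⟨𝔖.hStep Θ e v, ⟨H.1, ?_⟩, H.2.1⟩
    obtain ⟨Θ', rfl, hg⟩ := h.exists_of_infer (ρ := .h e v)
      ⟨hH, h.1.temp e H.2.1.isTerm H.2.1.rank_ge hu, H.2.2⟩ H.2.1.rank_ge
    exact hg
  rcases canExpr_cases e with hne | ⟨n, rfl⟩ | ⟨n, rfl⟩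
  · rcases lt_or_gt_of_ne hne with hlt | hgt
    · refine absurd ⟨?_, rfl, ?_⟩ (h.not_active hH (.inl hlt) hu (.inl rfl))
      · exact hu ▸ Option.some_ne_none _
      · rw [hStep_of_rk_ne hne, hOther_S_self, hu]
        exact hvu
    · have hs := h.1.stepTo_hOther hgt hu hf hv
      rw [hStep_of_rk_ne hne]
      refine ⟨hs.1, hs.2, fun e' ha => ?_⟩
      have hee : e' = e := by
        by_contra hee
        refine ha.2.2 ?_
        rw [hStep_of_rk_ne hne, hOther_S_of_ne v hee, if_pos ha.2.1.le]
      subst hee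
      exact h.1.temp _ hs.2.isTerm hgt.le hu
  · by_cases hn : n ∈ Θ.P
    · have htop := (h.1.seq.mem_P n).1 hn
      refine absurd ⟨?_, ?_, ?_⟩ (h.not_active hH (.inr id) htop (.inr (𝔖.rk_mem n)))
      · exact htop ▸ Option.some_ne_none _
      · rw [rk_c, rk_mem]
      · rw [hStep_c, htop]
        intro hcon
        obtain ⟨T, hT⟩ := Option.ne_none_iff_exists'.1 ((h.1.seq.history.2.1 n).1 hn)
        have hnt : n ∉ Θ.P.takeWhile fun m => decide (m ≠ n) := fun hmem => by
          simpa using List.mem_takeWhile_imp hmem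
        -- `n ∈ I` is cut off from the history, and the stored `V(n ∈ I)` has only negative pairs,
        -- so it cannot restore `(n ∈ I, ⊤)`. That fixed expression is therefore active.
        have hTn : T (.mem n) ≠ some .top := fun hTn => by
          rcases (h.1.seq.history.2.2 n T hT).2 _ _ hTn with ⟨m, -, h2⟩ | ⟨m, w, h2, -⟩
          · cases h2
          · exact 𝔖.c_ne_mem m n h2.symm
        have hne : CanExpr.mem n ≠ 𝔖.c n := (𝔖.c_ne_mem n n).symm
        simp only [hNeg, Function.update_of_ne hne, if_pos hn, hT, Option.getD_some,
          Subst.restrict, htop] at hcon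
        rw [if_neg] at hcon
        · exact hTn hcon
        · rintro (hlt | ⟨m, hm, ⟨h2, -⟩ | ⟨h2, -⟩⟩)
          · exact absurd hlt (by simp [rk_mem])
          · exact 𝔖.c_ne_mem m n h2.symm
          · cases h2
            exact hnt hm
    · have hs := h.1.stepTo_hNeg hn hu hf hv
      rw [hStep_c]
      refine ⟨hs.1, hs.2, fun e' ha => ?_⟩
      obtain ⟨hu', m, rfl⟩ := active_c h.1.seq hn hu ha
      exact h.1.temp _ (𝔖.isTerm_c m) (𝔖.rk_c m).ge hu'
  · refine absurd ⟨?_, rfl, ?_⟩ (h.not_active hH (.inr id) hu (.inl rfl))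
    · exact hu ▸ Option.some_ne_none _
    · rw [hStep_mem, hu]
      simp [hPos]

end Step

/-! ## Termination -/

/-- One round of the process: an `H`-step followed by deciding what is needed for the next. -/
structure Round (Θ : Sequent 𝔖.L) (J : Fin 𝔖.N) (e : CanExpr 𝔖.L) (v : Val)
    (Θ' : Sequent 𝔖.L) : Prop where
  bound : ∀ β, BoundsUpTo β Θ.P → e = (critStep 𝔖.Op β Θ.S.nat Θ.S.holds (𝔖.Cr J)).1 ∧
    ∃ u : ℕ+, v = .num u ∧ (u : ℕ) ≤ (critStep 𝔖.Op β Θ.S.nat Θ.S.holds (𝔖.Cr J)).2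
  blank : Θ.S.val e = .unk
  rank_ge : Ω ≤ 𝔖.rk e
  pre : Θ.P <+: Θ'.P
  filled : Θ'.S.val e = v
  ne_unk : v ≠ .unk
  erase : ∀ e', 𝔖.rk e < 𝔖.rk e' → Θ'.S.val e' = .unk
  persist : ∀ e', 𝔖.rk e' ≤ 𝔖.rk e → Θ.S.val e' ≠ .unk → Θ'.S.val e' = Θ.S.val e'
  keep : ∀ e', Ω < 𝔖.rk e' → 𝔖.rk e' ≤ 𝔖.rk e → e' ≠ e → Θ'.S.val e' = Θ.S.val e'

/-- Deciding things after the step may fill blank entries of rank at most `Ω` by cuts, but above `Ω`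
it only adds `?`, which is invisible to `Subst.val`. -/
theorem Ready.exists_round {Θ : Sequent 𝔖.L} (h : Ready Θ) :
    ∃ J e v Θ', Ready Θ' ∧ Round Θ J e v Θ' := by
  obtain ⟨J, e, v, hH, hp⟩ := h.exists_hApplies
  obtain ⟨Ξ, hb, hs⟩ := h.bad.exists_stepTo hH hp.fits hp.ne_unk
  obtain ⟨Θ', hr, hx⟩ := hb.exists_ready
  have hval : ∀ {e' u}, Ξ.S e' = some u → Θ'.S.val e' = u := fun hu => by
    simp [Subst.val, hx.sub _ _ hu]
  have hhigh : ∀ e', Ω < 𝔖.rk e' → Ξ.S e' = none → Θ'.S.val e' = .unk := fun e' he' hn => by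
    cases hS : Θ'.S e' with
    | none => simp [Subst.val, hS]
    | some u => simp [Subst.val, hS, hx.high e' he' hn u hS]
  refine ⟨J, e, v, Θ', hr, fun β hβ => ?_, by simp [Subst.val, hp.unk], hs.rank_ge,
    hs.hP ▸ hx.pre, hval hs.filled, hp.ne_unk,
    fun e' he' => hhigh e' (hs.rank_ge.trans_lt he') (hs.erase e' he'),
    fun e' hle hne => ?_, fun e' hlt hle hne => ?_⟩
  · rcases hp.bound β hβ with ⟨n, hn, h2⟩ | ⟨n, rfl⟩ | h2
    · exact absurd h2 (hs.not_mem n hn)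
    · exact hs.isTerm.elim
    · exact h2
  · cases hS : Θ.S e' with
    | none => simp [Subst.val, hS] at hne
    | some u =>
      have hu : u ≠ .unk := by simpa [Subst.val, hS] using hne
      have hee : e' ≠ e := by
        rintro rfl
        rw [hp.unk] at hS
        exact hu (Option.some.inj hS).symm
      rw [hval (hs.persist e' u hle hee hS hu)]
      simp [Subst.val, hS]
  · have hk := hs.keep e' hlt hle hne
    cases hS : Θ.S e' with
    | none =>
      rw [hhigh e' hlt (hk.trans hS)]
      simp [Subst.val, hS]
    | some u =>
      rw [hval (hk.trans hS)]
      simp [Subst.val, hS]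

theorem critStep_local (Op : InductiveOperator 𝔖.L) (β : ℕ → ℕ) (C : Crit 𝔖.L)
    (τ : CanExpr 𝔖.L → Val) : ∃ D : Finset (CanExpr 𝔖.L), ∀ σ : CanExpr 𝔖.L → Val,
      (∀ e ∈ D, σ e = τ e) →
      critStep Op β (fun e => (σ e).toNat) (fun m => σ (.mem m) ≠ .unk) C =
        critStep Op β (fun e => (τ e).toNat) (fun m => τ (.mem m) ≠ .unk) C := by
  choose D hD using fun t : Tm 𝔖.L 0 => t.ev_local τ Val.toNat (· ≠ .unk) Fin.elim0
  have hfam : ∀ {k : ℕ} (s : Fin k → Tm 𝔖.L 0) (t : Tm 𝔖.L 0) (σ : CanExpr 𝔖.L → Val),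
      (∀ e ∈ Finset.univ.biUnion (fun i => D (s i)) ∪ D t, σ e = τ e) →
      (fun i => evT (fun e => (σ e).toNat) (fun m => σ (.mem m) ≠ .unk) Fin.elim0 (s i)) =
        (fun i => evT (fun e => (τ e).toNat) (fun m => τ (.mem m) ≠ .unk) Fin.elim0 (s i)) ∧
      evT (fun e => (σ e).toNat) (fun m => σ (.mem m) ≠ .unk) Fin.elim0 t =
        evT (fun e => (τ e).toNat) (fun m => τ (.mem m) ≠ .unk) Fin.elim0 t := by
    intro k s t σ hσ
    exact ⟨funext fun i => hD (s i) σ fun e he => hσ e (Finset.mem_union_left _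
      (Finset.mem_biUnion.2 ⟨i, Finset.mem_univ i, he⟩)),
      hD t σ fun e he => hσ e (Finset.mem_union_right _ he)⟩
  cases C with
  | pred s =>
    refine ⟨D s, fun σ hσ => ?_⟩
    have h1 : evT _ _ _ s = evT _ _ _ s := hD s σ hσ
    simp only [critStep, h1]
  | eps φ s t =>
    refine ⟨Finset.univ.biUnion (fun i => D (s i)) ∪ D t, fun σ hσ => ?_⟩
    obtain ⟨h1, h2⟩ := hfam s t σ hσ
    simp only [critStep, h1, h2]
  | ind φ s t =>
    refine ⟨Finset.univ.biUnion (fun i => D (s i)) ∪ D t, fun σ hσ => ?_⟩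
    obtain ⟨h1, h2⟩ := hfam s t σ hσ
    simp only [critStep, h1, h2]
  | indDef t =>
    refine ⟨D t, fun σ hσ => ?_⟩
    have h1 : evT _ _ _ t = evT _ _ _ t := hD t σ hσ
    simp only [critStep, h1]
  | closure φ s =>
    refine ⟨Finset.univ.biUnion (fun i => D (s i)) ∪ D (.sk (memImp φ).neg s), fun σ hσ => ?_⟩
    obtain ⟨h1, h2⟩ := hfam s (.sk (memImp φ).neg s) σ hσ
    simp only [critStep, h1, h2]

/-- The critical formula fixes the Skolem symbol; the valuation affects only its numerical
arguments. Hence only finitely many ranks occur. -/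
theorem rk_critStep (Op : InductiveOperator 𝔖.L) (β : ℕ → ℕ) (C : Crit 𝔖.L)
    (g g' : CanExpr 𝔖.L → ℕ) (X X' : ℕ → Prop) :
    𝔖.rk (critStep Op β g X C).1 = 𝔖.rk (critStep Op β g' X' C).1 := by
  cases C <;> rfl

variable (𝔖) in
/-- The expressions and values that may be proposed under a total valuation. -/
def choices (β : ℕ → ℕ) (σ : CanExpr 𝔖.L → Val) : Set (CanExpr 𝔖.L × Val) :=
  ⋃ J : Fin 𝔖.N, {p |
    p.1 = (critStep 𝔖.Op β (fun e => (σ e).toNat) (fun m => σ (.mem m) ≠ .unk) (𝔖.Cr J)).1 ∧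
    ∃ u : ℕ+, p.2 = .num u ∧ (u : ℕ) ≤
      (critStep 𝔖.Op β (fun e => (σ e).toNat) (fun m => σ (.mem m) ≠ .unk) (𝔖.Cr J)).2}

theorem finite_choices (β : ℕ → ℕ) (σ : CanExpr 𝔖.L → Val) : (𝔖.choices β σ).Finite := by
  refine Set.finite_iUnion fun J => ?_
  generalize critStep 𝔖.Op β (fun e => (σ e).toNat) (fun m => σ (.mem m) ≠ .unk) (𝔖.Cr J) = c
  have hfin : {u : ℕ+ | (u : ℕ) ≤ c.2}.Finite :=
    (Set.finite_Iic c.2).preimage PNat.coe_injective.injOn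
  refine (hfin.image fun u => (c.1, Val.num u)).subset ?_
  rintro ⟨x, w⟩ ⟨h1, u, h2, h3⟩
  exact ⟨u, h3, Prod.ext h1.symm h2.symm⟩

theorem choices_local (β : ℕ → ℕ) (τ : CanExpr 𝔖.L → Val) :
    ∃ D : Finset (CanExpr 𝔖.L), ∀ σ, (∀ e ∈ D, σ e = τ e) →
      𝔖.choices β σ = 𝔖.choices β τ := by
  choose D hD using fun J => critStep_local 𝔖.Op β (𝔖.Cr J) τ
  refine ⟨Finset.univ.biUnion D, fun σ hσ => ?_⟩
  have := fun J => hD J σ fun e he =>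
    hσ e (Finset.mem_biUnion.2 ⟨J, Finset.mem_univ J, he⟩)
  simp only [choices, this]

/-- Rounds can be repeated for ever on an underivable sequent, and the resulting valuations form a
run with `o = Ω`. -/
theorem not_bad (Θ : Sequent 𝔖.L) : ¬ Bad Θ := by
  intro hb
  obtain ⟨Θ₀, h₀, -⟩ := hb.exists_ready
  choose J e v next hnext hround using fun Υ : {Υ : Sequent 𝔖.L // Ready Υ} =>
    Υ.2.exists_round
  let seq : ℕ → {Υ : Sequent 𝔖.L // Ready Υ} :=
    fun k => Nat.rec ⟨Θ₀, h₀⟩ (fun _ Υ => ⟨next Υ, hnext Υ⟩) k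
  have hr : ∀ k, Round (seq k).1 (J (seq k)) (e (seq k)) (v (seq k)) (seq (k + 1)).1 :=
    fun k => hround (seq k)
  have hpre : ∀ k i, (seq k).1.P <+: (seq (k + i)).1.P := by
    intro k i
    induction i with
    | zero => exact List.prefix_rfl
    | succ i ih => exact ih.trans (hr (k + i)).pre
  -- The history at the first stage containing `w` is an initial segment of all later ones. A first
  -- failure no later than `w` belongs to it, and the sum bounds its entries. One `β` thus serves
  -- all stages.
  let β : ℕ → ℕ := fun w =>
    if h : ∃ k, w ∈ (seq k).1.P then (seq (Nat.find h)).1.P.sum else 0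
  have hβ : ∀ k, BoundsUpTo β (seq k).1.P := by
    intro k w hw n hn
    have h : ∃ k, w ∈ (seq k).1.P := ⟨k, hw⟩
    obtain ⟨i, hi⟩ := Nat.exists_eq_add_of_le (Nat.find_min' h hw)
    have h1 := hpre (Nat.find h) i
    rw [← hi] at h1
    change n ≤ dite _ _ _
    rw [dif_pos h]
    exact List.le_sum_of_mem (hn _ h1 (Nat.find_spec h))
  refine not_isRun (b := Val.unk) (ρ := 𝔖.rk) (o := Ω) (N := 𝔖.choices β) (finite_choices β)
    (choices_local β)
    (Finset.univ.image fun J =>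
      𝔖.rk (critStep 𝔖.Op β (fun _ => 0) (fun _ => False) (𝔖.Cr J)).1)
    (fun k => (seq k).1.S.val) (fun k => e (seq k)) (fun k => ?_)
    ⟨fun k => ?_, fun k => (hr k).blank, fun k => ?_, fun k => (hr k).persist,
      fun k => (hr k).erase, fun k => (hr k).keep, fun k => (hr k).rank_ge⟩
  · rw [Finset.mem_image]
    refine ⟨J (seq k), Finset.mem_univ _, ?_⟩
    rw [((hr k).bound β (hβ k)).1]
    exact rk_critStep ..
  · refine Set.mem_iUnion.2 ⟨J (seq k), ((hr k).bound β (hβ k)).1, ?_⟩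
    rw [(hr k).filled]
    exact ((hr k).bound β (hβ k)).2
  · rw [(hr k).filled]
    exact (hr k).ne_unk

theorem Inv.good {Θ : Sequent 𝔖.L} (h : Inv Θ) : Good Θ := by
  by_contra hg
  exact not_bad Θ ⟨h, hg⟩

/-! ## Sequents on `Ω+1`-paths -/

/-- Expressions of rank at most `Ω` are fixed, those of higher rank are temporary. -/
structure PathInv (Θ : Sequent 𝔖.L) : Prop where
  seq : 𝔖.IsSequent Θ
  fin : {e | Θ.S e ≠ none}.Finite
  adm : 𝔖.Admissible Θ.P
  fixed : ∀ e i, 𝔖.rk e ≤ Ω → Θ.F e = some i → i = false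
  temp : ∀ e i, Ω < 𝔖.rk e → Θ.F e = some i → i = true

/-- The relabelling affects exactly the terms of rank `Ω` with value `?`, the only place where
`PathInv` and `Inv` ask for different labels. -/
theorem PathInv.inv_termToT {Θ : Sequent 𝔖.L} (h : PathInv Θ) : Inv (𝔖.termToT Θ) := by
  refine ⟨⟨h.seq.subst, h.seq.history, h.seq.mem_P, fun e => ?_⟩, h.fin, h.adm,
    fun e i he hi => ?_, fun e ht he hu => ?_⟩
  · simp only [termToT]
    split_ifs with hc
    · simp [hc.1, hc.2.2]
    · exact h.seq.dom_F e
  · simp only [termToT] at hi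
    rw [if_neg] at hi
    · refine h.fixed e i ?_ hi
      rcases he with he | he
      · exact he.le
      · exact (not_not.1 fun hne => he (isTerm_of_rk_ne hne)).le
    · rintro ⟨h1, h2, -⟩
      rcases he with he | he
      · exact he.ne h1
      · exact he h2
  · simp only [termToT] at hu ⊢
    by_cases hr : 𝔖.rk e = Ω
    · rw [if_pos ⟨hr, ht, hu⟩]
    · rw [if_neg fun hc => hr hc.1]
      obtain ⟨i, hi⟩ := Option.ne_none_iff_exists'.1 ((h.seq.dom_F e).2 ⟨_, hu, .inl rfl⟩)
      rw [hi, h.temp e i (lt_of_le_of_ne he (Ne.symm hr)) hi]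

theorem PathInv.add {Θ : Sequent 𝔖.L} (h : PathInv Θ) {e : CanExpr 𝔖.L} {u : Val}
    {i : Option Bool} (hs : 𝔖.IsSequent (Θ.add e u i)) (hle : 𝔖.rk e ≤ Ω → i ≠ some true)
    (hgt : Ω < 𝔖.rk e → i ≠ some false) : PathInv (Θ.add e u i) := by
  refine ⟨hs, ?_, h.adm, fun e' j he' hj => ?_, fun e' j he' hj => ?_⟩
  · refine (h.fin.insert e).subset fun e' he' => ?_
    by_cases hee : e' = e
    · exact .inl hee
    · simp only [Sequent.add, Set.mem_ofPred_eq, Function.update_of_ne hee] at he'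
      exact .inr he'
  · by_cases hee : e' = e
    · subst hee
      simp only [Sequent.add, Function.update_self] at hj
      cases j
      · rfl
      · exact absurd hj (hle he')
    · simp only [Sequent.add, Function.update_of_ne hee] at hj
      exact h.fixed e' j he' hj
  · by_cases hee : e' = e
    · subst hee
      simp only [Sequent.add, Function.update_self] at hj
      cases j
      · exact absurd hj (hgt he')
      · rfl
    · simp only [Sequent.add, Function.update_of_ne hee] at hj
      exact h.temp e' j he' hj

theorem PathInv.addForm {Θ : Sequent 𝔖.L} (h : PathInv Θ) {n : ℕ} {Pe : List ℕ}
    {Ve : ℕ → Option (Subst 𝔖.L)} (hp : 𝔖.Proper Θ n Pe) (hh : 𝔖.IsHistory Pe Ve) :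
    PathInv (Θ.addForm false Pe Ve) := by
  refine ⟨isSequent_addForm h.seq hp hh, finite_addForm h.fin Pe Ve, hp.2.2.1,
    fun e i he hi => ?_, fun e i he hi => ?_⟩
  · cases e with
    | term φ a => exact h.fixed _ i he hi
    | mem m =>
      rw [addForm_F_mem] at hi
      split_ifs at hi
      · exact (Option.some.inj hi).symm
      · exact h.fixed _ i he hi
  · rw [addForm_F_of_isTerm (isTerm_of_rk_ne he.ne')] at hi
    exact h.temp e i he hi

/-- A step of rank above `Ω` changes nothing of rank at most `Ω` and keeps the history; labels it
creates are temporary. -/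
theorem PathInv.hOther {Θ : Sequent 𝔖.L} (h : PathInv Θ) {e : CanExpr 𝔖.L} {v : Val}
    (hs : 𝔖.IsSequent (𝔖.hOther Θ e v)) (hr : Ω < 𝔖.rk e) : PathInv (𝔖.hOther Θ e v) := by
  have hP : (𝔖.hOther Θ e v).P = Θ.P := if_pos hr
  refine ⟨hs, ?_, hP ▸ h.adm, fun e' i he' hi => ?_, fun e' i he' hi => ?_⟩
  · refine (h.fin.insert e).subset fun e' he' => ?_
    by_cases hee : e' = e
    · exact .inl hee
    · rw [Set.mem_ofPred_eq, hOther_S_of_ne v hee] at he'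
      split_ifs at he'
      · exact .inr he'
      · exact absurd rfl he'
  · change 𝔖.newF Θ (𝔖.hOther Θ e v).S e' = some i at hi
    obtain ⟨u, hu, hc⟩ := newF_ne_none_iff.1 (hi ▸ Option.some_ne_none _)
    rw [newF_eq hu hc] at hi
    rw [hOther_S_of_ne v (by rintro rfl; exact not_lt.2 he' hr),
      if_pos (he'.trans hr.le)] at hu
    obtain ⟨j, hj⟩ := Option.ne_none_iff_exists'.1 ((h.seq.dom_F e').2 ⟨u, hu, hc⟩)
    rw [hj] at hi
    obtain rfl : j = i := Option.some.inj hi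
    exact h.fixed e' _ he' hj
  · change 𝔖.newF Θ (𝔖.hOther Θ e v).S e' = some i at hi
    obtain ⟨u, hu, hc⟩ := newF_ne_none_iff.1 (hi ▸ Option.some_ne_none _)
    rw [newF_eq hu hc] at hi
    cases hF : Θ.F e' with
    | none =>
      rw [hF] at hi
      exact (Option.some.inj hi).symm
    | some j =>
      rw [hF] at hi
      obtain rfl : j = i := Option.some.inj hi
      exact h.temp e' _ he' hF

theorem pathInv_empty : PathInv (Sequent.empty 𝔖.L) := by
  refine ⟨⟨nofun, ⟨List.nodup_nil, fun n => ?_, nofun⟩, fun n => ?_, fun e => ?_⟩, ?_, ?_, nofun,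
    nofun⟩
  · simp [Sequent.empty]
  · simp [Sequent.empty]
  · simp [Sequent.empty]
  · simp [Sequent.empty]
  · intro l n r h
    simp [Sequent.empty] at h

theorem Deduction.isSequent {𝒮 : Set (Sequent 𝔖.L)} {Θ : Sequent 𝔖.L} (d : 𝔖.Deduction 𝒮 Θ) :
    𝔖.IsSequent Θ := by
  cases d <;> assumption

theorem Deduction.HasPath.ne_nil {𝒮 : Set (Sequent 𝔖.L)} {Θ : Sequent 𝔖.L}
    {d : 𝔖.Deduction 𝒮 Θ} {p : List (Sequent 𝔖.L)} (h : d.HasPath p) : p ≠ [] := by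
  cases h <;> exact List.cons_ne_nil _ _

/-- In an `Ω+1`-deduction cuts have rank at most `Ω` and introduce fixed expressions, while `Fr` and
`H` have rank above `Ω`; there is no `CutFr`, as no rank is below `0`. -/
theorem PathInv.of_premise {𝒮 : Set (Sequent 𝔖.L)} {Θ Θ' : Sequent 𝔖.L} {ρ : Rule 𝔖.L}
    {hs : 𝔖.IsSequent Θ} {hρ : 𝔖.Applies Θ ρ}
    {d : ∀ Θ', 𝔖.IsPremise Θ Θ' ρ → 𝔖.Deduction 𝒮 Θ'}
    (hd : (Deduction.infer ρ Θ hs hρ d).IsRDeduction (Ω + 1)) (hp : 𝔖.IsPremise Θ Θ' ρ)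
    (h : PathInv Θ) : PathInv Θ' := by
  obtain ⟨⟨h1, -⟩, ⟨h2, -⟩, ⟨h3, -⟩, ⟨h4, -⟩⟩ := hd
  have hs' := (d Θ' hp).isSequent
  have hlt : ∀ {r : Ordinal.{0}}, Ω + 1 ≤ r → Ω < r := fun h => Order.succ_le_iff.1 h
  cases ρ with
  | cut e =>
    have hle : 𝔖.rk e ≤ Ω := Order.lt_succ_iff.1 h1
    rcases hp with rfl | ⟨u, rfl⟩
    · exact h.add hs' (by simp) fun hgt => absurd hle (not_le.2 hgt)
    · exact h.add hs' (by simp) (by simp)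
  | cutFr e => exact absurd h2 (not_lt.2 (zero_le))
  | cutTerm e =>
    have hle : 𝔖.rk e ≤ Ω := Order.lt_succ_iff.1 h1
    rcases hp with rfl | ⟨u, rfl⟩
    · exact h.add hs' (by simp) fun hgt => absurd hle (not_le.2 hgt)
    · exact h.add hs' (by simp) fun hgt => absurd hle (not_le.2 hgt)
  | cutFrTerm e => exact absurd h2 (not_lt.2 (zero_le))
  | cutForm n =>
    rcases hp with rfl | ⟨Pe, Ve, hp, hh, rfl⟩
    · exact h.add hs' (by simp) fun hgt => absurd hgt (by simp [rk_mem])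
    · exact h.addForm hp hh
  | fr e =>
    have hgt : Ω < 𝔖.rk e := hlt h3
    cases (hp : Θ' = _)
    exact h.add hs' (fun hle => absurd hle (not_le.2 hgt)) (by simp)
  | h e v =>
    have hgt : Ω < 𝔖.rk e := hlt h4
    cases (hp : Θ' = _)
    rw [hStep_of_rk_ne hgt.ne'] at hs' ⊢
    exact h.hOther hs' hgt

theorem PathInv.of_hasPath {𝒮 : Set (Sequent 𝔖.L)} {Θ₀ : Sequent 𝔖.L} {d : 𝔖.Deduction 𝒮 Θ₀}
    {p : List (Sequent 𝔖.L)} (hp : d.HasPath p) (hd : d.IsRDeduction (Ω + 1)) (h : PathInv Θ₀)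
    {Θ : Sequent 𝔖.L} (hlast : p.getLast? = some Θ) : PathInv Θ := by
  induction hp with
  | root d =>
    cases hlast
    exact h
  | @step ρ Θ₀ hs hρ d Θ' hprem l hl ih =>
    refine ih ⟨hd.1.2 Θ' hprem, hd.2.1.2 Θ' hprem, hd.2.2.1.2 Θ' hprem, hd.2.2.2.2 Θ' hprem⟩
      (h.of_premise hd hprem) ?_
    rwa [List.getLast?_cons_of_ne_nil hl.ne_nil] at hlast

end System

end EpsID
end

/-! ### The lemma: from the path to the derivation -/

theorem mainTheorem3 (𝔖 : EpsID.System) (Θ : EpsID.Sequent 𝔖.L)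
    (d : 𝔖.Derivation Θ) (hd : d.IsRDeduction (EpsID.Ω + 1))
    (p : List (EpsID.Sequent 𝔖.L)) (hp : 𝔖.IsRPath (EpsID.Ω + 1) p)
    (hlast : p.getLast? = some Θ)
    (side : ∀ (i : ℕ) (hi : i + 1 < p.length) (e : EpsID.CanExpr 𝔖.L),
      e.IsTerm → 𝔖.rk e = EpsID.Ω → p[i].S e = none → p[i + 1] = p[i].add e .unk (some false) →
      ∀ v : ℕ+, ∃ d' : 𝔖.Derivation ((𝔖.termToT p[i]).add e (.num v) (some false)),
        d'.IsOmegaStar) :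
    ∃ d' : 𝔖.Derivation (𝔖.termToT Θ), d'.IsOmegaStar ∧
      d'.AllAxioms fun Υ => ∀ n v, 𝔖.AxH (𝔖.c n) v Υ → Υ.S (.mem n) = some .top := by
  obtain ⟨𝒮, d₀, hd₀, hpath⟩ := hp
  exact (EpsID.System.PathInv.of_hasPath hpath hd₀ EpsID.System.pathInv_empty
    hlast).inv_termToT.good
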